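/- **Theorem (Uniqueness under small pressure).** Let $B\subset\mathbb{R}^2$ be the open unit disc with polar coordinates $(R,\theta)$ and unit vectors $e_R,e_\theta$. Let $M\in L^\infty(B,\mathbb{R}^{16})$, regarded as a field of linear maps on $\mathbb{R}^{2\times2}$, be symmetric for a.e. $x$, and suppose that for some constant $\nu>0$ one has $M(x)\xi\cdot\xi\ge\nu|\xi|^2$ for a.e. $x\in B$ and all $\xi\in\mathbb{R}^{2\times 2}$ (Frobenius inner product). For $u\in W^{1,2}(B,\mathbb{R}^2)$ put $$E(u)=\int_B M(x)\nabla u\cdot\nabla u\,dx .$$ Let $b\in\mathbb{R}^2$, $g\in W^{1,2}(S^1,\mathbb{R}^2)$ and $$\mathcal{A}^c=\{u\in W^{1,2}(B,\mathbb{R}^2):\ \det\nabla u=1 \text{ a.e. in } B,\ u|_{\partial B}=g+b \text{ in the sense of traces}\}.$$ Let $u\in\mathcal{A}^c$ be a stationary point of $E$ with corresponding pressure $\lambda$: that is, $\lambda\in L^1_{loc}(B)$ has a weak gradient in $L^1_{loc}(B)$ and, for all $\eta\in C_c^\infty(B,\mathbb{R}^2)$, the function $\lambda\,\mathrm{cof}\,\nabla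 u\cdot\nabla\eta$ is integrable and $$\int_B M(x)\nabla u\cdot\nabla\eta\,dx=-\int_B\lambda(x)\,\mathrm{cof}\,\nabla u\cdot\nabla\eta\,dx .$$ For a vector field $f$ on $B$ write $|f(x)|_\ast=\max\{|f(x)\cdot e_R|,|f(x)\cdot e_\theta|\}$, and let $\|f\|_{L^\infty(B,\mathbb{R}^2,dx/R)}$ be the essential supremum of $|f|_\ast$ with respect to the measure $dx/R$. 1. If $$\|R\,\nabla\lambda\|_{L^\infty(B,\mathbb{R}^2,dx/R)}\le\frac{\sqrt3\,\nu}{2\sqrt2},$$ then $u$ is a global minimizer of $E$ in $\mathcal{A}^c$. If moreover $|R\,\nabla\lambda(x)|_\ast<\frac{\sqrt3\,\nu}{2\sqrt2}$ on a measurable set $U\subset B$ of positive $dx/R$-measure, then $u$ is the unique global minimizer of $E$ in $\mathcal{A}^c$. 2. If $\lambda$ depends (up to a null set) only on $R$ or only on $\theta$, then both assertions of 1. hold with $\frac{\sqrt3\,\nu}{2\sqrt2}$ replaced by $\nu$. -/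

import Mathlib

open MeasureTheory Filter Topology
open scoped ContDiff ENNReal

noncomputable section

namespace SmallPressure

/-- The Euclidean plane. -/
abbrev Plane : Type := EuclideanSpace ℝ (Fin 2)

/-- Real `2 × 2` matrices. -/
abbrev Mat2 : Type := Matrix (Fin 2) (Fin 2) ℝ

/-- Fourth order tensors, i.e. linear maps on `2 × 2` matrices, with entries `T (i,j) (k,l)`. -/
abbrev Tensor4 : Type := Matrix (Fin 2 × Fin 2) (Fin 2 × Fin 2) ℝ

/-- The open unit disc `B`. -/
def disc : Set Plane := Metric.ball 0 1

/-- Lebesgue measure `dx` on the disc. -/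
def discMeasure : Measure Plane := volume.restrict disc

/-- The measure `dx / R` on the disc, where `R = ‖x‖`. -/
def discMeasureInvR : Measure Plane :=
  discMeasure.withDensity (fun x => ENNReal.ofReal (‖x‖⁻¹))

/-- The Frobenius inner product `A · B`. -/
def frob (A B : Mat2) : ℝ := ∑ i, ∑ j, A i j * B i j

/-- The cofactor matrix `cof A = (adj A)ᵀ`. -/
def cof (A : Mat2) : Mat2 := A.adjugate.transpose

/-- The action `T ξ` of a fourth order tensor on a matrix. -/
def tensorApply (T : Tensor4) (ξ : Mat2) : Mat2 :=
  Matrix.of fun i j => ∑ k, ∑ l, T (i, j) (k, l) * ξ k l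

/-! ### Weak derivatives and Sobolev spaces on the disc -/

/-- The classical partial derivative `∂ⱼ φ`. -/
def partialDeriv (j : Fin 2) (φ : Plane → ℝ) (x : Plane) : ℝ :=
  fderiv ℝ φ x (EuclideanSpace.single j 1)

/-- `φ ∈ C_c^∞(B)`. -/
def IsTestFunction (φ : Plane → ℝ) : Prop :=
  ContDiff ℝ ∞ φ ∧ HasCompactSupport φ ∧ tsupport φ ⊆ disc

/-- `d` is a weak partial derivative `∂ⱼ w` on the disc. -/
def HasWeakPartial (w : Plane → ℝ) (j : Fin 2) (d : Plane → ℝ) : Prop :=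
  LocallyIntegrableOn w disc ∧ LocallyIntegrableOn d disc ∧
    ∀ φ : Plane → ℝ, IsTestFunction φ →
      ∫ x in disc, w x * partialDeriv j φ x = -∫ x in disc, d x * φ x

/-- `w ∈ L¹_loc(B)` has both weak partial derivatives in `L¹_loc(B)`. -/
def WeaklyDifferentiable (w : Plane → ℝ) : Prop :=
  ∀ j, ∃ d, HasWeakPartial w j d

open Classical in
/-- The weak partial derivative `∂ⱼ w` (unique up to null sets; `0` if there is none). -/
def weakPartial (w : Plane → ℝ) (j : Fin 2) : Plane → ℝ :=
  if h : ∃ d, HasWeakPartial w j d then h.choose else 0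

/-- The weak gradient of a scalar function. -/
def weakGrad (w : Plane → ℝ) (x : Plane) : Plane :=
  WithLp.toLp 2 fun j => weakPartial w j x

/-- The weak gradient of a planar map, `(∇u)ᵢⱼ = ∂ⱼ uᵢ`. -/
def weakJacobian (u : Plane → Plane) (x : Plane) : Mat2 :=
  Matrix.of fun i j => weakPartial (fun y => u y i) j x

/-- The classical gradient of a planar map. -/
def classicalJacobian (η : Plane → Plane) (x : Plane) : Mat2 :=
  Matrix.of fun i j => partialDeriv j (fun y => η y i) x

/-- `w ∈ W^{1,2}(B)`. -/
def MemW12 (w : Plane → ℝ) : Prop :=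
  MemLp w 2 discMeasure ∧ WeaklyDifferentiable w ∧ ∀ j, MemLp (weakPartial w j) 2 discMeasure

/-! ### The boundary circle, parametrised by the angle `θ ∈ (-π, π]` -/

/-- The measure `dθ` on `(-π, π]`, i.e. arc length on `S¹`. -/
def angleMeasure : Measure ℝ := volume.restrict (Set.Ioc (-Real.pi) Real.pi)

/-- The point `(cos θ, sin θ)` of `S¹`. -/
def circlePoint (θ : ℝ) : Plane := !₂[Real.cos θ, Real.sin θ]

/-- `g ∈ W^{1,2}(S¹)`: both `g` and its weak derivative on the circle are square integrable. -/
def MemW12Circle (g : ℝ → ℝ) : Prop :=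
  MemLp g 2 angleMeasure ∧ ∃ g' : ℝ → ℝ, MemLp g' 2 angleMeasure ∧
    ∀ φ : ℝ → ℝ, ContDiff ℝ ∞ φ → Function.Periodic φ (2 * Real.pi) →
      ∫ θ, g θ * deriv φ θ ∂angleMeasure = -∫ θ, g' θ * φ θ ∂angleMeasure

/-- `h ∈ L²(S¹)` is the trace of `w ∈ W^{1,2}(B)` on `S¹ = ∂B`. The trace operator is the
continuous extension to `W^{1,2}(B)` of the restriction map on functions that are smooth up to the
boundary, so this says that some sequence of smooth functions tends to `w` in `W^{1,2}(B)` while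
its restrictions to `S¹` tend to `h` in `L²(S¹)`. -/
def HasTrace (w : Plane → ℝ) (h : ℝ → ℝ) : Prop :=
  ∃ φ : ℕ → Plane → ℝ, (∀ n, ContDiff ℝ ∞ (φ n)) ∧
    Tendsto (fun n => eLpNorm (fun x => φ n x - w x) 2 discMeasure) atTop (𝓝 0) ∧
    (∀ j, Tendsto (fun n => eLpNorm (fun x => partialDeriv j (φ n) x - weakPartial w j x) 2
      discMeasure) atTop (𝓝 0)) ∧
    Tendsto (fun n => eLpNorm (fun θ => φ n (circlePoint θ) - h θ) 2 angleMeasure) atTop (𝓝 0)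

/-! ### The variational problem -/

/-- The quadratic energy `E(u) = ∫_B M(x)∇u · ∇u dx`. -/
def energy (M : Plane → Tensor4) (u : Plane → Plane) : ℝ :=
  ∫ x in disc, frob (tensorApply (M x) (weakJacobian u x)) (weakJacobian u x)

/-- The admissible class: maps in `W^{1,2}(B, ℝ²)` with `det ∇u = 1` a.e. in `B` and
`u = g + b` on `∂B` in the sense of traces. -/
def admissible (g : ℝ → Plane) (b : Plane) : Set (Plane → Plane) :=
  {u | (∀ i, MemW12 (fun x => u x i)) ∧
    (∀ᵐ x ∂discMeasure, (weakJacobian u x).det = 1) ∧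
    ∀ i, HasTrace (fun x => u x i) (fun θ => g θ i + b i)}

/-- `u` minimises the energy in the admissible class. -/
def IsGlobalMinimizer (M : Plane → Tensor4) (g : ℝ → Plane) (b : Plane) (u : Plane → Plane) :
    Prop :=
  u ∈ admissible g b ∧ ∀ v ∈ admissible g b, energy M u ≤ energy M v

/-- `u` is the only minimiser of the energy in the admissible class (up to null sets). -/
def IsUniqueGlobalMinimizer (M : Plane → Tensor4) (g : ℝ → Plane) (b : Plane)
    (u : Plane → Plane) : Prop :=
  IsGlobalMinimizer M g b u ∧ ∀ v, IsGlobalMinimizer M g b v → v =ᵐ[discMeasure] u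

/-- `u` is a stationary point of the constrained problem with corresponding pressure `p`: the weak
Euler-Lagrange equation `∫_B M∇u·∇η dx = -∫_B p cof ∇u·∇η dx` holds for all
`η ∈ C_c^∞(B, ℝ²)`. The integral on the left always exists; that the one on the right exists is
part of the equation. -/
def IsStationaryWithPressure (M : Plane → Tensor4) (u : Plane → Plane) (p : Plane → ℝ) : Prop :=
  ∀ η : Plane → Plane, (∀ i, IsTestFunction (fun x => η x i)) →
    IntegrableOn (fun x => p x * frob (cof (weakJacobian u x)) (classicalJacobian η x)) disc ∧
    ∫ x in disc, frob (tensorApply (M x) (weakJacobian u x)) (classicalJacobian η x) =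
      -∫ x in disc, p x * frob (cof (weakJacobian u x)) (classicalJacobian η x)

/-! ### Size of the pressure gradient -/

/-- The radial component `f · e_R`. -/
def radialPart (f : Plane → Plane) (x : Plane) : ℝ :=
  (f x 0 * x 0 + f x 1 * x 1) / ‖x‖

/-- The angular component `f · e_θ`, where `e_θ = (-x₁, x₀) / ‖x‖`. -/
def angularPart (f : Plane → Plane) (x : Plane) : ℝ :=
  (f x 1 * x 0 - f x 0 * x 1) / ‖x‖

/-- The norm of `L^∞(B, ℝ², dx/R)`: the larger of the essential suprema of `|f · e_R|` and
`|f · e_θ|`. -/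
def polarSupNorm (f : Plane → Plane) : ℝ≥0∞ :=
  max (eLpNorm (radialPart f) ∞ discMeasureInvR) (eLpNorm (angularPart f) ∞ discMeasureInvR)

/-- The vector field `R ∇p`. -/
def scaledGrad (p : Plane → ℝ) (x : Plane) : Plane := ‖x‖ • weakGrad p x

/-- `|R ∇p| < C` on a measurable subset of the disc of positive `dx/R`-measure, the size of a
vector again being the larger of the moduli of its radial and angular components. -/
def StrictOnNontrivialSet (p : Plane → ℝ) (C : ℝ) : Prop :=
  ∃ U ⊆ disc, MeasurableSet U ∧ discMeasureInvR U ≠ 0 ∧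
    ∀ x ∈ U, max |radialPart (scaledGrad p) x| |angularPart (scaledGrad p) x| < C

/-- `p` depends only on the radius `R`. -/
def DependsOnlyOnRadius (p : Plane → ℝ) : Prop :=
  ∃ f : ℝ → ℝ, ∀ᵐ x ∂discMeasure, p x = f ‖x‖

/-- `p` depends only on the angle `θ`, i.e. on the direction `x / ‖x‖`. -/
def DependsOnlyOnAngle (p : Plane → ℝ) : Prop :=
  ∃ f : Plane → ℝ, ∀ᵐ x ∂discMeasure, p x = f (‖x‖⁻¹ • x)

end SmallPressure

end

noncomputable section

namespace SmallPressure

/-! ### Elementary calculus in the plane -/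

/-! For a competitor `v` put `D = ∇v - ∇u`. Since `M` is symmetric, `E(v) = E(u) + ∫ M D·D + 2 ∫
M∇u·D`, and the middle term is at least `ν ∫ |D|²`. Both Jacobian determinants are one, so `cof ∇u ·
D = -det D`, and the Euler-Lagrange equation tested formally with `v - u` turns the last term into
`2 ∫ λ det D`. Everything therefore rests on `2 |∫ λ det D| ≤ ν ∫ |D|²`.

Write `ā` for the mean of `a` over circles about the origin and `{a, b}` for the Jacobian of `(a,
b)`. Radial functions have parallel gradients, so `{ā, b̄} = 0` and `2 {a, b} = {a - ā, b + b̄} + {a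
+ ā, b - b̄}`. This is a curl; integrating by parts puts one derivative on `λ` and leaves a factor
`a - ā` or `b - b̄` in every term (`integral_mul_bracket`). In polar form `R ∂_R λ` multiplies
angular derivatives only, while `∂_θ λ` multiplies radial derivatives of `a + ā`, `b + b̄`.
Wirtinger's inequality on circles (`wirtinger_inequality`, `weighted_wirtinger`) controls `(a -
ā)/R` by `∂_θ a / R`, and orthogonality of mean and fluctuation gives `radialSumEnergy_add_le`.
Young's inequality with a free weight `c` then yields `quadBound`.

Three choices of `c` finish the estimate. With both components of size `K`, `c = 5/4` gives the
factor `13/8`, and `13/8 · √3/(2√2) < 1`. For a radial pressure only angular energy appears, so a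
full radial energy is left over. For an angular pressure `c = 2` leaves over the radial energy of
the fluctuation. A competitor that does not increase the energy forces the leftover term to vanish
in the limit, hence `v = u` by a Poincaré inequality (`integral_sq_le_radialEnergy`); the angular
case needs a second pass with `c = 4`.

Two points make the formal computation rigorous. Equality of traces makes `v - u` a limit of test
maps in `W^{1,2}` (`exists_test_of_hasTrace`). The pressure may be unbounded, so it is truncated by
a scaled arctangent; the weak chain rule keeps the bounds on its scaled gradient, and all estimates
depend on those bounds alone. They are thus uniform in the truncation, which is removed before the
test maps converge (`two_mul_abs_integral_pressure_le`, `exists_test_maps_energy_le`). -/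

theorem Plane.eq_single_add_single (v : Plane) :
    v = v 0 • EuclideanSpace.single 0 1 + v 1 • EuclideanSpace.single 1 1 := by
  ext i
  fin_cases i <;> simp

theorem fderiv_apply_eq (φ : Plane → ℝ) (x v : Plane) :
    fderiv ℝ φ x v = v 0 * partialDeriv 0 φ x + v 1 * partialDeriv 1 φ x := by
  conv_lhs => rw [Plane.eq_single_add_single v]
  simp [partialDeriv]

theorem Plane.norm_sq_eq (x : Plane) : ‖x‖ ^ 2 = x 0 ^ 2 + x 1 ^ 2 := by
  simp [EuclideanSpace.norm_sq_eq, Fin.sum_univ_two]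

theorem _root_.ContDiff.partialDeriv {φ : Plane → ℝ} (h : ContDiff ℝ ∞ φ) (j : Fin 2) :
    ContDiff ℝ ∞ (partialDeriv j φ) :=
  (contDiff_infty_iff_fderiv.1 h).2.clm_apply contDiff_const

theorem _root_.ContDiff.differentiableAt_infty {E F : Type*} [NormedAddCommGroup E] [NormedSpace ℝ E]
    [NormedAddCommGroup F] [NormedSpace ℝ F] {φ : E → F} (h : ContDiff ℝ ∞ φ) (x : E) :
    DifferentiableAt ℝ φ x :=
  (h.differentiable (by simp)) x

theorem contDiff_coord (i : Fin 2) : ContDiff ℝ ∞ (fun x : Plane => x i) :=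
  (EuclideanSpace.proj (𝕜 := ℝ) i).contDiff

@[simp] theorem partialDeriv_coord (i j : Fin 2) (x : Plane) :
    partialDeriv j (fun x : Plane => x i) x = if i = j then 1 else 0 := by
  have h : HasFDerivAt (fun x : Plane => x i) (EuclideanSpace.proj (𝕜 := ℝ) i) x :=
    (EuclideanSpace.proj (𝕜 := ℝ) i).hasFDerivAt
  simp [partialDeriv, h.fderiv]

section rules
variable {φ ψ : Plane → ℝ} {x : Plane} (j : Fin 2)

theorem partialDeriv_add (h : DifferentiableAt ℝ φ x) (h' : DifferentiableAt ℝ ψ x) :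
    partialDeriv j (fun y => φ y + ψ y) x = partialDeriv j φ x + partialDeriv j ψ x := by
  simp [partialDeriv, fderiv_fun_add h h']

theorem partialDeriv_sub (h : DifferentiableAt ℝ φ x) (h' : DifferentiableAt ℝ ψ x) :
    partialDeriv j (fun y => φ y - ψ y) x = partialDeriv j φ x - partialDeriv j ψ x := by
  simp [partialDeriv, fderiv_fun_sub h h']

theorem partialDeriv_mul (h : DifferentiableAt ℝ φ x) (h' : DifferentiableAt ℝ ψ x) :
    partialDeriv j (fun y => φ y * ψ y) x =
      partialDeriv j φ x * ψ x + φ x * partialDeriv j ψ x := by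
  simp [partialDeriv, fderiv_fun_mul h h']
  ring

theorem partialDeriv_const_mul (c : ℝ) (h : DifferentiableAt ℝ φ x) :
    partialDeriv j (fun y => c * φ y) x = c * partialDeriv j φ x := by
  simp [partialDeriv, fderiv_const_mul h]

end rules

theorem partialDeriv_comm {φ : Plane → ℝ} (h : ContDiff ℝ ∞ φ) (x : Plane) :
    partialDeriv 0 (partialDeriv 1 φ) x = partialDeriv 1 (partialDeriv 0 φ) x := by
  have hs : IsSymmSndFDerivAt ℝ φ x := h.contDiffAt.isSymmSndFDerivAt
    (by simpa using (WithTop.coe_le_coe.2 (le_top : (2 : ℕ∞) ≤ ⊤)))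
  have hd : DifferentiableAt ℝ (fderiv ℝ φ) x :=
    (contDiff_infty_iff_fderiv.1 h).2.differentiableAt_infty x
  have key : ∀ i j : Fin 2, partialDeriv i (partialDeriv j φ) x =
      fderiv ℝ (fderiv ℝ φ) x (EuclideanSpace.single i 1) (EuclideanSpace.single j 1) := by
    intro i j
    have := (hd.hasFDerivAt.clm_apply (hasFDerivAt_const (EuclideanSpace.single j (1:ℝ)) x)).fderiv
    show fderiv ℝ (fun y => fderiv ℝ φ y (EuclideanSpace.single j 1)) x _ = _
    rw [this]
    simp
  rw [key, key, hs]

theorem _root_.HasCompactSupport.partialDeriv {φ : Plane → ℝ} (h : HasCompactSupport φ) (j : Fin 2) :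
    HasCompactSupport (partialDeriv j φ) :=
  (h.fderiv ℝ).comp_left (g := fun L : Plane →L[ℝ] ℝ => L (EuclideanSpace.single j 1)) (by simp)

theorem tsupport_partialDeriv_subset (φ : Plane → ℝ) (j : Fin 2) :
    tsupport (partialDeriv j φ) ⊆ tsupport φ := by
  refine (closure_mono ?_).trans (tsupport_fderiv_subset ℝ (f := φ))
  intro x hx h0
  apply hx
  simp [partialDeriv, h0]

theorem integral_partialDeriv_eq_zero {φ : Plane → ℝ} (h : ContDiff ℝ ∞ φ)
    (hc : HasCompactSupport φ) (j : Fin 2) : ∫ x, partialDeriv j φ x = 0 := by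
  have h1 : Integrable (partialDeriv j φ) :=
    (h.partialDeriv j).continuous.integrable_of_hasCompactSupport (hc.partialDeriv j)
  have := integral_mul_fderiv_eq_neg_fderiv_mul_of_integrable (μ := (volume : Measure Plane))
    (f := fun _ : Plane => (1 : ℝ)) (g := φ) (v := EuclideanSpace.single j 1)
    (by simp) (by simp only [one_mul]; exact h1)
    (by simpa using h.continuous.integrable_of_hasCompactSupport hc)
    (fun x _ => by simp) (fun x _ => h.differentiableAt_infty x)
  simpa [SmallPressure.partialDeriv] using this

/-! ### Test functions -/

theorem IsTestFunction.partialDeriv {φ : Plane → ℝ} (h : IsTestFunction φ) (j : Fin 2) :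
    IsTestFunction (partialDeriv j φ) :=
  ⟨h.1.partialDeriv j, h.2.1.partialDeriv j, (tsupport_partialDeriv_subset φ j).trans h.2.2⟩

theorem IsTestFunction.mul_left {φ ψ : Plane → ℝ} (h : IsTestFunction φ) (hψ : ContDiff ℝ ∞ ψ) :
    IsTestFunction (fun x => ψ x * φ x) :=
  ⟨hψ.mul h.1, h.2.1.mul_left, (tsupport_mul_subset_right).trans h.2.2⟩

theorem IsTestFunction.mul_right {φ ψ : Plane → ℝ} (h : IsTestFunction φ) (hψ : ContDiff ℝ ∞ ψ) :
    IsTestFunction (fun x => φ x * ψ x) :=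
  ⟨h.1.mul hψ, h.2.1.mul_right, (tsupport_mul_subset_left).trans h.2.2⟩

theorem IsTestFunction.const_mul {φ : Plane → ℝ} (h : IsTestFunction φ) (c : ℝ) :
    IsTestFunction (fun x => c * φ x) := h.mul_left contDiff_const

theorem IsTestFunction.sub {φ ψ : Plane → ℝ} (h : IsTestFunction φ) (h' : IsTestFunction ψ) :
    IsTestFunction (fun x => φ x - ψ x) :=
  ⟨h.1.sub h'.1, h.2.1.sub h'.2.1,
    (tsupport_sub φ ψ).trans (Set.union_subset h.2.2 h'.2.2)⟩

theorem IsTestFunction.neg {φ : Plane → ℝ} (h : IsTestFunction φ) :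
    IsTestFunction (fun x => - φ x) := by
  simpa using h.const_mul (-1)

theorem IsTestFunction.add {φ ψ : Plane → ℝ} (h : IsTestFunction φ) (h' : IsTestFunction ψ) :
    IsTestFunction (fun x => φ x + ψ x) := by
  simpa using h.sub h'.neg

theorem IsTestFunction.eq_zero {φ : Plane → ℝ} (h : IsTestFunction φ) {x : Plane} (hx : x ∉ disc) :
    φ x = 0 :=
  image_eq_zero_of_notMem_tsupport fun h' => hx (h.2.2 h')

theorem measurableSet_disc : MeasurableSet disc := Metric.isOpen_ball.measurableSet

theorem IsTestFunction.setIntegral_mul {φ : Plane → ℝ} (h : IsTestFunction φ) (f : Plane → ℝ) :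
    ∫ x in disc, f x * φ x = ∫ x, f x * φ x :=
  setIntegral_eq_integral_of_forall_compl_eq_zero fun x hx => by simp [h.eq_zero hx]

/-! ### Smoothness of parametric integrals -/

/-- Differentiation under the integral, dominated by a constant on compact sets. The derivative is
again an integral of a jointly smooth function, now with values in linear maps; the induction on the
order therefore has to let `F` vary, and it carries the derivative formula along. -/
theorem contDiff_nat_intervalIntegral (n : ℕ) : ∀ {E F : Type} [NormedAddCommGroup E]
    [NormedSpace ℝ E] [FiniteDimensional ℝ E] [NormedAddCommGroup F] [NormedSpace ℝ F]
    {f : E → ℝ → F} (_ : ContDiff ℝ ∞ (fun q : E × ℝ => f q.1 q.2)) (a b : ℝ),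
    ContDiff ℝ n (fun x => ∫ t in a..b, f x t) ∧
    ∀ x, HasFDerivAt (fun x => ∫ t in a..b, f x t) (∫ t in a..b, fderiv ℝ (fun y => f y t) x) x := by
  induction n with
  | zero => ?_
  | succ n ih => ?_
  all_goals
    intro E F _ _ _ _ _ f hf a b
    have hc : Continuous (fun q : E × ℝ => f q.1 q.2) := hf.continuous
    have hf' : ContDiff ℝ ∞ (fun q : E × ℝ => fderiv ℝ (fun y => f y q.2) q.1) := by
      have : ContDiff ℝ ∞ (Function.uncurry fun (q : E × ℝ) (y : E) => f y q.2) :=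
        hf.comp (contDiff_snd.prodMk (contDiff_snd.comp contDiff_fst))
      exact this.fderiv contDiff_fst (by simp)
    have hd : ∀ x, HasFDerivAt (fun x => ∫ t in a..b, f x t)
        (∫ t in a..b, fderiv ℝ (fun y => f y t) x) x := by
      intro x₀
      obtain ⟨C, hC⟩ := ((isCompact_closedBall x₀ 1).prod
        (isCompact_uIcc (a := a) (b := b))).exists_bound_of_continuousOn hf'.continuous.continuousOn
      refine intervalIntegral.hasFDerivAt_integral_of_dominated_of_fderiv_le (𝕜 := ℝ) (μ := volume)
        (F := f) (F' := fun x t => fderiv ℝ (fun y => f y t) x) (bound := fun _ => C) (Metric.ball_mem_nhds x₀ one_pos)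
        (Eventually.of_forall fun x => ?_) ?_ ?_ ?_ ?_ ?_
      · exact (hc.comp (by fun_prop : Continuous fun t : ℝ => (x, t))).aestronglyMeasurable
      · exact (hc.comp (by fun_prop : Continuous fun t : ℝ => (x₀, t))).intervalIntegrable a b
      · exact (hf'.continuous.comp
          (by fun_prop : Continuous fun t : ℝ => (x₀, t))).aestronglyMeasurable
      · refine Eventually.of_forall fun t ht x hx => ?_
        exact hC (x, t) ⟨Metric.ball_subset_closedBall hx, Set.uIoc_subset_uIcc ht⟩
      · simp
      · refine Eventually.of_forall fun t _ x _ => ?_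
        exact ((hf.comp (contDiff_id.prodMk contDiff_const) :
          ContDiff ℝ ∞ (fun y => f y t)).differentiableAt_infty x).hasFDerivAt
    refine ⟨?_, hd⟩
  · exact contDiff_zero.2 (continuous_iff_continuousAt.2 fun x => (hd x).continuousAt)
  · rw [Nat.cast_add, Nat.cast_one, contDiff_succ_iff_fderiv]
    refine ⟨fun x => (hd x).differentiableAt, by simp, ?_⟩
    rw [funext fun x => (hd x).fderiv]
    exact (ih hf' a b).1

theorem contDiff_intervalIntegral {E F : Type} [NormedAddCommGroup E]
    [NormedSpace ℝ E] [FiniteDimensional ℝ E] [NormedAddCommGroup F] [NormedSpace ℝ F]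
    {f : E → ℝ → F} (hf : ContDiff ℝ ∞ (fun q : E × ℝ => f q.1 q.2)) (a b : ℝ) :
    ContDiff ℝ ∞ (fun x => ∫ t in a..b, f x t) :=
  contDiff_infty.2 fun n => (contDiff_nat_intervalIntegral n hf a b).1

/-! ### Rotations and circular means -/

/-- The rotation by the angle `α`, as a function. -/
def rotFun (α : ℝ) (x : Plane) : Plane :=
  !₂[Real.cos α * x 0 - Real.sin α * x 1, Real.sin α * x 0 + Real.cos α * x 1]

theorem rotFun_rotFun (α β : ℝ) (x : Plane) : rotFun α (rotFun β x) = rotFun (α + β) x := by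
  ext i
  fin_cases i <;> simp [rotFun, Real.cos_add, Real.sin_add] <;> ring

theorem rotFun_zero (x : Plane) : rotFun 0 x = x := by
  ext i
  fin_cases i <;> simp [rotFun]

/-- The rotation of the plane by the angle `α`. -/
def rot (α : ℝ) : Plane ≃ₗᵢ[ℝ] Plane where
  toFun := rotFun α
  invFun := rotFun (-α)
  map_add' x y := by ext i; fin_cases i <;> simp [rotFun] <;> ring
  map_smul' c x := by ext i; fin_cases i <;> simp [rotFun] <;> ring
  left_inv x := by rw [rotFun_rotFun]; simp [rotFun_zero]
  right_inv x := by rw [rotFun_rotFun]; simp [rotFun_zero]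
  norm_map' x := by
    refine (sq_eq_sq₀ (norm_nonneg _) (norm_nonneg _)).1 ?_
    rw [Plane.norm_sq_eq, Plane.norm_sq_eq]
    simp only [LinearEquiv.coe_mk, LinearMap.coe_mk, AddHom.coe_mk, rotFun]
    simp only [Matrix.cons_val_zero, Matrix.cons_val_one]
    linear_combination (x 0 ^ 2 + x 1 ^ 2) * Real.sin_sq_add_cos_sq α

theorem rot_apply (α : ℝ) (x : Plane) : rot α x =
    !₂[Real.cos α * x 0 - Real.sin α * x 1, Real.sin α * x 0 + Real.cos α * x 1] := rfl

@[simp] theorem rot_apply_zero (α : ℝ) (x : Plane) :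
    rot α x 0 = Real.cos α * x 0 - Real.sin α * x 1 := rfl

@[simp] theorem rot_apply_one (α : ℝ) (x : Plane) :
    rot α x 1 = Real.sin α * x 0 + Real.cos α * x 1 := rfl

theorem rot_rot (α β : ℝ) (x : Plane) : rot α (rot β x) = rot (α + β) x := rotFun_rotFun α β x

@[simp] theorem rot_zero (x : Plane) : rot 0 x = x := rotFun_zero x

theorem periodic_rot (x : Plane) : Function.Periodic (fun α => rot α x) (2 * Real.pi) := by
  intro α
  simp [rot_apply]

/-- In this form joint smoothness in the angle and the point is visible. -/
theorem rot_eq_smul_add_smul (α : ℝ) (x : Plane) :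
    rot α x = Real.cos α • x + Real.sin α • (!₂[-x 1, x 0] : Plane) := by
  ext i
  fin_cases i
  · simp
    ring
  · simp
    ring

theorem contDiff_rot : ContDiff ℝ ∞ (fun q : Plane × ℝ => rot q.2 q.1) := by
  simp only [rot_eq_smul_add_smul]
  have h : ContDiff ℝ ∞ (fun x : Plane => (!₂[-x 1, x 0] : Plane)) := by
    rw [contDiff_euclidean]
    exact Fin.forall_fin_two.2 ⟨(contDiff_coord 1).neg, contDiff_coord 0⟩
  exact ((Real.contDiff_cos.comp contDiff_snd).smul contDiff_fst).add
    ((Real.contDiff_sin.comp contDiff_snd).smul (h.comp contDiff_fst))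

theorem continuous_rot_left (x : Plane) : Continuous fun α => rot α x := by
  simp only [rot_eq_smul_add_smul]
  fun_prop

/-- The radial derivative `R ∂_R φ = x · ∇φ`. -/
def dR (φ : Plane → ℝ) (x : Plane) : ℝ := x 0 * partialDeriv 0 φ x + x 1 * partialDeriv 1 φ x

/-- The angular derivative `∂_θ φ`. -/
def dTheta (φ : Plane → ℝ) (x : Plane) : ℝ :=
  x 0 * partialDeriv 1 φ x - x 1 * partialDeriv 0 φ x

theorem dR_eq_fderiv (φ : Plane → ℝ) (x : Plane) : dR φ x = fderiv ℝ φ x x :=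
  (fderiv_apply_eq φ x x).symm

theorem dR_sq_add_dTheta_sq (φ : Plane → ℝ) (x : Plane) : dR φ x ^ 2 + dTheta φ x ^ 2 =
    ‖x‖ ^ 2 * (partialDeriv 0 φ x ^ 2 + partialDeriv 1 φ x ^ 2) := by
  rw [Plane.norm_sq_eq, dR, dTheta]
  ring

theorem _root_.ContDiff.dR {φ : Plane → ℝ} (h : ContDiff ℝ ∞ φ) : ContDiff ℝ ∞ (dR φ) :=
  ((contDiff_coord 0).mul (h.partialDeriv 0)).add ((contDiff_coord 1).mul (h.partialDeriv 1))

theorem _root_.ContDiff.dTheta {φ : Plane → ℝ} (h : ContDiff ℝ ∞ φ) : ContDiff ℝ ∞ (dTheta φ) :=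
  ((contDiff_coord 0).mul (h.partialDeriv 1)).sub ((contDiff_coord 1).mul (h.partialDeriv 0))

theorem hasDerivAt_comp_rot {φ : Plane → ℝ} (h : ContDiff ℝ ∞ φ) (x : Plane) (α : ℝ) :
    HasDerivAt (fun α => φ (rot α x)) (dTheta φ (rot α x)) α := by
  have h1 : HasDerivAt (fun α => rot α x)
      (-Real.sin α • x + Real.cos α • (!₂[-x 1, x 0] : Plane)) α := by
    simp only [rot_eq_smul_add_smul]
    exact ((Real.hasDerivAt_cos α).smul_const x).add ((Real.hasDerivAt_sin α).smul_const _)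
  have h2 := (h.differentiableAt_infty (rot α x)).hasFDerivAt.comp_hasDerivAt α h1
  refine h2.congr_deriv ?_
  rw [fderiv_apply_eq]
  simp [dTheta]
  ring

/-- The mean of `φ` over the circle through `x` centred at the origin. -/
def circMean (φ : Plane → ℝ) (x : Plane) : ℝ :=
  (2 * Real.pi)⁻¹ * ∫ α in (-Real.pi)..Real.pi, φ (rot α x)

/-- Rotating the base point shifts the variable of a `2π`-periodic integrand integrated over one
period. -/
theorem circMean_rot (φ : Plane → ℝ) (β : ℝ) (x : Plane) : circMean φ (rot β x) = circMean φ x := by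
  have hper : Function.Periodic (fun α => φ (rot α x)) (2 * Real.pi) := fun α => by
    simp only [periodic_rot x α]
  have h := hper.intervalIntegral_add_eq (-Real.pi + β) (-Real.pi)
  simp only [circMean, rot_rot]
  rw [intervalIntegral.integral_comp_add_right (fun α => φ (rot α x))]
  rw [show Real.pi + β = -Real.pi + β + 2 * Real.pi by ring, h]
  congr 3
  ring

theorem contDiff_comp_rot {φ : Plane → ℝ} (h : ContDiff ℝ ∞ φ) :
    ContDiff ℝ ∞ (fun q : Plane × ℝ => φ (rot q.2 q.1)) := h.comp contDiff_rot

theorem _root_.ContDiff.circMean {φ : Plane → ℝ} (h : ContDiff ℝ ∞ φ) :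
    ContDiff ℝ ∞ (circMean φ) :=
  contDiff_const.mul (contDiff_intervalIntegral
    (f := fun x α => φ (rot α x)) (contDiff_comp_rot h) _ _)

/-- Rotations are linear, so the derivative of `φ ∘ rot α` at `x` in direction `x` is the derivative
of `φ` at `rot α x` in direction `rot α x`: the Euler field commutes with rotations, hence with
averaging over them. -/
theorem dR_circMean {φ : Plane → ℝ} (h : ContDiff ℝ ∞ φ) (x : Plane) :
    dR (circMean φ) x = circMean (dR φ) x := by
  have h1 := ((contDiff_nat_intervalIntegral 0
    (f := fun x α => φ (rot α x)) (contDiff_comp_rot h) (-Real.pi) Real.pi).2 x).const_mul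
      ((2 * Real.pi)⁻¹)
  rw [dR_eq_fderiv]
  have h2 : fderiv ℝ (circMean φ) x = _ := h1.fderiv
  rw [h2, circMean, smul_apply, smul_eq_mul]
  congr 1
  have hf' : ContDiff ℝ ∞ (fun q : Plane × ℝ => fderiv ℝ (fun y => φ (rot q.2 y)) q.1) := by
    have : ContDiff ℝ ∞ (Function.uncurry fun (q : Plane × ℝ) (y : Plane) => φ (rot q.2 y)) :=
      (contDiff_comp_rot h).comp (contDiff_snd.prodMk (contDiff_snd.comp contDiff_fst))
    exact this.fderiv contDiff_fst (by simp)
  rw [ContinuousLinearMap.intervalIntegral_apply]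
  · refine intervalIntegral.integral_congr fun α _ => ?_
    have h3 : HasFDerivAt (fun y => φ (rot α y))
        ((fderiv ℝ φ (rot α x)).comp
          ((rot α).toContinuousLinearEquiv : Plane →L[ℝ] Plane)) x :=
      (h.differentiableAt_infty _).hasFDerivAt.comp x
        ((rot α).toContinuousLinearEquiv : Plane →L[ℝ] Plane).hasFDerivAt
    simp only [h3.fderiv, dR_eq_fderiv]
    rfl
  · exact (hf'.continuous.comp
      (by fun_prop : Continuous fun t : ℝ => (x, t))).intervalIntegrable _ _

theorem dTheta_circMean {φ : Plane → ℝ} (h : ContDiff ℝ ∞ φ) (x : Plane) :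
    dTheta (circMean φ) x = 0 := by
  have h1 := hasDerivAt_comp_rot h.circMean x 0
  simp only [circMean_rot, rot_zero] at h1
  exact h1.unique (hasDerivAt_const _ _)

theorem norm_rot (α : ℝ) (x : Plane) : ‖rot α x‖ = ‖x‖ := (rot α).norm_map x

theorem rot_mem_disc {α : ℝ} {x : Plane} : rot α x ∈ disc ↔ x ∈ disc := by
  simp [disc]

theorem exists_tsupport_subset_closedBall {φ : Plane → ℝ} (h : IsTestFunction φ) :
    ∃ r, 0 < r ∧ r < 1 ∧ tsupport φ ⊆ Metric.closedBall 0 r := by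
  rcases (tsupport φ).eq_empty_or_nonempty with he | hne
  · exact ⟨1 / 2, by norm_num, by norm_num, by simp [he]⟩
  · obtain ⟨y, hy, hmax⟩ := IsCompact.exists_isMaxOn h.2.1 hne continuous_norm.continuousOn
    have hy1 : ‖y‖ < 1 := by simpa [disc] using h.2.2 hy
    refine ⟨(‖y‖ + 1) / 2, by positivity, by linarith, fun x hx => ?_⟩
    have : ‖x‖ ≤ ‖y‖ := hmax hx
    simp only [Metric.mem_closedBall, dist_zero_right]
    linarith

theorem isTestFunction_of_forall_eq_zero {φ : Plane → ℝ} (h : ContDiff ℝ ∞ φ) {r : ℝ} (hr : r < 1)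
    (h0 : ∀ x, r < ‖x‖ → φ x = 0) : IsTestFunction φ := by
  have hs : tsupport φ ⊆ Metric.closedBall 0 r := by
    refine closure_minimal (fun x hx => ?_) Metric.isClosed_closedBall
    by_contra hx'
    exact hx (h0 x (by simpa using hx'))
  refine ⟨h, HasCompactSupport.of_support_subset_isCompact (isCompact_closedBall 0 r)
    (subset_closure.trans hs), hs.trans fun x hx => ?_⟩
  simp only [Metric.mem_closedBall, dist_zero_right] at hx
  simp only [disc, Metric.mem_ball, dist_zero_right]
  linarith

theorem IsTestFunction.circMean {φ : Plane → ℝ} (h : IsTestFunction φ) :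
    IsTestFunction (circMean φ) := by
  obtain ⟨r, _, hr, hs⟩ := exists_tsupport_subset_closedBall h
  refine isTestFunction_of_forall_eq_zero h.1.circMean hr fun x hx => ?_
  have : ∀ α, φ (rot α x) = 0 := fun α => image_eq_zero_of_notMem_tsupport fun h' => by
    have := hs h'
    simp at this
    linarith
  simp [SmallPressure.circMean, this]

/-! ### Wirtinger's inequality -/

/-- Parseval: by periodicity the `n`-th Fourier coefficient of `f'` is `i n` times that of `f`, and
`|n| ≥ 1` for every mode except the zeroth, which vanishes because the mean is zero. -/
theorem wirtinger_inequality {f f' : ℝ → ℝ} (hf : ∀ t, HasDerivAt f (f' t) t)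
    (hf' : Continuous f') (hper : f Real.pi = f (-Real.pi))
    (hmean : ∫ t in (-Real.pi)..Real.pi, f t = 0) :
    ∫ t in (-Real.pi)..Real.pi, f t ^ 2 ≤ ∫ t in (-Real.pi)..Real.pi, f' t ^ 2 := by
  have hab : -Real.pi < Real.pi := by linarith [Real.pi_pos]
  have hfc : Continuous f := continuous_iff_continuousAt.2 fun t => (hf t).continuousAt
  set F : ℝ → ℂ := fun t => (f t : ℂ)
  set F' : ℝ → ℂ := fun t => (f' t : ℂ)
  have hFc : Continuous F := Complex.continuous_ofReal.comp hfc
  have hF'c : Continuous F' := Complex.continuous_ofReal.comp hf'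
  have hmem : ∀ G : ℝ → ℂ, Continuous G →
      MemLp G 2 (volume.restrict (Set.Ioc (-Real.pi) Real.pi)) := fun G hG =>
    (memLp_two_iff_integrable_sq_norm hG.aestronglyMeasurable).2
      (hG.norm.pow 2).integrableOn_Ioc
  have h1 := hasSum_sq_fourierCoeffOn hab (hmem F hFc)
  have h2 := hasSum_sq_fourierCoeffOn hab (hmem F' hF'c)
  have hle : ∀ n : ℤ, ‖fourierCoeffOn hab F n‖ ^ 2 ≤ ‖fourierCoeffOn hab F' n‖ ^ 2 := by
    intro n
    rcases eq_or_ne n 0 with rfl | hn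
    · have : fourierCoeffOn hab F 0 = 0 := by
        rw [fourierCoeffOn_eq_integral]
        simp [F, intervalIntegral.integral_ofReal, hmean]
      rw [this]
      simp
    · have hd : ∀ t, HasDerivAt F (F' t) t := fun t => (hf t).ofReal_comp
      rw [fourierCoeffOn_of_hasDerivAt hab hn (fun t _ => hd t) (hF'c.intervalIntegrable _ _)]
      have hF0 : F Real.pi - F (-Real.pi) = 0 := by simp [F, hper]
      rw [hF0]
      have hpi := Real.pi_pos
      have hnorm : ‖(1 / (-2 * Real.pi * Complex.I * n) : ℂ) *
          (fourier (-n) ((-Real.pi : ℝ) : AddCircle (Real.pi - -Real.pi)) * 0 -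
            ((Real.pi : ℝ) - ((-Real.pi : ℝ) : ℂ)) * fourierCoeffOn hab F' n)‖ =
          |(n : ℝ)|⁻¹ * ‖fourierCoeffOn hab F' n‖ := by
        have : (1 / (-2 * Real.pi * Complex.I * n) : ℂ) *
          (fourier (-n) ((-Real.pi : ℝ) : AddCircle (Real.pi - -Real.pi)) * 0 -
            ((Real.pi : ℝ) - ((-Real.pi : ℝ) : ℂ)) * fourierCoeffOn hab F' n) =
            (n : ℂ)⁻¹ * (Complex.I⁻¹ * fourierCoeffOn hab F' n) := by
          have : (Real.pi : ℂ) ≠ 0 := by exact_mod_cast hpi.ne'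
          have : (n : ℂ) ≠ 0 := by exact_mod_cast hn
          push_cast
          field_simp
          ring
        rw [this, norm_mul, norm_mul, norm_inv, norm_inv, Complex.norm_I]
        simp
      rw [hnorm]
      have hn1 : (1 : ℝ) ≤ |(n : ℝ)| := by exact_mod_cast Int.one_le_abs hn
      have : |(n : ℝ)|⁻¹ * ‖fourierCoeffOn hab F' n‖ ≤ 1 * ‖fourierCoeffOn hab F' n‖ :=
        mul_le_mul_of_nonneg_right (inv_le_one_of_one_le₀ hn1) (norm_nonneg _)
      rw [one_mul] at this
      exact pow_le_pow_left₀ (by positivity) this 2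
  have h3 := hasSum_le hle h1 h2
  simp only [smul_eq_mul, F, F', Complex.norm_real, Real.norm_eq_abs, sq_abs] at h3
  exact le_of_mul_le_mul_left h3 (inv_pos.2 (by linarith))

/-! ### Averaging over rotations -/

theorem lintegral_disc_comp_rot (h : Plane → ℝ≥0∞) (α : ℝ) :
    ∫⁻ x in disc, h (rot α x) = ∫⁻ x in disc, h x := by
  have hmp := (rot α).measurePreserving
  have hpre : (rot α) ⁻¹' disc = disc := by
    ext x
    exact rot_mem_disc
  have := hmp.setLIntegral_comp_preimage_emb (rot α).toHomeomorph.measurableEmbedding h disc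
  rw [hpre] at this
  exact this

/-- Tonelli and rotation invariance of the disc. Averaging over all rotations transfers inequalities
on circles to the disc without polar coordinates. -/
theorem lintegral_disc_eq_lintegral_rot {h : Plane → ℝ≥0∞} (hh : Measurable h) :
    ENNReal.ofReal (2 * Real.pi) * ∫⁻ x in disc, h x =
      ∫⁻ x in disc, ∫⁻ α in Set.Ioc (-Real.pi) Real.pi, h (rot α x) := by
  rw [lintegral_lintegral_swap]
  · simp only [lintegral_disc_comp_rot, lintegral_const, Measure.restrict_apply_univ,
      Real.volume_Ioc]
    rw [mul_comm]
    congr 2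
    ring
  · exact (hh.comp contDiff_rot.continuous.measurable).aemeasurable

/-- Inequalities between integrals over circles integrate to inequalities on the disc, with any
rotation invariant weight. -/
theorem weighted_integral_mono_of_circle {w g₁ g₂ : Plane → ℝ} (hw : Measurable w)
    (hw0 : ∀ x, 0 ≤ w x) (hwr : ∀ α x, w (rot α x) = w x) (hg₁ : Continuous g₁)
    (hg₂ : Continuous g₂) (h₁ : ∀ x, 0 ≤ g₁ x) (h₂ : ∀ x, 0 ≤ g₂ x)
    (h : ∀ x, ∫ α in (-Real.pi)..Real.pi, g₁ (rot α x) ≤ ∫ α in (-Real.pi)..Real.pi, g₂ (rot α x))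
    (hint : IntegrableOn (fun x => w x * g₂ x) disc) :
    IntegrableOn (fun x => w x * g₁ x) disc ∧
      ∫ x in disc, w x * g₁ x ≤ ∫ x in disc, w x * g₂ x := by
  have hpi : -Real.pi ≤ Real.pi := by linarith [Real.pi_pos]
  have hcirc : ∀ g : Plane → ℝ, Continuous g → (∀ x, 0 ≤ g x) → ∀ x,
      ∫⁻ α in Set.Ioc (-Real.pi) Real.pi, ENNReal.ofReal (w (rot α x) * g (rot α x)) =
        ENNReal.ofReal (w x) * ENNReal.ofReal (∫ α in (-Real.pi)..Real.pi, g (rot α x)) := by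
    intro g hg hg0 x
    have hc : Continuous fun α => g (rot α x) := hg.comp (continuous_rot_left x)
    rw [intervalIntegral.integral_of_le hpi, ofReal_integral_eq_lintegral_ofReal
      hc.integrableOn_Ioc (Eventually.of_forall fun α => hg0 _)]
    rw [← lintegral_const_mul _ hc.measurable.ennreal_ofReal]
    simp only [hwr, ENNReal.ofReal_mul (hw0 x)]
  have hmeas : ∀ g : Plane → ℝ, Continuous g →
      Measurable fun x => ENNReal.ofReal (w x * g x) := fun g hg =>
    (hw.mul hg.measurable).ennreal_ofReal
  -- Lower integrals are compared, because the integrability of `w * g₁` is itself part of the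
  -- conclusion.
  have hle : ∫⁻ x in disc, ENNReal.ofReal (w x * g₁ x) ≤
      ∫⁻ x in disc, ENNReal.ofReal (w x * g₂ x) := by
    have hc : ENNReal.ofReal (2 * Real.pi) ≠ 0 := by simp [Real.pi_pos]
    rw [← ENNReal.mul_le_mul_iff_right hc ENNReal.ofReal_ne_top,
      lintegral_disc_eq_lintegral_rot (hmeas g₁ hg₁), lintegral_disc_eq_lintegral_rot (hmeas g₂ hg₂)]
    refine lintegral_mono fun x => ?_
    simp only [hcirc g₁ hg₁ h₁, hcirc g₂ hg₂ h₂]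
    gcongr
    exact h x
  have hnn₁ : ∀ x, 0 ≤ w x * g₁ x := fun x => mul_nonneg (hw0 x) (h₁ x)
  have hnn₂ : ∀ x, 0 ≤ w x * g₂ x := fun x => mul_nonneg (hw0 x) (h₂ x)
  have hfin := (hasFiniteIntegral_iff_ofReal (Eventually.of_forall hnn₂)).1 hint.2
  have hint₁ : IntegrableOn (fun x => w x * g₁ x) disc :=
    ⟨(hw.mul hg₁.measurable).aestronglyMeasurable,
      (hasFiniteIntegral_iff_ofReal (Eventually.of_forall hnn₁)).2 (hle.trans_lt hfin)⟩
  refine ⟨hint₁, ?_⟩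
  rw [integral_eq_lintegral_of_nonneg_ae (Eventually.of_forall hnn₁) hint₁.1,
    integral_eq_lintegral_of_nonneg_ae (Eventually.of_forall hnn₂) hint.1]
  exact ENNReal.toReal_mono hfin.ne hle

theorem integral_sub_circMean (φ : Plane → ℝ) (h : Continuous φ) (x : Plane) :
    ∫ α in (-Real.pi)..Real.pi, (φ (rot α x) - circMean φ (rot α x)) = 0 := by
  have hc : Continuous fun α => φ (rot α x) := h.comp (continuous_rot_left x)
  simp only [circMean_rot]
  rw [intervalIntegral.integral_sub (hc.intervalIntegrable _ _) (by simp)]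
  simp only [intervalIntegral.integral_const, circMean, smul_eq_mul]
  field_simp
  ring

/-- Wirtinger's inequality on circles, integrated against a rotation invariant weight. -/
theorem weighted_wirtinger {w φ : Plane → ℝ} (hw : Measurable w)
    (hw0 : ∀ x, 0 ≤ w x) (hwr : ∀ α x, w (rot α x) = w x) (hφ : ContDiff ℝ ∞ φ)
    (hint : IntegrableOn (fun x => w x * dTheta φ x ^ 2) disc) :
    IntegrableOn (fun x => w x * (φ x - circMean φ x) ^ 2) disc ∧
      ∫ x in disc, w x * (φ x - circMean φ x) ^ 2 ≤ ∫ x in disc, w x * dTheta φ x ^ 2 := by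
  refine weighted_integral_mono_of_circle hw hw0 hwr
    ((hφ.continuous.sub hφ.circMean.continuous).pow 2) (hφ.dTheta.continuous.pow 2)
    (fun x => sq_nonneg _) (fun x => sq_nonneg _) (fun x => ?_) hint
  refine wirtinger_inequality (f := fun α => φ (rot α x) - circMean φ (rot α x)) (fun α => ?_)
    (hφ.dTheta.continuous.comp (continuous_rot_left x)) ?_ (integral_sub_circMean φ hφ.continuous x)
  · have := (hasDerivAt_comp_rot hφ x α).sub_const (circMean φ x)
    simpa only [circMean_rot] using this
  · simp only [circMean_rot]
    have := periodic_rot x (-Real.pi)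
    rw [show -Real.pi + 2 * Real.pi = Real.pi by ring] at this
    simp only [this]

/-- The decomposition of the `L²` norm along circles into mean and fluctuation, integrated against
a rotation invariant weight. -/
theorem weighted_circMean_sq_le {w ψ : Plane → ℝ} (hw : Measurable w)
    (hw0 : ∀ x, 0 ≤ w x) (hwr : ∀ α x, w (rot α x) = w x) (hψ : ContDiff ℝ ∞ ψ)
    (hint : IntegrableOn (fun x => w x * (4 * ψ x ^ 2)) disc) :
    IntegrableOn (fun x => w x * ((ψ x + circMean ψ x) ^ 2 + 3 * (ψ x - circMean ψ x) ^ 2)) disc ∧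
      ∫ x in disc, w x * ((ψ x + circMean ψ x) ^ 2 + 3 * (ψ x - circMean ψ x) ^ 2) ≤
        ∫ x in disc, w x * (4 * ψ x ^ 2) := by
  have hc := hψ.continuous
  have hm := hψ.circMean.continuous
  refine weighted_integral_mono_of_circle hw hw0 hwr (by fun_prop) (by fun_prop)
    (fun x => by positivity) (fun x => by positivity) (fun x => le_of_eq ?_) hint
  have hcx : Continuous fun α => ψ (rot α x) := hc.comp (continuous_rot_left x)
  have h0 := integral_sub_circMean ψ hc x
  simp only [circMean_rot] at h0 ⊢
  -- The last term has zero integral over the circle, so the two sides of the inequality agree on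
  -- every circle.
  have : ∀ α, (ψ (rot α x) + circMean ψ x) ^ 2 + 3 * (ψ (rot α x) - circMean ψ x) ^ 2 =
      4 * ψ (rot α x) ^ 2 - 4 * circMean ψ x * (ψ (rot α x) - circMean ψ x) := fun α => by ring
  simp only [this]
  rw [intervalIntegral.integral_sub, intervalIntegral.integral_const_mul (4 * circMean ψ x), h0]
  · simp
  · exact (continuous_const.mul (hcx.pow 2)).intervalIntegrable _ _
  · exact (continuous_const.mul (hcx.sub continuous_const)).intervalIntegrable _ _

/-! ### Integrability on the disc -/

instance : IsFiniteMeasure discMeasure :=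
  ⟨by simp [discMeasure, disc]⟩

theorem integrableOn_disc_of_continuous {f : Plane → ℝ} (hf : Continuous f) :
    IntegrableOn f disc :=
  (hf.continuousOn.integrableOn_compact (isCompact_closedBall 0 1)).mono_set
    Metric.ball_subset_closedBall

theorem exists_bound_on_disc {f : Plane → ℝ} (hf : Continuous f) :
    ∃ C, ∀ x ∈ disc, |f x| ≤ C := by
  obtain ⟨C, hC⟩ := (isCompact_closedBall (0 : Plane) 1).exists_bound_of_continuousOn
    hf.continuousOn
  exact ⟨C, fun x hx => hC x (Metric.ball_subset_closedBall hx)⟩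

theorem integrable_discMeasure_of_bound {f : Plane → ℝ} (hf : AEStronglyMeasurable f discMeasure)
    {C : ℝ} (hC : ∀ x ∈ disc, |f x| ≤ C) : Integrable f discMeasure := by
  refine Integrable.of_bound hf C ?_
  exact ae_restrict_of_forall_mem measurableSet_disc hC

theorem LocallyIntegrableOn.integrableOn_mul_test {f φ : Plane → ℝ}
    (hf : LocallyIntegrableOn f disc) (hφ : IsTestFunction φ) :
    IntegrableOn (fun x => f x * φ x) disc := by
  have h1 : IntegrableOn f (tsupport φ) := hf.integrableOn_compact_subset hφ.2.2 hφ.2.1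
  have h2 : IntegrableOn (fun x => f x * φ x) (tsupport φ) :=
    h1.mul_continuousOn hφ.1.continuous.continuousOn hφ.2.1
  refine IntegrableOn.of_forall_sdiff_eq_zero h2 measurableSet_disc fun x hx => ?_
  rw [image_eq_zero_of_notMem_tsupport hx.2, mul_zero]

/-! ### The weight `R⁻²` -/

/-- The weight `R⁻²`. -/
def invSq (x : Plane) : ℝ := (‖x‖ ^ 2)⁻¹

theorem measurable_invSq : Measurable invSq := by unfold invSq; fun_prop

theorem invSq_nonneg (x : Plane) : 0 ≤ invSq x := by unfold invSq; positivity

theorem invSq_rot (α : ℝ) (x : Plane) : invSq (rot α x) = invSq x := by simp [invSq]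

theorem invSq_mul_norm_sq {x : Plane} (hx : x ≠ 0) : invSq x * ‖x‖ ^ 2 = 1 := by
  have : ‖x‖ ≠ 0 := norm_ne_zero_iff.2 hx
  unfold invSq
  field_simp

theorem ae_ne_zero : ∀ᵐ x ∂discMeasure, x ≠ 0 :=
  ae_restrict_of_ae (Measure.ae_ne volume 0)

theorem invSq_mul_dR_add_dTheta {φ : Plane → ℝ} {x : Plane} (hx : x ≠ 0) :
    invSq x * dR φ x ^ 2 + invSq x * dTheta φ x ^ 2 =
      partialDeriv 0 φ x ^ 2 + partialDeriv 1 φ x ^ 2 := by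
  rw [← mul_add, dR_sq_add_dTheta_sq, ← mul_assoc, invSq_mul_norm_sq hx, one_mul]

theorem invSq_mul_le {φ : Plane → ℝ} (x : Plane) :
    invSq x * dR φ x ^ 2 + invSq x * dTheta φ x ^ 2 ≤
      partialDeriv 0 φ x ^ 2 + partialDeriv 1 φ x ^ 2 := by
  -- At the origin `invSq` takes the default value `0⁻¹ = 0`, so only an inequality holds there.
  rcases eq_or_ne x 0 with rfl | hx
  · simp [invSq]
    positivity
  · exact (invSq_mul_dR_add_dTheta hx).le

/-- The Dirichlet integral on the disc. -/
def dirichlet (φ : Plane → ℝ) : ℝ :=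
  ∫ x in disc, (partialDeriv 0 φ x ^ 2 + partialDeriv 1 φ x ^ 2)

/-- The radial part of the Dirichlet integral. -/
def radialEnergy (φ : Plane → ℝ) : ℝ := ∫ x in disc, invSq x * dR φ x ^ 2

/-- The angular part of the Dirichlet integral. -/
def angularEnergy (φ : Plane → ℝ) : ℝ := ∫ x in disc, invSq x * dTheta φ x ^ 2

/-- The weighted norm of the fluctuation of `φ` about its circular means. -/
def fluctuation (φ : Plane → ℝ) : ℝ := ∫ x in disc, invSq x * (φ x - circMean φ x) ^ 2

/-- The radial energy of the fluctuation of `φ` about its circular means. -/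
def radialFluctuation (φ : Plane → ℝ) : ℝ :=
  ∫ x in disc, invSq x * (dR φ x - circMean (dR φ) x) ^ 2

/-- The radial energy of the sum of `φ` and its circular mean. -/
def radialSumEnergy (φ : Plane → ℝ) : ℝ :=
  ∫ x in disc, invSq x * (dR φ x + circMean (dR φ) x) ^ 2

section smooth
variable {φ : Plane → ℝ} (hφ : ContDiff ℝ ∞ φ)
include hφ

theorem integrableOn_grad_sq :
    IntegrableOn (fun x => partialDeriv 0 φ x ^ 2 + partialDeriv 1 φ x ^ 2) disc :=
  integrableOn_disc_of_continuous
    (((hφ.partialDeriv 0).continuous.pow 2).add ((hφ.partialDeriv 1).continuous.pow 2))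

theorem integrableOn_radialEnergy : IntegrableOn (fun x => invSq x * dR φ x ^ 2) disc := by
  refine (integrableOn_grad_sq hφ).mono'
    (measurable_invSq.mul (hφ.dR.continuous.measurable.pow_const 2)).aestronglyMeasurable
    (Eventually.of_forall fun x => ?_)
  have := invSq_mul_le (φ := φ) x
  have h0 := invSq_nonneg x
  rw [Real.norm_of_nonneg (by positivity)]
  nlinarith [sq_nonneg (dTheta φ x)]

theorem integrableOn_angularEnergy : IntegrableOn (fun x => invSq x * dTheta φ x ^ 2) disc := by
  refine (integrableOn_grad_sq hφ).mono'
    (measurable_invSq.mul (hφ.dTheta.continuous.measurable.pow_const 2)).aestronglyMeasurable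
    (Eventually.of_forall fun x => ?_)
  have := invSq_mul_le (φ := φ) x
  have h0 := invSq_nonneg x
  rw [Real.norm_of_nonneg (by positivity)]
  nlinarith [sq_nonneg (dR φ x)]

theorem radialEnergy_add_angularEnergy : radialEnergy φ + angularEnergy φ = dirichlet φ := by
  rw [radialEnergy, angularEnergy, dirichlet,
    ← integral_add (integrableOn_radialEnergy hφ) (integrableOn_angularEnergy hφ)]
  refine integral_congr_ae ?_
  filter_upwards [ae_ne_zero] with x hx using invSq_mul_dR_add_dTheta hx

/-- The weight `R⁻²` is not integrable near the origin of the plane; subtracting the circular mean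
is what makes the integral finite, through Wirtinger's inequality. -/
theorem integrableOn_fluctuation :
    IntegrableOn (fun x => invSq x * (φ x - circMean φ x) ^ 2) disc :=
  (weighted_wirtinger measurable_invSq invSq_nonneg invSq_rot hφ (integrableOn_angularEnergy hφ)).1

theorem fluctuation_le_angularEnergy : fluctuation φ ≤ angularEnergy φ :=
  (weighted_wirtinger measurable_invSq invSq_nonneg invSq_rot hφ (integrableOn_angularEnergy hφ)).2

theorem integrableOn_radialSum_add_radialFluctuation :
    IntegrableOn (fun x => invSq x * ((dR φ x + circMean (dR φ) x) ^ 2 +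
      3 * (dR φ x - circMean (dR φ) x) ^ 2)) disc := by
  refine (weighted_circMean_sq_le measurable_invSq invSq_nonneg invSq_rot hφ.dR ?_).1
  simp_rw [mul_left_comm _ (4 : ℝ)]
  exact (integrableOn_radialEnergy hφ).const_mul 4

theorem integrableOn_radialSumEnergy :
    IntegrableOn (fun x => invSq x * (dR φ x + circMean (dR φ) x) ^ 2) disc := by
  refine (integrableOn_radialSum_add_radialFluctuation hφ).mono'
    (measurable_invSq.mul ((hφ.dR.continuous.add
      hφ.dR.circMean.continuous).measurable.pow_const 2)).aestronglyMeasurable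
    (Eventually.of_forall fun x => ?_)
  have h0 := invSq_nonneg x
  rw [Real.norm_of_nonneg (by positivity)]
  nlinarith [mul_nonneg h0 (sq_nonneg (dR φ x - circMean (dR φ) x))]

theorem integrableOn_radialFluctuation :
    IntegrableOn (fun x => invSq x * (dR φ x - circMean (dR φ) x) ^ 2) disc := by
  refine (integrableOn_radialSum_add_radialFluctuation hφ).mono'
    (measurable_invSq.mul ((hφ.dR.continuous.sub
      hφ.dR.circMean.continuous).measurable.pow_const 2)).aestronglyMeasurable
    (Eventually.of_forall fun x => ?_)
  have h0 := invSq_nonneg x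
  rw [Real.norm_of_nonneg (by positivity)]
  nlinarith [mul_nonneg h0 (sq_nonneg (dR φ x - circMean (dR φ) x)),
    mul_nonneg h0 (sq_nonneg (dR φ x + circMean (dR φ) x))]

/-- With `m` the mean and `f` the fluctuation of `dR φ` on a circle, the left side is `(2m + f)² +
3f²` and the right side `4(m + f)²`; the mixed terms integrate to zero. The term with factor 3 is
kept because it supplies the remainder for angular pressures. -/
theorem radialSumEnergy_add_le :
    radialSumEnergy φ + 3 * radialFluctuation φ ≤ 4 * radialEnergy φ := by
  have h := (weighted_circMean_sq_le measurable_invSq invSq_nonneg invSq_rot hφ.dR (by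
    simp_rw [mul_left_comm _ (4 : ℝ)]
    exact (integrableOn_radialEnergy hφ).const_mul 4)).2
  simp_rw [mul_add, mul_left_comm _ (3 : ℝ), mul_left_comm _ (4 : ℝ)] at h
  rwa [integral_add (integrableOn_radialSumEnergy hφ)
    ((integrableOn_radialFluctuation hφ).const_mul 3), integral_const_mul, integral_const_mul] at h

end smooth

theorem radialEnergy_nonneg (φ : Plane → ℝ) : 0 ≤ radialEnergy φ :=
  integral_nonneg fun x => mul_nonneg (invSq_nonneg x) (sq_nonneg _)

theorem angularEnergy_nonneg (φ : Plane → ℝ) : 0 ≤ angularEnergy φ :=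
  integral_nonneg fun x => mul_nonneg (invSq_nonneg x) (sq_nonneg _)

theorem fluctuation_nonneg (φ : Plane → ℝ) : 0 ≤ fluctuation φ :=
  integral_nonneg fun x => mul_nonneg (invSq_nonneg x) (sq_nonneg _)

theorem radialFluctuation_nonneg (φ : Plane → ℝ) : 0 ≤ radialFluctuation φ :=
  integral_nonneg fun x => mul_nonneg (invSq_nonneg x) (sq_nonneg _)

/-! ### The Jacobian bracket integrated against a function with a weak gradient -/

/-- The Jacobian determinant `∂₀a ∂₁b - ∂₁a ∂₀b`. -/
def bracket (a b : Plane → ℝ) (x : Plane) : ℝ :=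
  partialDeriv 0 a x * partialDeriv 1 b x - partialDeriv 1 a x * partialDeriv 0 b x

theorem norm_sq_mul_bracket (a b : Plane → ℝ) (x : Plane) :
    ‖x‖ ^ 2 * bracket a b x = dR a x * dTheta b x - dTheta a x * dR b x := by
  rw [Plane.norm_sq_eq, bracket, dR, dR, dTheta, dTheta]
  ring

theorem bracket_circMean {a b : Plane → ℝ} (ha : ContDiff ℝ ∞ a) (hb : ContDiff ℝ ∞ b)
    {x : Plane} (hx : x ≠ 0) : bracket (circMean a) (circMean b) x = 0 := by
  have h := norm_sq_mul_bracket (circMean a) (circMean b) x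
  rw [dTheta_circMean ha, dTheta_circMean hb] at h
  have : ‖x‖ ^ 2 ≠ 0 := by simpa using hx
  simpa [this] using h

/-- The polar density of the pairing of a gradient with radial part `gR` and angular part `gT`
with the field whose divergence is `2 {a, b}`. -/
def polarDensity (gR gT a b : Plane → ℝ) (x : Plane) : ℝ :=
  invSq x * (gR x * ((a x - circMean a x) * dTheta b x - (b x - circMean b x) * dTheta a x) -
    gT x * ((a x - circMean a x) * (dR b x + circMean (dR b) x) -
      (b x - circMean b x) * (dR a x + circMean (dR a) x)))

/-- The Jacobian is the curl of many fields; the field `V` below is chosen so that each of its terms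
carries a fluctuation `a - ā` or `b - b̄`, which Wirtinger's inequality can absorb. Its curl is `2
{a, b} - 2 {ā, b̄}`, and the second bracket vanishes off the origin. Since `b` has compact support
so does `V`, and the weak gradient of `l` may be tested with it. -/
theorem integral_mul_bracket {l : Plane → ℝ} {G : Fin 2 → Plane → ℝ}
    (hl : ∀ j, HasWeakPartial l j (G j)) {a b : Plane → ℝ} (ha : ContDiff ℝ ∞ a)
    (hb : IsTestFunction b) :
    2 * ∫ x in disc, l x * bracket a b x =
      -∫ x in disc, polarDensity (fun x => G 0 x * x 0 + G 1 x * x 1)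
        (fun x => G 1 x * x 0 - G 0 x * x 1) a b x := by
  have ha0 := ha.circMean
  have hb0 := hb.circMean
  have hat : ContDiff ℝ ∞ fun x => a x - circMean a x := ha.sub ha0
  have hbt := hb.sub hb0
  have has : ContDiff ℝ ∞ fun x => a x + circMean a x := ha.add ha0
  have hbs := hb.add hb0
  have hV : ∀ j, IsTestFunction fun x => (a x - circMean a x) *
      partialDeriv j (fun y => b y + circMean b y) x - (b x - circMean b x) *
      partialDeriv j (fun y => a y + circMean a y) x := fun j =>
    ((hbs.partialDeriv j).mul_left hat).sub (hbt.mul_right (has.partialDeriv j))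
  set V : Fin 2 → Plane → ℝ := fun j x => (a x - circMean a x) *
      partialDeriv j (fun y => b y + circMean b y) x - (b x - circMean b x) *
      partialDeriv j (fun y => a y + circMean a y) x with hVdef
  have hdV : ∀ i j x, partialDeriv i (V j) x =
      (partialDeriv i a x - partialDeriv i (circMean a) x) *
        (partialDeriv j b x + partialDeriv j (circMean b) x) +
      (a x - circMean a x) * partialDeriv i (partialDeriv j (fun y => b y + circMean b y)) x -
      ((partialDeriv i b x - partialDeriv i (circMean b) x) *
        (partialDeriv j a x + partialDeriv j (circMean a) x) +
      (b x - circMean b x) * partialDeriv i (partialDeriv j (fun y => a y + circMean a y)) x) := by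
    intro i j x
    rw [hVdef]
    simp only []
    rw [partialDeriv_sub, partialDeriv_mul, partialDeriv_mul, partialDeriv_sub, partialDeriv_sub]
    · congr 3
      · rw [partialDeriv_add _ (hb.1.differentiableAt_infty x) (hb0.1.differentiableAt_infty x)]
      · rw [partialDeriv_add _ (ha.differentiableAt_infty x) (ha0.differentiableAt_infty x)]
    all_goals apply ContDiff.differentiableAt_infty
    · exact hb.1
    · exact hb0.1
    · exact ha
    · exact ha0
    · exact hbt.1
    · exact has.partialDeriv j
    · exact hat
    · exact hbs.1.partialDeriv j
    · exact hat.mul (hbs.1.partialDeriv j)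
    · exact hbt.1.mul (has.partialDeriv j)
  have hdiv : ∀ x, x ≠ 0 → 2 * bracket a b x = partialDeriv 0 (V 1) x - partialDeriv 1 (V 0) x := by
    intro x hx
    have h0 := bracket_circMean ha hb.1 hx
    rw [hdV, hdV, partialDeriv_comm hbs.1, partialDeriv_comm has]
    unfold bracket at h0 ⊢
    linear_combination 2 * h0
  have hw := fun i j => (hl i).2.2 (V j) (hV j)
  have hil : ∀ i j, IntegrableOn (fun x => l x * partialDeriv i (V j) x) disc := fun i j =>
    LocallyIntegrableOn.integrableOn_mul_test (hl 0).1 ((hV j).partialDeriv i)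
  have hiG : ∀ i j, IntegrableOn (fun x => G i x * V j x) disc := fun i j =>
    LocallyIntegrableOn.integrableOn_mul_test (hl i).2.1 (hV j)
  calc 2 * ∫ x in disc, l x * bracket a b x
      = ∫ x in disc, (l x * partialDeriv 0 (V 1) x - l x * partialDeriv 1 (V 0) x) := by
        rw [← integral_const_mul]
        refine integral_congr_ae ?_
        filter_upwards [ae_ne_zero] with x hx
        rw [← mul_sub, ← hdiv x hx]
        ring
    _ = -∫ x in disc, (G 0 x * V 1 x - G 1 x * V 0 x) := by
        rw [integral_sub (hil 0 1) (hil 1 0), integral_sub (hiG 0 1) (hiG 1 0), hw, hw]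
        ring
    _ = _ := by
        congr 1
        refine integral_congr_ae ?_
        filter_upwards [ae_ne_zero] with x hx
        have hsum : ∀ (c : Plane → ℝ) (_ : ContDiff ℝ ∞ c) j,
            partialDeriv j (fun y => c y + circMean c y) x =
              partialDeriv j c x + partialDeriv j (circMean c) x := fun c hc j =>
          partialDeriv_add _ (hc.differentiableAt_infty x) (hc.circMean.differentiableAt_infty x)
        simp only [hVdef, polarDensity, hsum a ha, hsum b hb.1, ← dR_circMean ha,
          ← dR_circMean hb.1]
        have hTa := dTheta_circMean ha x
        have hTb := dTheta_circMean hb.1 x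
        have hone := invSq_mul_norm_sq hx
        rw [Plane.norm_sq_eq] at hone
        simp only [dR, dTheta] at hTa hTb ⊢
        -- The first part inserts `R⁻² (x₀² + x₁²) = 1` to pass from Cartesian to polar components;
        -- the second removes the angular derivatives of the circular means, which are zero.
        linear_combination (-(G 0 x * ((a x - circMean a x) *
          (partialDeriv 1 b x + partialDeriv 1 (circMean b) x) - (b x - circMean b x) *
          (partialDeriv 1 a x + partialDeriv 1 (circMean a) x)) - G 1 x * ((a x - circMean a x) *
          (partialDeriv 0 b x + partialDeriv 0 (circMean b) x) - (b x - circMean b x) *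
          (partialDeriv 0 a x + partialDeriv 0 (circMean a) x)))) * hone +
          invSq x * (G 0 x * x 0 + G 1 x * x 1) * ((a x - circMean a x) * hTb -
            (b x - circMean b x) * hTa)

/-! ### Young's inequality and the quadratic bounds for the pairing -/

theorem abs_mul_le_young {s : ℝ} (hs : 0 < s) (x y : ℝ) :
    |x * y| ≤ (s * x ^ 2 + s⁻¹ * y ^ 2) / 2 := by
  have h : 0 ≤ s⁻¹ * (s * |x| - |y|) ^ 2 := by positivity
  have h2 : s⁻¹ * (s * |x| - |y|) ^ 2 = s * x ^ 2 + s⁻¹ * y ^ 2 - 2 * |x * y| := by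
    rw [abs_mul, ← sq_abs x, ← sq_abs y]
    field_simp
    ring
  linarith

theorem integral_linear_combination_four {X : Type*} [MeasurableSpace X] {μ : Measure X}
    {f₁ f₂ f₃ f₄ : X → ℝ} (h₁ : Integrable f₁ μ) (h₂ : Integrable f₂ μ) (h₃ : Integrable f₃ μ)
    (h₄ : Integrable f₄ μ) (s₁ s₂ s₃ s₄ : ℝ) :
    Integrable (fun x => s₁ * f₁ x + s₂ * f₂ x + (s₃ * f₃ x + s₄ * f₄ x)) μ ∧
      ∫ x, (s₁ * f₁ x + s₂ * f₂ x + (s₃ * f₃ x + s₄ * f₄ x)) ∂μ =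
        s₁ * ∫ x, f₁ x ∂μ + s₂ * ∫ x, f₂ x ∂μ + (s₃ * ∫ x, f₃ x ∂μ + s₄ * ∫ x, f₄ x ∂μ) := by
  have i₁ : Integrable (fun x => s₁ * f₁ x + s₂ * f₂ x) μ := (h₁.const_mul s₁).add (h₂.const_mul s₂)
  have i₂ : Integrable (fun x => s₃ * f₃ x + s₄ * f₄ x) μ := (h₃.const_mul s₃).add (h₄.const_mul s₄)
  refine ⟨i₁.add i₂, ?_⟩
  rw [integral_add i₁ i₂, integral_add (h₁.const_mul s₁) (h₂.const_mul s₂),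
    integral_add (h₃.const_mul s₃) (h₄.const_mul s₄)]
  simp only [integral_const_mul]

/-- Young's inequality is applied to each of the four products in `polarDensity` with its own
weight. Independent weights serve two purposes later: balancing `a` against `b`, and balancing
fluctuations against radial energies. -/
theorem two_mul_abs_integral_mul_bracket_le {l : Plane → ℝ} {G : Fin 2 → Plane → ℝ}
    (hl : ∀ j, HasWeakPartial l j (G j)) {KR KT : ℝ} (hKR : 0 ≤ KR) (hKT : 0 ≤ KT)
    (hR : ∀ᵐ x ∂discMeasure, |G 0 x * x 0 + G 1 x * x 1| ≤ KR)
    (hT : ∀ᵐ x ∂discMeasure, |G 1 x * x 0 - G 0 x * x 1| ≤ KT)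
    {a b : Plane → ℝ} (ha : ContDiff ℝ ∞ a) (hb : IsTestFunction b)
    {s₁ s₂ s₃ s₄ : ℝ} (h₁ : 0 < s₁) (h₂ : 0 < s₂) (h₃ : 0 < s₃) (h₄ : 0 < s₄) :
    2 * |∫ x in disc, l x * bracket a b x| ≤
      KR / 2 * (s₁ * fluctuation a + s₁⁻¹ * angularEnergy b +
        (s₂ * fluctuation b + s₂⁻¹ * angularEnergy a)) +
      KT / 2 * (s₃ * fluctuation a + s₃⁻¹ * radialSumEnergy b +
        (s₄ * fluctuation b + s₄⁻¹ * radialSumEnergy a)) := by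
  have hFa := integrableOn_fluctuation ha
  have hFb := integrableOn_fluctuation hb.1
  have hTa := integrableOn_angularEnergy ha
  have hTb := integrableOn_angularEnergy hb.1
  have hPa := integrableOn_radialSumEnergy ha
  have hPb := integrableOn_radialSumEnergy hb.1
  have h := integral_mul_bracket hl ha hb
  have habs : 2 * |∫ x in disc, l x * bracket a b x| =
      ‖∫ x in disc, polarDensity (fun x => G 0 x * x 0 + G 1 x * x 1)
        (fun x => G 1 x * x 0 - G 0 x * x 1) a b x‖ := by
    rw [← norm_neg, ← h, norm_mul]
    simp
  rw [habs]
  obtain ⟨hi₁, e₁⟩ := integral_linear_combination_four hFa hTb hFb hTa s₁ s₁⁻¹ s₂ s₂⁻¹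
  obtain ⟨hi₂, e₂⟩ := integral_linear_combination_four hFa hPb hFb hPa s₃ s₃⁻¹ s₄ s₄⁻¹
  refine (norm_integral_le_of_norm_le ((hi₁.const_mul (KR / 2)).add (hi₂.const_mul (KT / 2)))
    ?_).trans (le_of_eq ?_)
  · filter_upwards [hR, hT] with x hxR hxT
    have hw := invSq_nonneg x
    have e₁ := abs_mul_le_young h₁ (a x - circMean a x) (dTheta b x)
    have e₂ := abs_mul_le_young h₂ (b x - circMean b x) (dTheta a x)
    have e₃ := abs_mul_le_young h₃ (a x - circMean a x) (dR b x + circMean (dR b) x)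
    have e₄ := abs_mul_le_young h₄ (b x - circMean b x) (dR a x + circMean (dR a) x)
    simp only [Pi.add_apply]
    rw [polarDensity, norm_mul, Real.norm_of_nonneg hw, Real.norm_eq_abs]
    have m₁ := (abs_sub ((a x - circMean a x) * dTheta b x)
      ((b x - circMean b x) * dTheta a x)).trans (add_le_add e₁ e₂)
    have m₂ := (abs_sub ((a x - circMean a x) * (dR b x + circMean (dR b) x))
      ((b x - circMean b x) * (dR a x + circMean (dR a) x))).trans (add_le_add e₃ e₄)
    refine (mul_le_mul_of_nonneg_left ((abs_sub _ _).trans (add_le_add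
      (le_trans (abs_mul _ _).le (mul_le_mul hxR m₁ (abs_nonneg _) hKR))
      (le_trans (abs_mul _ _).le (mul_le_mul hxT m₂ (abs_nonneg _) hKT)))) hw).trans (le_of_eq ?_)
    ring
  · simp only [Pi.add_def]
    rw [integral_add (hi₁.const_mul _) (hi₂.const_mul _), integral_const_mul, integral_const_mul,
      e₁, e₂]
    rfl

theorem radialEnergy_le_dirichlet {φ : Plane → ℝ} (hφ : ContDiff ℝ ∞ φ) :
    radialEnergy φ ≤ dirichlet φ := by
  linarith [radialEnergy_add_angularEnergy hφ, angularEnergy_nonneg φ]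

theorem angularEnergy_le_dirichlet {φ : Plane → ℝ} (hφ : ContDiff ℝ ∞ φ) :
    angularEnergy φ ≤ dirichlet φ := by
  linarith [radialEnergy_add_angularEnergy hφ, radialEnergy_nonneg φ]

theorem fluctuation_le_dirichlet {φ : Plane → ℝ} (hφ : ContDiff ℝ ∞ φ) :
    fluctuation φ ≤ dirichlet φ :=
  (fluctuation_le_angularEnergy hφ).trans (angularEnergy_le_dirichlet hφ)

theorem radialSumEnergy_le_dirichlet {φ : Plane → ℝ} (hφ : ContDiff ℝ ∞ φ) :
    radialSumEnergy φ ≤ 4 * dirichlet φ := by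
  linarith [radialSumEnergy_add_le hφ, radialFluctuation_nonneg φ, radialEnergy_le_dirichlet hφ]

/-- The pairing of a pressure with Jacobian brackets is bounded on `W^{1,2} × W^{1,2}`, with a
constant that only depends on the size of the scaled pressure gradient. -/
theorem abs_integral_mul_bracket_le_dirichlet {l : Plane → ℝ} {G : Fin 2 → Plane → ℝ}
    (hl : ∀ j, HasWeakPartial l j (G j)) {KR KT : ℝ} (hKR : 0 ≤ KR) (hKT : 0 ≤ KT)
    (hR : ∀ᵐ x ∂discMeasure, |G 0 x * x 0 + G 1 x * x 1| ≤ KR)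
    (hT : ∀ᵐ x ∂discMeasure, |G 1 x * x 0 - G 0 x * x 1| ≤ KT)
    {a b : Plane → ℝ} (ha : ContDiff ℝ ∞ a) (hb : IsTestFunction b) {c : ℝ} (hc : 0 < c) :
    |∫ x in disc, l x * bracket a b x| ≤
      2 * (KR + KT) * (c * dirichlet a + c⁻¹ * dirichlet b) := by
  -- With these weights every energy of `a` is multiplied by `c` and every energy of `b` by `c⁻¹`.
  -- The resulting constant is crude, but the estimate only serves to make the error of
  -- approximation vanish.
  have h := two_mul_abs_integral_mul_bracket_le hl hKR hKT hR hT ha hb hc (inv_pos.2 hc) hc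
    (inv_pos.2 hc)
  rw [inv_inv] at h
  have hci : 0 < c⁻¹ := inv_pos.2 hc
  have n₁ := mul_le_mul_of_nonneg_left (fluctuation_le_dirichlet ha) hc.le
  have n₂ := mul_le_mul_of_nonneg_left (fluctuation_le_dirichlet hb.1) hci.le
  have n₃ := mul_le_mul_of_nonneg_left (angularEnergy_le_dirichlet ha) hc.le
  have n₄ := mul_le_mul_of_nonneg_left (angularEnergy_le_dirichlet hb.1) hci.le
  have n₅ := mul_le_mul_of_nonneg_left (radialSumEnergy_le_dirichlet ha) hc.le
  have n₆ := mul_le_mul_of_nonneg_left (radialSumEnergy_le_dirichlet hb.1) hci.le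
  have p₀ : 0 ≤ c * dirichlet a :=
    mul_nonneg hc.le ((radialEnergy_nonneg a).trans (radialEnergy_le_dirichlet ha))
  have p₁ : 0 ≤ c⁻¹ * dirichlet b :=
    mul_nonneg hci.le ((radialEnergy_nonneg b).trans (radialEnergy_le_dirichlet hb.1))
  have q₁ := mul_le_mul_of_nonneg_left (show c * fluctuation a + c⁻¹ * angularEnergy b +
    (c⁻¹ * fluctuation b + c * angularEnergy a) ≤ 8 * (c * dirichlet a + c⁻¹ * dirichlet b) by
      linarith) (show 0 ≤ KR / 2 by positivity)
  have q₂ := mul_le_mul_of_nonneg_left (show c * fluctuation a + c⁻¹ * radialSumEnergy b +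
    (c⁻¹ * fluctuation b + c * radialSumEnergy a) ≤ 8 * (c * dirichlet a + c⁻¹ * dirichlet b) by
      linarith) (show 0 ≤ KT / 2 by positivity)
  linarith

/-- The quadratic bound of the pairing of a pressure with the Jacobian determinant. -/
theorem two_mul_abs_integral_mul_bracket_self_le {l : Plane → ℝ} {G : Fin 2 → Plane → ℝ}
    (hl : ∀ j, HasWeakPartial l j (G j)) {KR KT : ℝ} (hKR : 0 ≤ KR) (hKT : 0 ≤ KT)
    (hR : ∀ᵐ x ∂discMeasure, |G 0 x * x 0 + G 1 x * x 1| ≤ KR)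
    (hT : ∀ᵐ x ∂discMeasure, |G 1 x * x 0 - G 0 x * x 1| ≤ KT)
    {a b : Plane → ℝ} (ha : ContDiff ℝ ∞ a) (hb : IsTestFunction b) {c : ℝ} (hc : 0 < c) :
    2 * |∫ x in disc, l x * bracket a b x| ≤ KR * (angularEnergy a + angularEnergy b) +
      KT / 2 * (c * (fluctuation a + fluctuation b) +
        c⁻¹ * (radialSumEnergy a + radialSumEnergy b)) := by
  -- In the terms with `KR` the weight one is natural, as Wirtinger's inequality compares
  -- fluctuation and angular energy with constant one. In the terms with `KT` the weight stays free.
  have h := two_mul_abs_integral_mul_bracket_le hl hKR hKT hR hT ha hb one_pos one_pos hc hc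
  have q₁ := mul_le_mul_of_nonneg_left (show 1 * fluctuation a + 1⁻¹ * angularEnergy b +
    (1 * fluctuation b + 1⁻¹ * angularEnergy a) ≤ 2 * (angularEnergy a + angularEnergy b) by
      rw [inv_one]
      linarith [fluctuation_le_angularEnergy ha, fluctuation_le_angularEnergy hb.1])
      (show 0 ≤ KR / 2 by positivity)
  linarith

/-! ### Mollification and the chain rule -/

/-- The convolution of `q` with the kernel `ρ`. -/
def mollify (ρ q : Plane → ℝ) (x : Plane) : ℝ := ∫ t, q t * ρ (x - t)

theorem contDiff_mollify {ρ q : Plane → ℝ} (hρ : ContDiff ℝ ∞ ρ) (hc : HasCompactSupport ρ)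
    (hq : Integrable q) : ContDiff ℝ ∞ (mollify ρ q) :=
  hc.contDiff_convolution_right (ContinuousLinearMap.mul ℝ ℝ) hq.locallyIntegrable hρ

theorem partialDeriv_mollify {ρ q : Plane → ℝ} (hρ : ContDiff ℝ ∞ ρ) (hc : HasCompactSupport ρ)
    (hq : Integrable q) (j : Fin 2) (x : Plane) :
    partialDeriv j (mollify ρ q) x = mollify (partialDeriv j ρ) q x := by
  have h := hc.hasFDerivAt_convolution_right (ContinuousLinearMap.mul ℝ ℝ) hq.locallyIntegrable
    (hρ.of_le (by simp)) x
  have h2 : fderiv ℝ (mollify ρ q) x = _ := h.fderiv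
  rw [partialDeriv, h2, convolution_precompR_apply _ hq.locallyIntegrable (hc.fderiv ℝ)
    (hρ.continuous_fderiv (by simp))]
  rfl

theorem partialDeriv_comp_const_sub {φ : Plane → ℝ} (hφ : ContDiff ℝ ∞ φ) (j : Fin 2)
    (x y : Plane) :
    partialDeriv j (fun y => φ (x - y)) y = -partialDeriv j φ (x - y) := by
  have h := (hφ.differentiableAt_infty (x - y)).hasFDerivAt.comp y
    ((hasFDerivAt_id y).const_sub x)
  have h2 : fderiv ℝ (fun y => φ (x - y)) y = _ := h.fderiv
  simp [partialDeriv, h2]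

theorem partialDeriv_comp {f : ℝ → ℝ} (hf : ContDiff ℝ ∞ f) {φ : Plane → ℝ} (hφ : ContDiff ℝ ∞ φ)
    (j : Fin 2) (x : Plane) :
    partialDeriv j (fun y => f (φ y)) x = deriv f (φ x) * partialDeriv j φ x := by
  have h := (hf.differentiableAt_infty (φ x)).hasDerivAt.comp_hasFDerivAt x
    (hφ.differentiableAt_infty x).hasFDerivAt
  have h2 : fderiv ℝ (fun y => f (φ y)) x = _ := h.fderiv
  simp [partialDeriv, h2]

/-- Away from the boundary, derivatives of mollifications are mollifications of weak
derivatives. -/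
theorem partialDeriv_mollify_indicator {p d : Plane → ℝ} {j : Fin 2} (hp : HasWeakPartial p j d)
    {ρ : Plane → ℝ} (hρ : ContDiff ℝ ∞ ρ) {ε r s : ℝ} (hs : s < 1)
    (hsupp : tsupport ρ ⊆ Metric.closedBall 0 ε) (hε : r + ε ≤ s) {x : Plane} (hx : ‖x‖ ≤ r) :
    partialDeriv j (mollify ρ ((Metric.closedBall 0 s).indicator p)) x =
      mollify ρ ((Metric.closedBall 0 s).indicator d) x := by
  have hsub : Metric.closedBall (0 : Plane) s ⊆ disc := Metric.closedBall_subset_ball hs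
  have hc : HasCompactSupport ρ :=
    HasCompactSupport.of_support_subset_isCompact (isCompact_closedBall 0 ε)
      (subset_closure.trans hsupp)
  have hint : Integrable ((Metric.closedBall 0 s).indicator p) :=
    (hp.1.integrableOn_compact_subset hsub (isCompact_closedBall 0 s)).integrable_indicator
      Metric.isClosed_closedBall.measurableSet
  rw [partialDeriv_mollify hρ hc hint]
  -- A point outside the ball of radius `s` has distance more than `ε` from `x`, so the kernel
  -- centred at `x` does not see the truncation by the indicator.
  have hz : ∀ y, y ∉ Metric.closedBall (0 : Plane) s → x - y ∉ tsupport ρ := by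
    intro y hy h'
    have h1 := hsupp h'
    simp only [Metric.mem_closedBall, dist_zero_right] at h1 hy
    have : ‖y‖ ≤ ‖x‖ + ‖x - y‖ := by
      have := norm_sub_le x (x - y)
      simpa using this
    linarith
  have hψ : IsTestFunction fun y => ρ (x - y) := by
    refine isTestFunction_of_forall_eq_zero (hρ.comp (contDiff_const.sub contDiff_id)) hs
      fun y hy => image_eq_zero_of_notMem_tsupport (hz y (by simpa using hy))
  have key : ∀ (q k : Plane → ℝ), (∀ z, z ∉ tsupport ρ → k z = 0) →
      mollify k ((Metric.closedBall 0 s).indicator q) x = ∫ y in disc, q y * k (x - y) := by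
    intro q k hk
    rw [mollify, setIntegral_eq_integral_of_forall_compl_eq_zero]
    · refine integral_congr_ae (Eventually.of_forall fun y => ?_)
      by_cases hy : y ∈ Metric.closedBall (0 : Plane) s
      · simp [Set.indicator_of_mem hy]
      · simp [hk _ (hz y hy)]
    · intro y hy
      rw [hk _ (hz y fun h => hy (hsub h)), mul_zero]
  rw [key p _ fun z hz => image_eq_zero_of_notMem_tsupport fun h =>
    hz (tsupport_partialDeriv_subset ρ j h), key d _ fun z hz =>
    image_eq_zero_of_notMem_tsupport hz]
  have h := hp.2.2 _ hψ
  simp only [partialDeriv_comp_const_sub hρ, mul_neg, integral_neg] at h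
  exact neg_injective h

/-- A sequence of bump functions shrinking to the origin. -/
def shrinkingBump (n : ℕ) : ContDiffBump (0 : Plane) where
  rIn := 1 / (2 * (n + 1))
  rOut := 1 / (n + 1)
  rIn_pos := by positivity
  rIn_lt_rOut := by
    have : (0 : ℝ) < n + 1 := by positivity
    apply one_div_lt_one_div_of_lt this
    linarith

/-- The corresponding mollifiers. -/
def mollifier (n : ℕ) : Plane → ℝ := (shrinkingBump n).normed volume

theorem contDiff_mollifier (n : ℕ) : ContDiff ℝ ∞ (mollifier n) :=
  (shrinkingBump n).contDiff_normed (n := ⊤)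

theorem tsupport_mollifier (n : ℕ) :
    tsupport (mollifier n) = Metric.closedBall 0 (1 / (n + 1)) :=
  (shrinkingBump n).tsupport_normed_eq

theorem hasCompactSupport_mollifier (n : ℕ) : HasCompactSupport (mollifier n) :=
  (shrinkingBump n).hasCompactSupport_normed

theorem ae_tendsto_mollify {q : Plane → ℝ} (hq : Integrable q) :
    ∀ᵐ x, Tendsto (fun n => mollify (mollifier n) q x) atTop (𝓝 (q x)) := by
  -- `K = 2` is the ratio of the outer to the inner radius of the bumps.
  have h := ContDiffBump.ae_convolution_tendsto_right_of_locallyIntegrable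
    (φ := shrinkingBump) (l := atTop) (K := 2) (g := q) (μ := volume)
    tendsto_one_div_add_atTop_nhds_zero_nat (Eventually.of_forall fun n => by
      simp only [shrinkingBump]
      apply le_of_eq
      field_simp) hq.locallyIntegrable
  filter_upwards [h] with x hx
  refine hx.congr fun n => ?_
  rw [convolution_lsmul_swap, mollify]
  simp only [mollifier, smul_eq_mul, mul_comm]

theorem abs_mollify_le {q : Plane → ℝ} {n : ℕ} {C : ℝ} {x : Plane}
    (hC : ∀ᵐ y, ‖x - y‖ ≤ 1 / (n + 1) → |q y| ≤ C) :
    |mollify (mollifier n) q x| ≤ C := by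
  have h1 : ∫ y, mollifier n (x - y) = 1 := by
    rw [integral_sub_left_eq_self (mollifier n)]
    exact (shrinkingBump n).integral_normed
  have hint : Integrable fun y => C * mollifier n (x - y) :=
    (((shrinkingBump n).integrable_normed (μ := volume)).comp_sub_left x).const_mul C
  have h := norm_integral_le_of_norm_le (f := fun y => q y * mollifier n (x - y)) hint ?_
  · rwa [integral_const_mul, h1, mul_one] at h
  · filter_upwards [hC] with y hy
    have h0 : 0 ≤ mollifier n (x - y) := (shrinkingBump n).nonneg_normed _
    rw [norm_mul, Real.norm_of_nonneg h0, Real.norm_eq_abs]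
    by_cases hxy : ‖x - y‖ ≤ 1 / (n + 1)
    · exact mul_le_mul_of_nonneg_right (hy hxy) h0
    · have : mollifier n (x - y) = 0 := by
        refine image_eq_zero_of_notMem_tsupport ?_
        rw [tsupport_mollifier]
        simpa using hxy
      simp [this]

/-- The weak chain rule, tested with functions vanishing near the origin. -/
theorem integral_comp_mul_partialDeriv_of_eq_zero_near {p d : Plane → ℝ} {j : Fin 2}
    (hp : HasWeakPartial p j d) {K : ℝ} (hd : ∀ᵐ x ∂discMeasure, |d x| * ‖x‖ ≤ K)
    {f : ℝ → ℝ} (hf : ContDiff ℝ ∞ f) {C : ℝ} (hC : ∀ t, |f t| ≤ C) (hf' : ∀ t, |deriv f t| ≤ 1)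
    {φ : Plane → ℝ} (hφ : IsTestFunction φ) {δ : ℝ} (hδ : 0 < δ) (hφ0 : ∀ x, ‖x‖ < δ → φ x = 0) :
    ∫ x in disc, f (p x) * partialDeriv j φ x = -∫ x in disc, deriv f (p x) * d x * φ x := by
  obtain ⟨r, hr0, hr1, hsupp⟩ := exists_tsupport_subset_closedBall hφ
  set s := (1 + r) / 2 with hs
  have hs1 : s < 1 := by linarith
  have hrs : r < s := by linarith
  have hsub : Metric.closedBall (0 : Plane) s ⊆ disc := Metric.closedBall_subset_ball hs1
  have hmeas : MeasurableSet (Metric.closedBall (0 : Plane) s) :=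
    Metric.isClosed_closedBall.measurableSet
  have hint : ∀ q : Plane → ℝ, LocallyIntegrableOn q disc →
      Integrable ((Metric.closedBall 0 s).indicator q) :=
    fun q hq => (hq.integrableOn_compact_subset hsub
      (isCompact_closedBall 0 s)).integrable_indicator hmeas
  set P : ℕ → Plane → ℝ := fun n => mollify (mollifier n) ((Metric.closedBall 0 s).indicator p)
  set Q : ℕ → Plane → ℝ := fun n => mollify (mollifier n) ((Metric.closedBall 0 s).indicator d)
  have hP : ∀ n, ContDiff ℝ ∞ (P n) := fun n =>
    contDiff_mollify (contDiff_mollifier n) (hasCompactSupport_mollifier n) (hint p hp.1)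
  have hQ : ∀ n, Continuous (Q n) := fun n =>
    (contDiff_mollify (contDiff_mollifier n) (hasCompactSupport_mollifier n)
      (hint d hp.2.1)).continuous
  have hzero : ∀ x, φ x ≠ 0 → δ ≤ ‖x‖ ∧ ‖x‖ ≤ r := fun x hx =>
    ⟨not_lt.1 fun h => hx (hφ0 x h), by simpa using hsupp (subset_tsupport φ hx)⟩
  -- A mollification radius below `s - r` keeps the kernels inside the ball of radius `s`; one below
  -- `δ / 2` keeps the averages at distance at least `δ / 2` from the origin, where `|d| ≤ K / (δ /
  -- 2)`. The second bound dominates the mollified derivatives.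
  have hε : ∀ᶠ n : ℕ in atTop, (1 : ℝ) / (n + 1) < min (s - r) (δ / 2) :=
    (tendsto_order.1 tendsto_one_div_add_atTop_nhds_zero_nat).2 _
      (lt_min (by linarith) (by linarith))
  have heq : ∀ᶠ n : ℕ in atTop, ∫ x, f (P n x) * partialDeriv j φ x =
      -∫ x, deriv f (P n x) * Q n x * φ x := by
    filter_upwards [hε] with n hn
    have hfP : ContDiff ℝ ∞ fun x => f (P n x) := hf.comp (hP n)
    have h := integral_partialDeriv_eq_zero (hφ.mul_left hfP).1 (hφ.mul_left hfP).2.1 j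
    have hpt : ∀ x, partialDeriv j (fun x => f (P n x) * φ x) x =
        f (P n x) * partialDeriv j φ x + deriv f (P n x) * Q n x * φ x := by
      intro x
      rw [partialDeriv_mul _ (hfP.differentiableAt_infty x) (hφ.1.differentiableAt_infty x),
        partialDeriv_comp hf (hP n)]
      by_cases hx : φ x = 0
      · simp [hx]
      · rw [partialDeriv_mollify_indicator (r := r) hp (contDiff_mollifier n) hs1
          (tsupport_mollifier n).le (by linarith [hn.le.trans (min_le_left _ _)]) (hzero x hx).2]
        ring
    simp only [hpt] at h
    rw [integral_add] at h
    · linarith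
    · exact ((hφ.partialDeriv j).mul_left hfP).1.continuous.integrable_of_hasCompactSupport
        ((hφ.partialDeriv j).mul_left hfP).2.1
    · refine Continuous.integrable_of_hasCompactSupport ?_ hφ.2.1.mul_left
      exact (((hf.continuous_deriv (by simp)).comp (hP n).continuous).mul (hQ n)).mul
        hφ.1.continuous
  have hlimP := ae_tendsto_mollify (hint p hp.1)
  have hlimQ := ae_tendsto_mollify (hint d hp.2.1)
  have hC0 : 0 ≤ C := (abs_nonneg _).trans (hC 0)
  have hK0 : ∀ᵐ y, y ∈ disc → |d y| * ‖y‖ ≤ K :=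
    (ae_restrict_iff' measurableSet_disc).1 hd
  have lim₁ : Tendsto (fun n => ∫ x, f (P n x) * partialDeriv j φ x) atTop
      (𝓝 (∫ x, f (p x) * partialDeriv j φ x)) := by
    refine tendsto_integral_of_dominated_convergence (fun x => C * |partialDeriv j φ x|)
      (fun n => ?_) ?_ (fun n => Eventually.of_forall fun x => ?_) ?_
    · exact ((hf.continuous.comp (hP n).continuous).mul
        (hφ.1.partialDeriv j).continuous).aestronglyMeasurable
    · exact (((hφ.1.partialDeriv j).continuous.integrable_of_hasCompactSupport
        (hφ.2.1.partialDeriv j)).abs).const_mul C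
    · rw [norm_mul]
      exact mul_le_mul_of_nonneg_right (hC _) (norm_nonneg _)
    · filter_upwards [hlimP] with x hx
      by_cases h0 : partialDeriv j φ x = 0
      · simp [h0]
      · have hxs : x ∈ Metric.closedBall (0 : Plane) s :=
          Metric.closedBall_subset_closedBall hrs.le
            (hsupp (tsupport_partialDeriv_subset φ j (subset_tsupport _ h0)))
        rw [Set.indicator_of_mem hxs] at hx
        exact ((hf.continuous.tendsto _).comp hx).mul_const _
  have lim₂ : Tendsto (fun n => ∫ x, deriv f (P n x) * Q n x * φ x) atTop
      (𝓝 (∫ x, deriv f (p x) * d x * φ x)) := by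
    refine tendsto_integral_filter_of_dominated_convergence (fun x => K / (δ / 2) * |φ x|)
      (Eventually.of_forall fun n => ?_) ?_ ?_ ?_
    · exact ((((hf.continuous_deriv (by simp)).comp (hP n).continuous).mul (hQ n)).mul
        hφ.1.continuous).aestronglyMeasurable
    · filter_upwards [hε] with n hn
      refine Eventually.of_forall fun x => ?_
      by_cases hx : φ x = 0
      · simp [hx]
      · have hb : |Q n x| ≤ K / (δ / 2) := by
          refine abs_mollify_le ?_
          filter_upwards [hK0] with y hy hxy
          have h1 : ‖x‖ ≤ ‖y‖ + ‖x - y‖ := by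
            have := norm_add_le y (x - y)
            simpa using this
          have h2 := hn.le.trans (min_le_right _ _)
          have h3 := hn.le.trans (min_le_left _ _)
          have h4 := (hzero x hx).1
          have h5 : ‖y‖ ≤ ‖x‖ + ‖x - y‖ := by
            have := norm_sub_le x (x - y)
            simpa using this
          have hys : y ∈ Metric.closedBall (0 : Plane) s := by
            simp only [Metric.mem_closedBall, dist_zero_right]
            linarith [(hzero x hx).2]
          rw [Set.indicator_of_mem hys, le_div_iff₀ (by positivity)]
          refine le_trans (mul_le_mul_of_nonneg_left ?_ (abs_nonneg _)) (hy (hsub hys))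
          linarith
        rw [norm_mul, norm_mul, Real.norm_eq_abs, Real.norm_eq_abs, Real.norm_eq_abs]
        refine mul_le_mul_of_nonneg_right ?_ (abs_nonneg _)
        calc |deriv f (P n x)| * |Q n x| ≤ 1 * |Q n x| :=
              mul_le_mul_of_nonneg_right (hf' _) (abs_nonneg _)
          _ ≤ _ := by rwa [one_mul]
    · exact ((hφ.1.continuous.integrable_of_hasCompactSupport hφ.2.1).abs).const_mul _
    · filter_upwards [hlimP, hlimQ] with x hx hx'
      by_cases h0 : φ x = 0
      · simp [h0]
      · have hxs : x ∈ Metric.closedBall (0 : Plane) s :=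
          Metric.closedBall_subset_closedBall hrs.le (hsupp (subset_tsupport _ h0))
        rw [Set.indicator_of_mem hxs] at hx hx'
        exact ((((hf.continuous_deriv (by simp)).tendsto _).comp hx).mul hx').mul_const _
  rw [hφ.setIntegral_mul, (hφ.partialDeriv j).setIntegral_mul]
  exact tendsto_nhds_unique (lim₁.congr' heq) lim₂.neg

theorem partialDeriv_comp_smul {φ : Plane → ℝ} (hφ : ContDiff ℝ ∞ φ) (c : ℝ) (j : Fin 2)
    (x : Plane) : partialDeriv j (fun y => φ (c • y)) x = c * partialDeriv j φ (c • x) := by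
  have h := (hφ.differentiableAt_infty (c • x)).hasFDerivAt.comp x
    ((hasFDerivAt_id x).const_smul c)
  have h2 : fderiv ℝ (fun y => φ (c • y)) x = _ := h.fderiv
  simp [partialDeriv, h2]

theorem isOpen_disc : IsOpen disc := Metric.isOpen_ball

theorem locallyIntegrableOn_disc_mul_of_bound {g d : Plane → ℝ}
    (hg : AEStronglyMeasurable g discMeasure) (hd : LocallyIntegrableOn d disc)
    (hb : ∀ x, |g x| ≤ 1) : LocallyIntegrableOn (fun x => g x * d x) disc := by
  rw [locallyIntegrableOn_iff (isOpen_disc.isLocallyClosed)] at hd ⊢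
  intro k hk hkc
  have h := (hd k hk hkc).norm
  refine h.mono' ?_ (Eventually.of_forall fun x => ?_)
  · exact (hg.mono_measure (Measure.restrict_mono hk le_rfl)).mul (hd k hk hkc).1
  · rw [norm_mul]
    exact (mul_le_mul_of_nonneg_right (hb x) (norm_nonneg _)).trans (by rw [one_mul])

/-- The weak chain rule for bounded smooth functions of a weakly differentiable function whose
gradient is bounded by a multiple of `R⁻¹`. -/
theorem HasWeakPartial.comp {p d : Plane → ℝ} {j : Fin 2}
    (hp : HasWeakPartial p j d) {K : ℝ} (hd : ∀ᵐ x ∂discMeasure, |d x| * ‖x‖ ≤ K)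
    {f : ℝ → ℝ} (hf : ContDiff ℝ ∞ f) {C : ℝ} (hC : ∀ t, |f t| ≤ C)
    (hf' : ∀ t, |deriv f t| ≤ 1) :
    HasWeakPartial (fun x => f (p x)) j (fun x => deriv f (p x) * d x) := by
  have hpm : AEStronglyMeasurable p discMeasure := hp.1.aestronglyMeasurable
  have hfm : AEStronglyMeasurable (fun x => f (p x)) discMeasure :=
    hf.continuous.comp_aestronglyMeasurable hpm
  have hf'm : AEStronglyMeasurable (fun x => deriv f (p x)) discMeasure :=
    (hf.continuous_deriv (by simp)).comp_aestronglyMeasurable hpm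
  have hC0 : 0 ≤ C := (abs_nonneg _).trans (hC 0)
  have hfi : IntegrableOn (fun x => f (p x)) disc :=
    integrable_discMeasure_of_bound hfm fun x _ => hC _
  have hld : LocallyIntegrableOn (fun x => deriv f (p x) * d x) disc :=
    locallyIntegrableOn_disc_mul_of_bound hf'm hp.2.1 fun x => hf' _
  refine ⟨hfi.locallyIntegrableOn, hld, fun φ hφ => ?_⟩
  let β : ContDiffBump (0 : Plane) := ⟨1, 2, one_pos, one_lt_two⟩
  have hβ : ContDiff ℝ ∞ (β : Plane → ℝ) := β.contDiff
  have hβc : HasCompactSupport (β : Plane → ℝ) := β.hasCompactSupport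
  -- The origin, where the bound on `d` degenerates, is cut out at scale `1 / (n + 1)`.
  set χ : ℕ → Plane → ℝ := fun n x => 1 - β (((n : ℝ) + 1) • x) with hχ
  have hχs : ∀ n, ContDiff ℝ ∞ (χ n) := fun n =>
    contDiff_const.sub (hβ.comp (contDiff_const_smul _))
  have hχ1 : ∀ n x, |χ n x| ≤ 1 := fun n x => by
    have h0 : 0 ≤ β (((n : ℝ) + 1) • x) := β.nonneg
    have h1 : β (((n : ℝ) + 1) • x) ≤ 1 := β.le_one
    rw [abs_le]
    constructor <;> simp only [hχ] <;> linarith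
  have hχlim : ∀ x : Plane, x ≠ 0 → Tendsto (fun n => χ n x) atTop (𝓝 1) := by
    intro x hx
    have hx0 : 0 < ‖x‖ := norm_pos_iff.2 hx
    refine tendsto_const_nhds.congr' ?_
    filter_upwards [eventually_ge_atTop ⌈2 / ‖x‖⌉₊] with n hn
    have h1 : 2 / ‖x‖ ≤ n := Nat.ceil_le.1 hn
    rw [div_le_iff₀ hx0] at h1
    have : β (((n : ℝ) + 1) • x) = 0 := by
      apply β.zero_of_le_dist
      simp only [dist_zero_right, norm_smul, β, Real.norm_eq_abs]
      rw [abs_of_pos (by positivity)]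
      linarith
    simp [hχ, this]
  have hkey : ∀ n : ℕ, (∫ x in disc, f (p x) * partialDeriv j φ x * χ n x) -
      ∫ x in disc, f (p x) * φ x * (((n : ℝ) + 1) * partialDeriv j β (((n : ℝ) + 1) • x)) =
      -∫ x in disc, deriv f (p x) * d x * φ x * χ n x := by
    intro n
    have h := integral_comp_mul_partialDeriv_of_eq_zero_near hp hd hf hC hf'
      (hφ.mul_right (hχs n)) (δ := 1 / ((n : ℝ) + 1)) (by positivity) (fun x hx => by
        have : β (((n : ℝ) + 1) • x) = 1 := by
          apply β.one_of_mem_closedBall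
          simp only [Metric.mem_closedBall, dist_zero_right, norm_smul, β, Real.norm_eq_abs]
          rw [abs_of_pos (by positivity)]
          rw [lt_div_iff₀ (by positivity)] at hx
          linarith
        simp [hχ, this])
    have hpt : ∀ x, partialDeriv j (fun x => φ x * χ n x) x = partialDeriv j φ x * χ n x -
        φ x * (((n : ℝ) + 1) * partialDeriv j β (((n : ℝ) + 1) • x)) := by
      intro x
      rw [partialDeriv_mul _ (hφ.1.differentiableAt_infty x) ((hχs n).differentiableAt_infty x)]
      have : partialDeriv j (χ n) x = -(((n : ℝ) + 1) * partialDeriv j β (((n : ℝ) + 1) • x)) := by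
        have hs : ContDiff ℝ ∞ fun x : Plane => β (((n : ℝ) + 1) • x) :=
          hβ.comp (contDiff_const_smul _)
        rw [hχ]
        simp only []
        rw [partialDeriv_sub _ (by fun_prop) (hs.differentiableAt_infty x),
          partialDeriv_comp_smul hβ]
        simp [partialDeriv]
      rw [this]
      ring
    simp only [hpt, mul_sub] at h
    rw [integral_sub] at h
    · simpa only [← mul_assoc] using h
    · exact LocallyIntegrableOn.integrableOn_mul_test hfi.locallyIntegrableOn
        ((hφ.partialDeriv j).mul_right (hχs n))
    · exact LocallyIntegrableOn.integrableOn_mul_test hfi.locallyIntegrableOn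
        (hφ.mul_right (contDiff_const.mul ((hβ.partialDeriv j).comp (contDiff_const_smul _))))
  have hmulχ : ∀ F : Plane → ℝ, IntegrableOn F disc →
      Tendsto (fun n => ∫ x in disc, F x * χ n x) atTop (𝓝 (∫ x in disc, F x)) := by
    intro F hF
    refine tendsto_integral_of_dominated_convergence (fun x => ‖F x‖)
      (fun n => hF.1.mul (hχs n).continuous.aestronglyMeasurable) hF.norm
      (fun n => Eventually.of_forall fun x => ?_) ?_
    · rw [norm_mul]
      exact (mul_le_mul_of_nonneg_left (hχ1 n x) (norm_nonneg _)).trans (by rw [mul_one])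
    · filter_upwards [ae_ne_zero] with x hx
      simpa using (hχlim x hx).const_mul (F x)
  -- The derivative of the cutoff has size of order `n + 1` on an area of order `(n + 1)⁻²`, hence
  -- an `L¹` norm of order `1 / (n + 1)`. The function `f ∘ p` multiplying it is bounded, so the
  -- origin contributes nothing in the limit.
  have herr : Tendsto (fun n : ℕ => ∫ x in disc, f (p x) * φ x *
      (((n : ℝ) + 1) * partialDeriv j β (((n : ℝ) + 1) • x))) atTop (𝓝 0) := by
    obtain ⟨S, hS⟩ := exists_bound_on_disc hφ.1.continuous
    have hS0 : 0 ≤ S := (abs_nonneg _).trans (hS 0 (by simp [disc]))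
    have hβi : Integrable (fun x => |partialDeriv j β x|) :=
      ((hβ.partialDeriv j).continuous.integrable_of_hasCompactSupport (hβc.partialDeriv j)).abs
    have hlim : Tendsto (fun n : ℕ => C * S * (∫ x, |partialDeriv j β x|) * (1 / ((n : ℝ) + 1)))
        atTop (𝓝 0) := by
      simpa using tendsto_one_div_add_atTop_nhds_zero_nat.const_mul
        (C * S * (∫ x, |partialDeriv j β x|))
    refine squeeze_zero_norm (fun n => ?_) hlim
    have hn : (0 : ℝ) < n + 1 := by positivity
    have hi : Integrable fun x => C * S * (((n : ℝ) + 1) *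
        |partialDeriv j β (((n : ℝ) + 1) • x)|) :=
      ((hβi.comp_smul hn.ne').const_mul _).const_mul _
    calc ‖∫ x in disc, f (p x) * φ x * (((n : ℝ) + 1) * partialDeriv j β (((n : ℝ) + 1) • x))‖
        ≤ ∫ x in disc, C * S * (((n : ℝ) + 1) * |partialDeriv j β (((n : ℝ) + 1) • x)|) := by
          refine norm_integral_le_of_norm_le hi.integrableOn ?_
          refine ae_restrict_of_forall_mem measurableSet_disc fun x hx => ?_
          rw [norm_mul, norm_mul, norm_mul, Real.norm_of_nonneg hn.le]
          exact mul_le_mul_of_nonneg_right (mul_le_mul (hC _) (hS x hx) (abs_nonneg _) hC0)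
            (by positivity)
      _ ≤ ∫ x, C * S * (((n : ℝ) + 1) * |partialDeriv j β (((n : ℝ) + 1) • x)|) :=
          setIntegral_le_integral hi (Eventually.of_forall fun x => by positivity)
      _ = _ := by
          rw [integral_const_mul, integral_const_mul,
            Measure.integral_comp_smul volume (fun x => |partialDeriv j β x|)]
          simp only [finrank_euclideanSpace, Fintype.card_fin, smul_eq_mul]
          rw [abs_of_pos (by positivity)]
          field_simp
  have h1 := (hmulχ _ (LocallyIntegrableOn.integrableOn_mul_test hfi.locallyIntegrableOn
    (hφ.partialDeriv j))).sub herr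
  have h2 := (hmulχ _ (LocallyIntegrableOn.integrableOn_mul_test hld hφ)).neg
  simp only [hkey, sub_zero] at h1
  exact tendsto_nhds_unique h1 h2

/-! ### Truncation -/

/-- A smooth truncation at height of order `n + 1`. -/
def truncate (n : ℕ) (t : ℝ) : ℝ := (n + 1) * Real.arctan (t / (n + 1))

theorem contDiff_truncate (n : ℕ) : ContDiff ℝ ∞ (truncate n) :=
  contDiff_const.mul (Real.contDiff_arctan.comp (contDiff_id.div_const _))

theorem hasDerivAt_truncate (n : ℕ) (t : ℝ) :
    HasDerivAt (truncate n) (1 / (1 + (t / (n + 1)) ^ 2)) t := by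
  have h := (((hasDerivAt_id t).div_const ((n : ℝ) + 1)).arctan).const_mul ((n : ℝ) + 1)
  refine h.congr_deriv ?_
  have : (n : ℝ) + 1 ≠ 0 := by positivity
  simp only [id]
  field_simp

theorem abs_deriv_truncate_le (n : ℕ) (t : ℝ) : |deriv (truncate n) t| ≤ 1 := by
  rw [(hasDerivAt_truncate n t).deriv, abs_of_pos (by positivity), div_le_one (by positivity)]
  nlinarith [sq_nonneg (t / ((n : ℝ) + 1))]

theorem abs_truncate_le_const (n : ℕ) (t : ℝ) : |truncate n t| ≤ (n + 1) * (Real.pi / 2) := by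
  rw [truncate, abs_mul, abs_of_pos (by positivity : (0 : ℝ) < n + 1)]
  refine mul_le_mul_of_nonneg_left (abs_le.2 ⟨?_, ?_⟩) (by positivity)
  · exact (Real.neg_pi_div_two_lt_arctan _).le
  · exact (Real.arctan_lt_pi_div_two _).le

theorem abs_truncate_le (n : ℕ) (t : ℝ) : |truncate n t| ≤ |t| := by
  have h := Convex.norm_image_sub_le_of_norm_deriv_le (f := truncate n) (C := 1) (s := Set.univ)
    (x := 0) (y := t) (fun x _ => (contDiff_truncate n).differentiableAt_infty x)
    (fun x _ => abs_deriv_truncate_le n x) convex_univ (Set.mem_univ _) (Set.mem_univ _)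
  simpa [truncate] using h

theorem tendsto_truncate (t : ℝ) : Tendsto (fun n => truncate n t) atTop (𝓝 t) := by
  rcases eq_or_ne t 0 with rfl | ht
  · simp [truncate]
  -- The arctangent has slope one at the origin, and `truncate n t` is `t` times its difference
  -- quotient there with increment `t / (n + 1)`.
  have h := (Real.hasDerivAt_arctan 0).tendsto_slope_zero
  simp only [zero_add, Real.arctan_zero, sub_zero, smul_eq_mul] at h
  have hlim : Tendsto (fun n : ℕ => t / ((n : ℝ) + 1)) atTop (𝓝[≠] 0) := by
    refine tendsto_nhdsWithin_iff.2 ⟨?_, Eventually.of_forall fun n => ?_⟩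
    · simpa [div_eq_mul_inv] using tendsto_one_div_add_atTop_nhds_zero_nat.const_mul t
    · have : (n : ℝ) + 1 ≠ 0 := by positivity
      simp [ht, this]
  have h2 := (h.comp hlim).const_mul t
  norm_num at h2
  refine h2.congr fun n => ?_
  have : (n : ℝ) + 1 ≠ 0 := by positivity
  simp only [truncate]
  field_simp

/-! ### Pressures depending only on the radius or only on the angle -/

/-- Differentiation under the integral against a merely locally integrable `p`: vanishing outside
one fixed smaller ball for all small `t` provides an integrable majorant. -/
theorem hasDerivAt_integral_mul_of_vanishing {p : Plane → ℝ} (hp : LocallyIntegrableOn p disc)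
    {h : Plane → ℝ → ℝ} (hh : ContDiff ℝ ∞ fun q : Plane × ℝ => h q.1 q.2) {r ε : ℝ} (hr : r < 1)
    (hε : 0 < ε) (hz : ∀ x t, |t| < ε → r < ‖x‖ → h x t = 0) :
    HasDerivAt (fun t => ∫ x in disc, p x * h x t) (∫ x in disc, p x * deriv (h x) 0) 0 := by
  have hh' : ContDiff ℝ ∞ fun q : Plane × ℝ => deriv (h q.1) q.2 := by
    have h1 : ContDiff ℝ ∞ (Function.uncurry fun (q : Plane × ℝ) (t : ℝ) => h q.1 t) :=
      hh.comp ((contDiff_fst.comp contDiff_fst).prodMk contDiff_snd)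
    have h2 : ContDiff ℝ ∞ fun q : Plane × ℝ => fderiv ℝ (h q.1) q.2 :=
      h1.fderiv contDiff_snd (by simp)
    exact h2.clm_apply contDiff_const
  have hsub : Metric.closedBall (0 : Plane) r ⊆ disc := Metric.closedBall_subset_ball hr
  have hpi : IntegrableOn p (Metric.closedBall 0 r) :=
    hp.integrableOn_compact_subset hsub (isCompact_closedBall 0 r)
  have hpm : AEStronglyMeasurable p discMeasure := hp.aestronglyMeasurable
  have hcx : ∀ t, Continuous fun x => h x t := fun t =>
    hh.continuous.comp (by fun_prop : Continuous fun x : Plane => (x, t))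
  have hcx' : ∀ t, Continuous fun x => deriv (h x) t := fun t =>
    hh'.continuous.comp (by fun_prop : Continuous fun x : Plane => (x, t))
  have hd : ∀ x t, HasDerivAt (h x) (deriv (h x) t) t := fun x t =>
    ((hh.comp (contDiff_const.prodMk contDiff_id) :
      ContDiff ℝ ∞ (fun t => h x t)).differentiableAt_infty t).hasDerivAt
  have hz' : ∀ x t, |t| < ε → r < ‖x‖ → deriv (h x) t = 0 := by
    intro x t ht hx
    have : h x =ᶠ[𝓝 t] fun _ => 0 := by
      filter_upwards [continuous_abs.continuousAt.eventually_lt continuousAt_const ht] with s hs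
      exact hz x s hs hx
    rw [this.deriv_eq]
    simp
  obtain ⟨C, hC⟩ := ((isCompact_closedBall (0 : Plane) r).prod
    (isCompact_Icc (a := -ε) (b := ε))).exists_bound_of_continuousOn hh'.continuous.continuousOn
  have hbound : Integrable (fun x => (Metric.closedBall (0 : Plane) r).indicator
      (fun x => |p x| * C) x) discMeasure :=
    (IntegrableOn.integrable_indicator (hpi.abs.mul_const C)
      Metric.isClosed_closedBall.measurableSet).integrableOn
  refine (hasDerivAt_integral_of_dominated_loc_of_deriv_le (𝕜 := ℝ) (μ := discMeasure)
    (F := fun t x => p x * h x t)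
    (F' := fun t x => p x * deriv (h x) t)
    (Metric.ball_mem_nhds (0 : ℝ) hε) ?_ ?_ ?_ ?_ hbound ?_).2
  · exact Eventually.of_forall fun t => hpm.mul (hcx t).aestronglyMeasurable
  · refine LocallyIntegrableOn.integrableOn_mul_test hp (isTestFunction_of_forall_eq_zero
      (hh.comp (contDiff_id.prodMk contDiff_const)) hr fun x hx => hz x 0 (by simpa using hε) hx)
  · exact hpm.mul (hcx' 0).aestronglyMeasurable
  · refine Eventually.of_forall fun x t ht => ?_
    have ht' : |t| < ε := by simpa using ht
    by_cases hx : ‖x‖ ≤ r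
    · rw [Set.indicator_of_mem (by simpa using hx), norm_mul]
      exact mul_le_mul_of_nonneg_left (hC (x, t) ⟨by simpa using hx, (abs_lt.1 ht').1.le,
        (abs_lt.1 ht').2.le⟩) (abs_nonneg _)
    · rw [hz' x t ht' (not_le.1 hx), mul_zero, norm_zero, Set.indicator_of_notMem (by simpa using hx)]
  · exact Eventually.of_forall fun x t _ => (hd x t).const_mul _

/-- A weakly differentiable function that depends only on the radius has no angular derivative. -/
theorem ae_angular_eq_zero {p : Plane → ℝ} {G : Fin 2 → Plane → ℝ}
    (hp : ∀ j, HasWeakPartial p j (G j)) (hrad : DependsOnlyOnRadius p) :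
    ∀ᵐ x ∂discMeasure, G 1 x * x 0 - G 0 x * x 1 = 0 := by
  obtain ⟨F, hF⟩ := hrad
  -- Since `p` is invariant under rotations, its pairing with a rotated test function does not
  -- depend on the angle; the derivative at angle zero is the pairing with `dTheta ψ`.
  have hzero : ∀ ψ, IsTestFunction ψ → ∫ x in disc, p x * dTheta ψ x = 0 := by
    intro ψ hψ
    obtain ⟨r, _, hr, hs⟩ := exists_tsupport_subset_closedBall hψ
    have h := hasDerivAt_integral_mul_of_vanishing (hp 0).1 (h := fun x t => ψ (rot t x))
      (contDiff_comp_rot hψ.1) hr one_pos (fun x t _ hx =>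
        image_eq_zero_of_notMem_tsupport fun h' => by
          have := hs h'
          simp at this
          linarith)
    have hconst : ∀ t, ∫ x in disc, p x * ψ (rot t x) = ∫ x in disc, p x * ψ x := by
      intro t
      have hpre : (rot t) ⁻¹' disc = disc := by
        ext x
        exact rot_mem_disc
      have hmp := (rot t).measurePreserving
      have h1 := hmp.setIntegral_preimage_emb (rot t).toHomeomorph.measurableEmbedding
        (fun x => p x * ψ x) disc
      rw [hpre] at h1
      rw [← h1]
      have hF2 : ∀ᵐ x ∂discMeasure, p (rot t x) = F ‖rot t x‖ := by
        have hmp' := hmp.restrict_preimage measurableSet_disc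
        rw [hpre] at hmp'
        exact hmp'.quasiMeasurePreserving.ae hF
      refine integral_congr_ae ?_
      filter_upwards [hF, hF2] with x h₁ h₂
      rw [h₁, h₂, norm_rot]
    simp only [hconst] at h
    have h2 := h.unique (hasDerivAt_const _ _)
    rw [← h2]
    refine integral_congr_ae (Eventually.of_forall fun x => ?_)
    have := (hasDerivAt_comp_rot hψ.1 x 0).deriv
    rw [rot_zero] at this
    simp only [this]
  have hcoord : ∀ i, Continuous fun x : Plane => x i := fun i => (contDiff_coord i).continuous
  have hloc : ∀ i j, LocallyIntegrableOn (fun x => G i x * x j) disc := fun i j =>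
    (hp i).2.1.mul_continuousOn (hcoord j).continuousOn isOpen_disc.isLocallyClosed
  have hae := IsOpen.ae_eq_zero_of_integral_contDiff_smul_eq_zero (μ := (volume : Measure Plane))
    isOpen_disc ((hloc 1 0).sub (hloc 0 1)) fun ψ hψ hc hs => ?_
  · exact (ae_restrict_iff' measurableSet_disc).2 hae
  · have hψt : IsTestFunction ψ := ⟨hψ, hc, hs⟩
    -- Each coordinate factor is differentiated only in the other direction, so no zeroth order term
    -- arises.
    have t₀ := hψt.mul_left (contDiff_coord 0)
    have t₁ := hψt.mul_left (contDiff_coord 1)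
    have w₀ := (hp 1).2.2 _ t₀
    have w₁ := (hp 0).2.2 _ t₁
    have d₀ : ∀ x, partialDeriv 1 (fun x => x 0 * ψ x) x = x 0 * partialDeriv 1 ψ x := fun x => by
      rw [partialDeriv_mul _ ((contDiff_coord 0).differentiableAt_infty x)
        (hψ.differentiableAt_infty x)]
      simp
    have d₁ : ∀ x, partialDeriv 0 (fun x => x 1 * ψ x) x = x 1 * partialDeriv 0 ψ x := fun x => by
      rw [partialDeriv_mul _ ((contDiff_coord 1).differentiableAt_infty x)
        (hψ.differentiableAt_infty x)]
      simp
    simp only [d₀] at w₀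
    simp only [d₁] at w₁
    have hz := hzero ψ hψt
    simp only [dTheta, mul_sub] at hz
    rw [integral_sub, w₀, w₁] at hz
    · have : ∀ x, ψ x • ((fun x => G 1 x * x 0) - fun x => G 0 x * x 1) x =
          (G 1 x * x 0 - G 0 x * x 1) * ψ x := fun x => by
        simp [mul_comm]
      simp only [this]
      rw [← IsTestFunction.setIntegral_mul hψt]
      simp only [sub_mul, mul_assoc]
      rw [integral_sub]
      · linarith
      · exact LocallyIntegrableOn.integrableOn_mul_test (hp 1).2.1 t₀
      · exact LocallyIntegrableOn.integrableOn_mul_test (hp 0).2.1 t₁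
    · exact LocallyIntegrableOn.integrableOn_mul_test (hp 0).1
        ((hψt.partialDeriv 1).mul_left (contDiff_coord 0))
    · exact LocallyIntegrableOn.integrableOn_mul_test (hp 0).1
        ((hψt.partialDeriv 0).mul_left (contDiff_coord 1))

/-- A weakly differentiable function that depends only on the angle has no radial derivative. -/
theorem ae_radial_eq_zero {p : Plane → ℝ} {G : Fin 2 → Plane → ℝ}
    (hp : ∀ j, HasWeakPartial p j (G j)) (hang : DependsOnlyOnAngle p) :
    ∀ᵐ x ∂discMeasure, G 0 x * x 0 + G 1 x * x 1 = 0 := by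
  obtain ⟨F, hF⟩ := hang
  -- Here `p` is homogeneous of degree zero, so dilating the test function by `exp t` multiplies its
  -- pairing with `p` by `exp (-2 * t)`, the Jacobian factor in the plane. Differentiating at `t =
  -- 0` gives the identity.
  have hzero : ∀ ψ, IsTestFunction ψ → ∫ x in disc, p x * (dR ψ x + 2 * ψ x) = 0 := by
    intro ψ hψ
    obtain ⟨r, hr0, hr, hs⟩ := exists_tsupport_subset_closedBall hψ
    have hψ0 : ∀ x, r < ‖x‖ → ψ x = 0 := fun x hx =>
      image_eq_zero_of_notMem_tsupport fun h' => by
        have := hs h'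
        simp at this
        linarith
    set s := (1 + r) / 2 with hsdef
    have hs1 : s < 1 := by linarith
    have hsr : r / s < 1 := by
      rw [div_lt_one (by linarith)]
      linarith
    have hrs0 : 0 < r / s := div_pos hr0 (by linarith)
    have hlog : 0 < -Real.log (r / s) := by
      have := Real.log_neg hrs0 hsr
      linarith
    -- For `|t| < log (s / r)` the dilated supports stay inside the ball of radius `s < 1`, so that
    -- integrals over the disc and over the plane agree.
    have hvan : ∀ (x : Plane) t, |t| < -Real.log (r / s) → s < ‖x‖ → ψ (Real.exp t • x) = 0 := by
      intro x t ht hx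
      apply hψ0
      have h1 : Real.log (r / s) < t := by linarith [(abs_lt.1 ht).1]
      rw [Real.log_lt_iff_lt_exp hrs0, div_lt_iff₀ (by linarith)] at h1
      rw [norm_smul, Real.norm_of_nonneg (Real.exp_pos t).le]
      exact h1.trans (mul_lt_mul_of_pos_left hx (Real.exp_pos t))
    have hexp : ContDiff ℝ ∞ fun q : Plane × ℝ => Real.exp q.2 • q.1 :=
      (Real.contDiff_exp.comp contDiff_snd).smul contDiff_fst
    have hsm : ContDiff ℝ ∞ fun q : Plane × ℝ => ψ (Real.exp q.2 • q.1) := hψ.1.comp hexp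
    have h := hasDerivAt_integral_mul_of_vanishing (hp 0).1
      (h := fun x t => ψ (Real.exp t • x)) hsm hs1 hlog hvan
    have hconst : ∀ t, |t| < -Real.log (r / s) → ∫ x in disc, p x * ψ (Real.exp t • x) =
        Real.exp (-2 * t) * ∫ x in disc, p x * ψ x := by
      intro t ht
      have het := Real.exp_pos t
      set c := Real.exp t
      have h1 : ∫ x in disc, p x * ψ (c • x) = ∫ x, F (‖x‖⁻¹ • x) * ψ (c • x) := by
        refine Eq.trans (b := ∫ x in disc, F (‖x‖⁻¹ • x) * ψ (c • x)) ?_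
          (setIntegral_eq_integral_of_forall_compl_eq_zero ?_)
        · refine integral_congr_ae ?_
          filter_upwards [hF] with x hx
          rw [hx]
        · intro x hx
          have : s < ‖x‖ := by
            simp only [disc, Metric.mem_ball, dist_zero_right, not_lt] at hx
            linarith
          rw [hvan x t ht this, mul_zero]
      have h2 : ∫ x in disc, p x * ψ x = ∫ x, F (‖x‖⁻¹ • x) * ψ x := by
        rw [← hψ.setIntegral_mul]
        refine integral_congr_ae ?_
        filter_upwards [hF] with x hx
        rw [hx]
      have h3 : ∀ x : Plane, F (‖x‖⁻¹ • x) * ψ (c • x) =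
          (fun y : Plane => F (‖y‖⁻¹ • y) * ψ y) (c • x) := by
        intro x
        simp only [norm_smul, Real.norm_of_nonneg het.le, smul_smul]
        congr 3
        field_simp
      rw [h1, h2, integral_congr_ae (Eventually.of_forall h3),
        Measure.integral_comp_smul volume (fun y : Plane => F (‖y‖⁻¹ • y) * ψ y)]
      simp only [finrank_euclideanSpace, Fintype.card_fin, smul_eq_mul]
      rw [abs_of_pos (by positivity)]
      congr 1
      rw [show -2 * t = -(t + t) by ring, Real.exp_neg, Real.exp_add, sq]
    have hnear : (fun t => ∫ x in disc, p x * ψ (Real.exp t • x)) =ᶠ[𝓝 0]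
        fun t => Real.exp (-2 * t) * ∫ x in disc, p x * ψ x := by
      filter_upwards [Metric.ball_mem_nhds (0 : ℝ) hlog] with t ht
      exact hconst t (by simpa using ht)
    have hd2 : HasDerivAt (fun t => Real.exp (-2 * t) * ∫ x in disc, p x * ψ x)
        (-2 * ∫ x in disc, p x * ψ x) 0 := by
      have := (((hasDerivAt_id (0 : ℝ)).const_mul (-2)).exp).mul_const (∫ x in disc, p x * ψ x)
      refine this.congr_deriv ?_
      simp
    have h2 := (h.congr_of_eventuallyEq hnear.symm).unique hd2
    have hdx : ∀ x, deriv (fun t => ψ (Real.exp t • x)) 0 = dR ψ x := by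
      intro x
      have e1 : HasDerivAt (fun t : ℝ => Real.exp t • x) x 0 := by
        have := (Real.hasDerivAt_exp 0).smul_const x
        simpa using this
      have e2 : HasFDerivAt ψ (fderiv ℝ ψ x) (Real.exp 0 • x) := by
        rw [Real.exp_zero, one_smul]
        exact (hψ.1.differentiableAt_infty x).hasFDerivAt
      rw [dR_eq_fderiv]
      exact (e2.comp_hasDerivAt (0 : ℝ) e1).deriv
    simp only [hdx] at h2
    simp only [mul_add]
    rw [integral_add, h2]
    · simp only [mul_left_comm _ (2 : ℝ)]
      rw [integral_const_mul]
      ring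
    · have : IsTestFunction (dR ψ) := ((hψ.partialDeriv 0).mul_left (contDiff_coord 0)).add
        ((hψ.partialDeriv 1).mul_left (contDiff_coord 1))
      exact LocallyIntegrableOn.integrableOn_mul_test (hp 0).1 this
    · exact LocallyIntegrableOn.integrableOn_mul_test (hp 0).1 (hψ.const_mul 2)
  have hcoord : ∀ i, Continuous fun x : Plane => x i := fun i => (contDiff_coord i).continuous
  have hloc : ∀ i j, LocallyIntegrableOn (fun x => G i x * x j) disc := fun i j =>
    (hp i).2.1.mul_continuousOn (hcoord j).continuousOn isOpen_disc.isLocallyClosed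
  have hae := IsOpen.ae_eq_zero_of_integral_contDiff_smul_eq_zero (μ := (volume : Measure Plane))
    isOpen_disc ((hloc 0 0).add (hloc 1 1)) fun ψ hψ hc hs => ?_
  · exact (ae_restrict_iff' measurableSet_disc).2 hae
  · have hψt : IsTestFunction ψ := ⟨hψ, hc, hs⟩
    have tt := fun i => hψt.mul_left (contDiff_coord i)
    have w := fun i => (hp i).2.2 _ (tt i)
    have dd : ∀ i x, partialDeriv i (fun x => x i * ψ x) x = ψ x + x i * partialDeriv i ψ x :=
      fun i x => by
        rw [partialDeriv_mul _ ((contDiff_coord i).differentiableAt_infty x)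
          (hψ.differentiableAt_infty x)]
        simp
    simp only [dd] at w
    have hz := hzero ψ hψt
    have hint : ∀ i, IntegrableOn (fun x => p x * (ψ x + x i * partialDeriv i ψ x)) disc := fun i =>
      LocallyIntegrableOn.integrableOn_mul_test (hp 0).1
        (hψt.add ((hψt.partialDeriv i).mul_left (contDiff_coord i)))
    have hsplit : ∀ x, p x * (dR ψ x + 2 * ψ x) = p x * (ψ x + x 0 * partialDeriv 0 ψ x) +
        p x * (ψ x + x 1 * partialDeriv 1 ψ x) := fun x => by
      rw [dR]
      ring
    simp only [hsplit] at hz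
    rw [integral_add (hint 0) (hint 1), w, w] at hz
    have : ∀ x, ψ x • ((fun x => G 0 x * x 0) + fun x => G 1 x * x 1) x =
        (G 0 x * x 0 + G 1 x * x 1) * ψ x := fun x => by
      simp [mul_comm]
    simp only [this]
    rw [← IsTestFunction.setIntegral_mul hψt]
    simp only [add_mul, mul_assoc]
    rw [integral_add]
    · linarith
    · exact LocallyIntegrableOn.integrableOn_mul_test (hp 0).2.1 (tt 0)
    · exact LocallyIntegrableOn.integrableOn_mul_test (hp 1).2.1 (tt 1)

/-! ### Convergence in `L²` -/

section L2
variable {X : Type*} [MeasurableSpace X] {μ : Measure X}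

theorem eLpNorm_two_eq_ofReal_sqrt {f : X → ℝ} (hf : MemLp f 2 μ) :
    eLpNorm f 2 μ = ENNReal.ofReal √(∫ x, f x ^ 2 ∂μ) := by
  rw [hf.eLpNorm_eq_integral_rpow_norm (by norm_num) (by norm_num)]
  simp [Real.sqrt_eq_rpow]

theorem tendsto_eLpNorm_two_iff {f : ℕ → X → ℝ} (hf : ∀ n, MemLp (f n) 2 μ) :
    Tendsto (fun n => eLpNorm (f n) 2 μ) atTop (𝓝 0) ↔
      Tendsto (fun n => ∫ x, f n x ^ 2 ∂μ) atTop (𝓝 0) := by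
  simp only [fun n => eLpNorm_two_eq_ofReal_sqrt (hf n)]
  constructor
  · intro h
    have h1 := (ENNReal.tendsto_toReal ENNReal.zero_ne_top).comp h
    simp only [Function.comp_def, ENNReal.toReal_ofReal (Real.sqrt_nonneg _),
      ENNReal.toReal_zero] at h1
    have h2 := h1.pow 2
    simp only [fun n => Real.sq_sqrt (integral_nonneg fun x => sq_nonneg (f n x) :
      0 ≤ ∫ x, f n x ^ 2 ∂μ)] at h2
    simpa using h2
  · intro h
    have h1 := ENNReal.tendsto_ofReal ((Real.continuous_sqrt.tendsto 0).comp h)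
    simpa using h1

/-- Convergence in `L²`, for sequences of functions. -/
structure TendstoL2 (μ : Measure X) (f : ℕ → X → ℝ) (g : X → ℝ) : Prop where
  memLp_seq : ∀ n, MemLp (f n) 2 μ
  memLp_lim : MemLp g 2 μ
  tendsto : Tendsto (fun n => eLpNorm (fun x => f n x - g x) 2 μ) atTop (𝓝 0)

namespace TendstoL2
variable {f f' : ℕ → X → ℝ} {g g' : X → ℝ}

theorem const (hg : MemLp g 2 μ) : TendstoL2 μ (fun _ => g) g :=
  ⟨fun _ => hg, hg, by simp⟩

theorem tendsto_toLp (h : TendstoL2 μ f g) :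
    Tendsto (fun n => (h.memLp_seq n).toLp (f n)) atTop (𝓝 (h.memLp_lim.toLp g)) :=
  (Lp.tendsto_Lp_iff_tendsto_eLpNorm'' f h.memLp_seq g h.memLp_lim).2 h.tendsto

theorem sub (h : TendstoL2 μ f g) (h' : TendstoL2 μ f' g') :
    TendstoL2 μ (fun n x => f n x - f' n x) (fun x => g x - g' x) := by
  refine ⟨fun n => (h.memLp_seq n).sub (h'.memLp_seq n), h.memLp_lim.sub h'.memLp_lim, ?_⟩
  have hs : Tendsto (fun n => eLpNorm (fun x => f n x - g x) 2 μ +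
      eLpNorm (fun x => f' n x - g' x) 2 μ) atTop (𝓝 0) := by
    simpa using h.tendsto.add h'.tendsto
  refine tendsto_of_tendsto_of_tendsto_of_le_of_le tendsto_const_nhds hs (fun _ => zero_le)
    fun n => ?_
  have := eLpNorm_sub_le (p := 2) (((h.memLp_seq n).sub h.memLp_lim).1)
    (((h'.memLp_seq n).sub h'.memLp_lim).1) (by norm_num)
  refine le_trans (le_of_eq ?_) this
  congr 1
  ext x
  simp only [Pi.sub_apply]
  ring

theorem mul_left (h : TendstoL2 μ f g) {l : X → ℝ} (hl : MemLp l ∞ μ) :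
    TendstoL2 μ (fun n x => l x * f n x) (fun x => l x * g x) := by
  refine ⟨fun n => (h.memLp_seq n).mul' hl, h.memLp_lim.mul' hl, ?_⟩
  have hs : Tendsto (fun n => eLpNorm l ∞ μ * eLpNorm (fun x => f n x - g x) 2 μ) atTop
      (𝓝 0) := by
    have := ENNReal.Tendsto.const_mul (a := eLpNorm l ∞ μ) h.tendsto (Or.inr hl.2.ne)
    simpa using this
  refine tendsto_of_tendsto_of_tendsto_of_le_of_le tendsto_const_nhds hs (fun _ => zero_le)
    fun n => ?_
  have := eLpNorm_smul_le_mul_eLpNorm (p := ∞) (q := 2) (r := 2)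
    ((h.memLp_seq n).sub h.memLp_lim).1 hl.1
  refine le_trans (le_of_eq ?_) this
  congr 1
  ext x
  simp only [Pi.sub_apply, Pi.smul_apply', smul_eq_mul]
  ring

theorem tendsto_integral_mul (h : TendstoL2 μ f g) (h' : TendstoL2 μ f' g') :
    Tendsto (fun n => ∫ x, f n x * f' n x ∂μ) atTop (𝓝 (∫ x, g x * g' x ∂μ)) := by
  have key : ∀ {a b : X → ℝ} (ha : MemLp a 2 μ) (hb : MemLp b 2 μ),
      inner ℝ (hb.toLp b) (ha.toLp a) = ∫ x, a x * b x ∂μ := by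
    intro a b ha hb
    rw [L2.inner_def]
    refine integral_congr_ae ?_
    filter_upwards [ha.coeFn_toLp, hb.coeFn_toLp] with x h1 h2
    rw [h1, h2]
    simp
  have := h'.tendsto_toLp.inner (𝕜 := ℝ) h.tendsto_toLp
  simpa only [key] using this

theorem tendsto_integral_mul_mul (h : TendstoL2 μ f g) (h' : TendstoL2 μ f' g') {l : X → ℝ}
    (hl : MemLp l ∞ μ) :
    Tendsto (fun n => ∫ x, l x * (f n x * f' n x) ∂μ) atTop (𝓝 (∫ x, l x * (g x * g' x) ∂μ)) := by
  simpa only [mul_assoc] using (h.mul_left hl).tendsto_integral_mul h'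

theorem tendsto_integral_sq (h : TendstoL2 μ f g) :
    Tendsto (fun n => ∫ x, f n x ^ 2 ∂μ) atTop (𝓝 (∫ x, g x ^ 2 ∂μ)) := by
  simpa only [sq] using h.tendsto_integral_mul h

theorem tendsto_integral_sub_sq (h : TendstoL2 μ f g) :
    Tendsto (fun n => ∫ x, (f n x - g x) ^ 2 ∂μ) atTop (𝓝 0) := by
  simpa using (h.sub (const h.memLp_lim)).tendsto_integral_sq

theorem of_integral_sub_sq (hf : ∀ n, MemLp (f n) 2 μ) (hg : MemLp g 2 μ)
    (h : Tendsto (fun n => ∫ x, (f n x - g x) ^ 2 ∂μ) atTop (𝓝 0)) : TendstoL2 μ f g :=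
  ⟨hf, hg, (tendsto_eLpNorm_two_iff fun n => (hf n).sub hg).2 h⟩

theorem ae_eq_zero (h : TendstoL2 μ f g)
    (h0 : Tendsto (fun n => ∫ x, f n x ^ 2 ∂μ) atTop (𝓝 0)) : g =ᵐ[μ] 0 := by
  have h1 := tendsto_nhds_unique h.tendsto_integral_sq h0
  rw [integral_eq_zero_iff_of_nonneg (fun x => sq_nonneg _) h.memLp_lim.integrable_sq] at h1
  filter_upwards [h1] with x hx
  simpa using hx

end TendstoL2

end L2

theorem memLp_of_bound_on_disc {f : Plane → ℝ} (hf : AEStronglyMeasurable f discMeasure)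
    {C : ℝ} (hC : ∀ x ∈ disc, |f x| ≤ C) (q : ℝ≥0∞) : MemLp f q discMeasure :=
  MemLp.of_bound hf C (ae_restrict_of_forall_mem measurableSet_disc hC)

theorem memLp_disc_of_continuous {f : Plane → ℝ} (hf : Continuous f) (q : ℝ≥0∞) :
    MemLp f q discMeasure := by
  obtain ⟨C, hC⟩ := exists_bound_on_disc hf
  exact memLp_of_bound_on_disc hf.aestronglyMeasurable hC q

/-! ### Polar coordinates -/

theorem continuous_circlePoint : Continuous circlePoint := by
  unfold circlePoint
  fun_prop

theorem norm_circlePoint (θ : ℝ) : ‖circlePoint θ‖ = 1 := by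
  have : ‖circlePoint θ‖ ^ 2 = 1 := by
    rw [Plane.norm_sq_eq]
    simp [circlePoint]
  exact (pow_eq_one_iff_of_nonneg (norm_nonneg _) two_ne_zero).1 this

theorem lintegral_polar {h : Plane → ℝ≥0∞} (hh : Measurable h) :
    ∫⁻ x, h x = ∫⁻ θ in Set.Ioo (-Real.pi) Real.pi, ∫⁻ R in Set.Ioi (0 : ℝ),
      ENNReal.ofReal R * h (R • circlePoint θ) := by
  have h1 : ∫⁻ x, h x = ∫⁻ q : ℝ × ℝ, h (!₂[q.1, q.2]) := by
    rw [← (PiLp.volume_preserving_toLp (Fin 2)).lintegral_comp hh,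
      ← (volume_preserving_finTwoArrow ℝ).symm.lintegral_comp (f := fun y => h (WithLp.toLp 2 y))
        (hh.comp (PiLp.volume_preserving_toLp (Fin 2)).measurable)]
    rfl
  have hmeas : Measurable fun q : ℝ × ℝ => ENNReal.ofReal q.1 * h (q.1 • circlePoint q.2) := by
    have : Continuous fun q : ℝ × ℝ => q.1 • circlePoint q.2 :=
      continuous_fst.smul (continuous_circlePoint.comp continuous_snd)
    exact measurable_fst.ennreal_ofReal.mul (hh.comp this.measurable)
  rw [h1, ← lintegral_comp_polarCoord_symm]
  have ht : polarCoord.target = Set.Ioi (0 : ℝ) ×ˢ Set.Ioo (-Real.pi) Real.pi := rfl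
  rw [ht, Measure.volume_eq_prod, ← Measure.prod_restrict,
    ← lintegral_prod_symm' _ hmeas]
  refine lintegral_congr fun q => ?_
  rw [smul_eq_mul]
  congr 2
  ext i
  fin_cases i <;> simp [circlePoint]

/-- The annulus of width `δ` inside the unit circle. -/
def annulus (δ : ℝ) : Set Plane := {x | 1 - δ < ‖x‖ ∧ ‖x‖ < 1}

theorem measurableSet_annulus (δ : ℝ) : MeasurableSet (annulus δ) :=
  (measurableSet_lt measurable_const measurable_norm).inter
    (measurableSet_lt measurable_norm measurable_const)

theorem annulus_subset_disc (δ : ℝ) : annulus δ ⊆ disc := fun x hx => by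
  simpa [disc] using hx.2

theorem lintegral_annulus {δ : ℝ} (hδ : δ ≤ 1) {h : Plane → ℝ≥0∞} (hh : Measurable h) :
    ∫⁻ x in annulus δ, h x = ∫⁻ θ in Set.Ioo (-Real.pi) Real.pi,
      ∫⁻ R in Set.Ioo (1 - δ) 1, ENNReal.ofReal R * h (R • circlePoint θ) := by
  rw [← lintegral_indicator (measurableSet_annulus δ),
    lintegral_polar (hh.indicator (measurableSet_annulus δ))]
  refine lintegral_congr fun θ => ?_
  have hsub : Set.Ioo (1 - δ) 1 ⊆ Set.Ioi (0 : ℝ) := fun R hR => by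
    have := hR.1
    simp only [Set.mem_Ioi]
    linarith
  rw [← Set.inter_eq_self_of_subset_left hsub, ← Measure.restrict_restrict measurableSet_Ioo,
    ← lintegral_indicator measurableSet_Ioo]
  refine setLIntegral_congr_fun measurableSet_Ioi fun R hR => ?_
  have hn : ‖R • circlePoint θ‖ = R := by
    rw [norm_smul, norm_circlePoint, mul_one, Real.norm_of_nonneg (le_of_lt hR)]
  have hiff : R • circlePoint θ ∈ annulus δ ↔ R ∈ Set.Ioo (1 - δ) 1 := by
    simp [annulus, hn]
  by_cases hR' : R ∈ Set.Ioo (1 - δ) 1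
  · simp [Set.indicator_of_mem hR', Set.indicator_of_mem (hiff.2 hR')]
  · simp [Set.indicator_of_notMem hR', Set.indicator_of_notMem (fun h => hR' (hiff.1 h))]

/-! ### The boundary layer estimate -/

/-- With `ρ = R - (1 - δ)`, the fundamental theorem of calculus gives `∫ (f² + 2ρff') = δ f(1)²`.
The inequality `f² ≤ 2(f² + 2ρff') + 4ρ²f'²`, together with `ρ ≤ δ` and `1/2 ≤ R ≤ 1`, yields the
constants 2 and 8. -/
theorem integral_mul_sq_le_of_hasDerivAt {f f' : ℝ → ℝ} (hf : ∀ t, HasDerivAt f (f' t) t)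
    (hf' : Continuous f') {δ : ℝ} (hδ : 0 < δ) (hδ2 : δ ≤ 1 / 2) :
    ∫ R in (1 - δ)..1, R * f R ^ 2 ≤
      2 * δ * f 1 ^ 2 + 8 * δ ^ 2 * ∫ R in (1 - δ)..1, R * f' R ^ 2 := by
  have hfc : Continuous f := continuous_iff_continuousAt.2 fun t => (hf t).continuousAt
  have hle : 1 - δ ≤ 1 := by linarith
  have hd : ∀ R, HasDerivAt (fun R => (R - (1 - δ)) * f R ^ 2)
      (f R ^ 2 + (R - (1 - δ)) * (2 * f R * f' R)) R := by
    intro R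
    refine (((hasDerivAt_id R).sub_const (1 - δ)).mul ((hf R).pow 2)).congr_deriv ?_
    simp
  have hftc := intervalIntegral.integral_eq_sub_of_hasDerivAt (a := 1 - δ) (b := 1)
    (fun R _ => hd R) ((by fun_prop : Continuous fun R =>
      f R ^ 2 + (R - (1 - δ)) * (2 * f R * f' R)).intervalIntegrable _ _)
  have hmono : ∫ R in (1 - δ)..1, (R * f R ^ 2) ≤
      ∫ R in (1 - δ)..1, (2 * (f R ^ 2 + (R - (1 - δ)) * (2 * f R * f' R)) +
        8 * δ ^ 2 * (R * f' R ^ 2)) := by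
    refine intervalIntegral.integral_mono_on hle
      ((by fun_prop : Continuous fun R => R * f R ^ 2).intervalIntegrable _ _)
      ((by fun_prop : Continuous fun R => 2 * (f R ^ 2 + (R - (1 - δ)) * (2 * f R * f' R)) +
        8 * δ ^ 2 * (R * f' R ^ 2)).intervalIntegrable _ _) fun R hR => ?_
    have hR0 : 0 ≤ R - (1 - δ) := by linarith [hR.1]
    have hRδ : R - (1 - δ) ≤ δ := by linarith [hR.2]
    have hR2 : 1 / 2 ≤ R := by linarith [hR.1]
    have e1 : R * f R ^ 2 ≤ f R ^ 2 := by nlinarith [sq_nonneg (f R), hR.2]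
    have e2 : 0 ≤ (f R + 2 * ((R - (1 - δ)) * f' R)) ^ 2 := sq_nonneg _
    have e3 : (R - (1 - δ)) ^ 2 ≤ δ ^ 2 := pow_le_pow_left₀ hR0 hRδ 2
    have e4 : (R - (1 - δ)) ^ 2 * f' R ^ 2 ≤ δ ^ 2 * f' R ^ 2 :=
      mul_le_mul_of_nonneg_right e3 (sq_nonneg _)
    have e5 : 1 / 2 * (δ ^ 2 * f' R ^ 2) ≤ R * (δ ^ 2 * f' R ^ 2) :=
      mul_le_mul_of_nonneg_right hR2 (by positivity)
    nlinarith
  refine hmono.trans (le_of_eq ?_)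
  rw [intervalIntegral.integral_add, intervalIntegral.integral_const_mul,
    intervalIntegral.integral_const_mul, hftc]
  · simp
    ring
  · exact (by fun_prop : Continuous fun R =>
      2 * (f R ^ 2 + (R - (1 - δ)) * (2 * f R * f' R))).intervalIntegrable _ _
  · exact (by fun_prop : Continuous fun R => 8 * δ ^ 2 * (R * f' R ^ 2)).intervalIntegrable _ _

theorem sq_fderiv_circlePoint_le (φ : Plane → ℝ) (x : Plane) (θ : ℝ) :
    fderiv ℝ φ x (circlePoint θ) ^ 2 ≤ partialDeriv 0 φ x ^ 2 + partialDeriv 1 φ x ^ 2 := by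
  rw [fderiv_apply_eq]
  simp only [circlePoint, Matrix.cons_val_zero, Matrix.cons_val_one]
  nlinarith [sq_nonneg (Real.cos θ * partialDeriv 1 φ x - Real.sin θ * partialDeriv 0 φ x),
    Real.sin_sq_add_cos_sq θ, sq_nonneg (partialDeriv 0 φ x), sq_nonneg (partialDeriv 1 φ x)]

/-- The one-dimensional estimate on each ray, integrated over the angle. The power `δ²` in front of
the gradient is exactly what compensates the square of the gradient of a cutoff of width `δ`. -/
theorem integral_annulus_sq_le {φ : Plane → ℝ} (hφ : ContDiff ℝ ∞ φ) {δ : ℝ} (hδ : 0 < δ)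
    (hδ2 : δ ≤ 1 / 2) :
    ∫ x in annulus δ, φ x ^ 2 ≤ 2 * δ * ∫ θ, φ (circlePoint θ) ^ 2 ∂angleMeasure +
      8 * δ ^ 2 * ∫ x in annulus δ, (partialDeriv 0 φ x ^ 2 + partialDeriv 1 φ x ^ 2) := by
  set N : Plane → ℝ := fun x => partialDeriv 0 φ x ^ 2 + partialDeriv 1 φ x ^ 2 with hN
  have hNc : Continuous N :=
    ((hφ.partialDeriv 0).continuous.pow 2).add ((hφ.partialDeriv 1).continuous.pow 2)
  have hN0 : ∀ x, 0 ≤ N x := fun x => by positivity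
  have hφc := hφ.continuous
  have hcc := continuous_circlePoint
  have hint : ∀ F : Plane → ℝ, Continuous F → IntegrableOn F (annulus δ) := fun F hF =>
    (integrableOn_disc_of_continuous hF).mono_set (annulus_subset_disc δ)
  have hcirc : IntegrableOn (fun θ => φ (circlePoint θ) ^ 2) (Set.Ioc (-Real.pi) Real.pi) :=
    ((hφc.comp hcc).pow 2).integrableOn_Ioc
  have hle : 1 - δ ≤ 1 := by linarith
  have key : ∀ θ, ∫⁻ R in Set.Ioo (1 - δ) 1, ENNReal.ofReal R *
      ENNReal.ofReal (φ (R • circlePoint θ) ^ 2) ≤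
      ENNReal.ofReal (2 * δ) * ENNReal.ofReal (φ (circlePoint θ) ^ 2) + ENNReal.ofReal (8 * δ ^ 2) *
        ∫⁻ R in Set.Ioo (1 - δ) 1, ENNReal.ofReal R * ENNReal.ofReal (N (R • circlePoint θ)) := by
    intro θ
    have hconv : ∀ F : ℝ → ℝ, Continuous F → (∀ R, 0 ≤ F R) →
        ∫⁻ R in Set.Ioo (1 - δ) 1, ENNReal.ofReal R * ENNReal.ofReal (F R) =
          ENNReal.ofReal (∫ R in (1 - δ)..1, R * F R) := by
      intro F hF hF0
      have hc : Continuous fun R => R * F R := by fun_prop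
      rw [intervalIntegral.integral_of_le hle, integral_Ioc_eq_integral_Ioo,
        ofReal_integral_eq_lintegral_ofReal (hc.integrableOn_Ioc.mono_set Set.Ioo_subset_Ioc_self)]
      · refine setLIntegral_congr_fun measurableSet_Ioo fun R hR => ?_
        rw [ENNReal.ofReal_mul (by linarith [hR.1])]
      · refine ae_restrict_of_forall_mem measurableSet_Ioo fun R hR => ?_
        exact mul_nonneg (by linarith [hR.1]) (hF0 R)
    have hline : Continuous fun R : ℝ => R • circlePoint θ := by fun_prop
    rw [hconv (fun R => φ (R • circlePoint θ) ^ 2) ((hφc.comp hline).pow 2) fun R => sq_nonneg _,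
      hconv (fun R => N (R • circlePoint θ)) (hNc.comp hline) fun R => hN0 _,
      ← ENNReal.ofReal_mul (by positivity), ← ENNReal.ofReal_mul (by positivity),
      ← ENNReal.ofReal_add (by positivity)]
    · apply ENNReal.ofReal_le_ofReal
      have hd : ∀ R : ℝ, HasDerivAt (fun R : ℝ => φ (R • circlePoint θ))
          (fderiv ℝ φ (R • circlePoint θ) (circlePoint θ)) R := by
        intro R
        have h1 : HasDerivAt (fun R : ℝ => R • circlePoint θ) (circlePoint θ) R := by
          simpa using (hasDerivAt_id R).smul_const (circlePoint θ)
        exact (hφ.differentiableAt_infty _).hasFDerivAt.comp_hasDerivAt R h1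
      have hd' : Continuous fun R : ℝ => fderiv ℝ φ (R • circlePoint θ) (circlePoint θ) :=
        ((hφ.continuous_fderiv (by simp)).comp hline).clm_apply continuous_const
      have h1 := integral_mul_sq_le_of_hasDerivAt hd hd' hδ hδ2
      rw [one_smul] at h1
      refine h1.trans (add_le_add le_rfl (mul_le_mul_of_nonneg_left ?_ (by positivity)))
      refine intervalIntegral.integral_mono_on hle
        ((continuous_id.mul (hd'.pow 2)).intervalIntegrable _ _)
        ((continuous_id.mul (hNc.comp hline)).intervalIntegrable _ _) fun R hR => ?_
      exact mul_le_mul_of_nonneg_left (sq_fderiv_circlePoint_le φ _ θ) (show (0 : ℝ) ≤ R by linarith [hR.1])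
    · refine mul_nonneg (by positivity) (intervalIntegral.integral_nonneg hle fun R hR => ?_)
      exact mul_nonneg (by linarith [hR.1]) (hN0 _)
  have hl : ∫⁻ x in annulus δ, ENNReal.ofReal (φ x ^ 2) ≤
      ENNReal.ofReal (2 * δ) * (∫⁻ θ in Set.Ioc (-Real.pi) Real.pi,
        ENNReal.ofReal (φ (circlePoint θ) ^ 2)) + ENNReal.ofReal (8 * δ ^ 2) *
          ∫⁻ x in annulus δ, ENNReal.ofReal (N x) := by
    rw [lintegral_annulus (by linarith) (by fun_prop), lintegral_annulus (by linarith)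
      hNc.measurable.ennreal_ofReal]
    refine (lintegral_mono fun θ => key θ).trans ?_
    rw [lintegral_add_left (by fun_prop), lintegral_const_mul _ (by fun_prop),
      lintegral_const_mul' _ _ ENNReal.ofReal_ne_top]
    exact add_le_add (mul_le_mul_of_nonneg_left
      (lintegral_mono_set Set.Ioo_subset_Ioc_self) zero_le) le_rfl
  rw [← ofReal_integral_eq_lintegral_ofReal (hint (fun x => φ x ^ 2) (hφc.pow 2))
      (Eventually.of_forall fun x => sq_nonneg _),
    ← ofReal_integral_eq_lintegral_ofReal (hint _ hNc) (Eventually.of_forall hN0),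
    ← ofReal_integral_eq_lintegral_ofReal hcirc (Eventually.of_forall fun x => sq_nonneg _),
    ← ENNReal.ofReal_mul (by positivity), ← ENNReal.ofReal_mul (by positivity),
    ← ENNReal.ofReal_add] at hl
  · rwa [ENNReal.ofReal_le_ofReal_iff] at hl
    exact add_nonneg (mul_nonneg (by positivity) (integral_nonneg fun x => sq_nonneg _))
      (mul_nonneg (by positivity) (integral_nonneg hN0))
  · exact mul_nonneg (by positivity) (integral_nonneg fun x => sq_nonneg _)
  · exact mul_nonneg (by positivity) (integral_nonneg hN0)

/-! ### Functions with zero trace are limits of test functions -/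

/-- A smooth cutoff function, equal to `1` up to distance `δ` from the unit circle. -/
def cutoff (δ : ℝ) (x : Plane) : ℝ := Real.smoothTransition ((1 - ‖x‖ ^ 2) / δ - 1 / 2)

theorem contDiff_cutoff (δ : ℝ) : ContDiff ℝ ∞ (cutoff δ) :=
  Real.smoothTransition.contDiff.comp
    (((contDiff_const.sub (contDiff_norm_sq ℝ)).div_const _).sub contDiff_const)

theorem cutoff_nonneg (δ : ℝ) (x : Plane) : 0 ≤ cutoff δ x := Real.smoothTransition.nonneg _

theorem cutoff_le_one (δ : ℝ) (x : Plane) : cutoff δ x ≤ 1 := Real.smoothTransition.le_one _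

theorem isTestFunction_cutoff {δ : ℝ} (hδ : 0 < δ) : IsTestFunction (cutoff δ) := by
  refine isTestFunction_of_forall_eq_zero (contDiff_cutoff δ) (r := √(1 - δ / 2)) ?_ fun x hx => ?_
  · rw [Real.sqrt_lt' one_pos]
    linarith
  · rw [Real.sqrt_lt' ((Real.sqrt_nonneg _).trans_lt hx)] at hx
    apply Real.smoothTransition.zero_of_nonpos
    rw [sub_nonpos, div_le_iff₀ hδ]
    linarith

/-- For `‖x‖ ≤ 1 - δ` the quotient is at least `2 - δ > 3/2`. The strict inequality places the point
in the interior of the region where the transition is constant, so the derivative of the cutoff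
vanishes as well. -/
theorem one_lt_cutoff_arg {δ : ℝ} (hδ : 0 < δ) (hδ2 : δ < 1 / 2) {x : Plane} (hx : x ∈ disc)
    (hxa : x ∉ annulus δ) : 1 < (1 - ‖x‖ ^ 2) / δ - 1 / 2 := by
  have hx1 : ‖x‖ < 1 := by simpa [disc] using hx
  have hle : ‖x‖ ≤ 1 - δ := not_lt.1 fun h => hxa ⟨h, hx1⟩
  have h2 : ‖x‖ ^ 2 ≤ (1 - δ) ^ 2 := pow_le_pow_left₀ (norm_nonneg _) hle 2
  rw [lt_sub_iff_add_lt, lt_div_iff₀ hδ]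
  nlinarith

theorem cutoff_eq_one {δ : ℝ} (hδ : 0 < δ) (hδ2 : δ < 1 / 2) {x : Plane} (hx : x ∈ disc)
    (hxa : x ∉ annulus δ) : cutoff δ x = 1 :=
  Real.smoothTransition.one_of_one_le (one_lt_cutoff_arg hδ hδ2 hx hxa).le

theorem partialDeriv_norm_sq (j : Fin 2) (x : Plane) :
    partialDeriv j (fun y => ‖y‖ ^ 2) x = 2 * x j := by
  rw [partialDeriv, (hasStrictFDerivAt_norm_sq x).hasFDerivAt.fderiv]
  simp [EuclideanSpace.inner_single_right]

theorem partialDeriv_cutoff (δ : ℝ) (j : Fin 2) (x : Plane) : partialDeriv j (cutoff δ) x =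
    deriv Real.smoothTransition ((1 - ‖x‖ ^ 2) / δ - 1 / 2) * (-(2 * x j) / δ) := by
  have hg : ContDiff ℝ ∞ fun x : Plane => (1 - ‖x‖ ^ 2) / δ - 1 / 2 :=
    ((contDiff_const.sub (contDiff_norm_sq ℝ)).div_const _).sub contDiff_const
  have h := partialDeriv_comp Real.smoothTransition.contDiff hg j x
  rw [show cutoff δ = fun y => Real.smoothTransition ((1 - ‖y‖ ^ 2) / δ - 1 / 2) from rfl, h]
  congr 1
  have hd : ∀ y : Plane, DifferentiableAt ℝ (fun y : Plane => ‖y‖ ^ 2) y := fun y =>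
    (contDiff_norm_sq ℝ (n := 1)).differentiable (by simp) y
  have : (fun x : Plane => (1 - ‖x‖ ^ 2) / δ - 1 / 2) =
      fun x => (1 / δ - 1 / 2) - δ⁻¹ * ‖x‖ ^ 2 := by
    ext y
    ring
  rw [this, partialDeriv_sub _ (by fun_prop) ((hd x).const_mul _),
    partialDeriv_const_mul _ _ (hd x), partialDeriv_norm_sq]
  simp [partialDeriv]
  ring

theorem exists_bound_deriv_smoothTransition : ∃ C, ∀ t, |deriv Real.smoothTransition t| ≤ C := by
  have hc : Continuous (deriv Real.smoothTransition) :=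
    (Real.smoothTransition.contDiff (n := 1)).continuous_deriv (by simp)
  obtain ⟨C, hC⟩ := (isCompact_Icc (a := (0 : ℝ)) (b := 1)).exists_bound_of_continuousOn
    hc.continuousOn
  have hC0 : 0 ≤ C := (norm_nonneg _).trans (hC 0 (by simp))
  refine ⟨C, fun t => ?_⟩
  by_cases ht : t ∈ Set.Icc (0 : ℝ) 1
  · exact hC t ht
  · have : deriv Real.smoothTransition t = 0 := by
      rw [Set.mem_Icc, not_and_or, not_le, not_le] at ht
      rcases ht with ht | ht
      · have : Real.smoothTransition =ᶠ[𝓝 t] fun _ => 0 := by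
          filter_upwards [Iio_mem_nhds ht] with s hs
          exact Real.smoothTransition.zero_of_nonpos (le_of_lt hs)
        rw [this.deriv_eq]
        simp
      · have : Real.smoothTransition =ᶠ[𝓝 t] fun _ => 1 := by
          filter_upwards [Ioi_mem_nhds ht] with s hs
          exact Real.smoothTransition.one_of_one_le (le_of_lt hs)
        rw [this.deriv_eq]
        simp
    rw [this, abs_zero]
    exact hC0

theorem deriv_smoothTransition_eq_zero {t : ℝ} (ht : 1 < t) :
    deriv Real.smoothTransition t = 0 := by
  have : Real.smoothTransition =ᶠ[𝓝 t] fun _ => 1 := by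
    filter_upwards [Ioi_mem_nhds ht] with s hs
    exact Real.smoothTransition.one_of_one_le (le_of_lt hs)
  rw [this.deriv_eq]
  simp

theorem exists_bound_partialDeriv_cutoff : ∃ C, 0 ≤ C ∧ ∀ δ, 0 < δ → ∀ x ∈ disc, ∀ j,
    |partialDeriv j (cutoff δ) x| ≤ C / δ := by
  obtain ⟨C, hC⟩ := exists_bound_deriv_smoothTransition
  have hC0 : 0 ≤ C := (abs_nonneg _).trans (hC 0)
  refine ⟨2 * C, by positivity, fun δ hδ x hx j => ?_⟩
  have hx1 : ‖x‖ < 1 := by simpa [disc] using hx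
  have hxj : |x j| ≤ 1 := (PiLp.norm_apply_le x j).trans hx1.le
  rw [partialDeriv_cutoff, abs_mul, abs_div, abs_neg, abs_mul, abs_of_pos hδ, abs_two]
  have : |deriv Real.smoothTransition ((1 - ‖x‖ ^ 2) / δ - 1 / 2)| * (2 * |x j| / δ) ≤
      C * (2 * 1 / δ) := by
    refine mul_le_mul (hC _) ?_ (by positivity) hC0
    gcongr
  refine this.trans (le_of_eq ?_)
  ring

theorem integral_disc_indicator_annulus (δ : ℝ) (F : Plane → ℝ) :
    ∫ x in disc, (annulus δ).indicator F x = ∫ x in annulus δ, F x := by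
  rw [setIntegral_indicator (measurableSet_annulus δ),
    Set.inter_eq_self_of_subset_right (annulus_subset_disc δ)]

theorem tendsto_integral_annulus {g : Plane → ℝ} (hg : IntegrableOn g disc) {δ : ℕ → ℝ}
    (hδ : Antitone δ) (hδ0 : Tendsto δ atTop (𝓝 0)) :
    Tendsto (fun n => ∫ x in annulus (δ n), g x) atTop (𝓝 0) := by
  have h := tendsto_setIntegral_of_antitone (μ := volume) (f := g) (s := fun n => annulus (δ n))
    (fun n => measurableSet_annulus _) (fun m n hmn x hx => ⟨by
      have := hδ hmn
      have := hx.1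
      linarith, hx.2⟩) ⟨0, hg.mono_set (annulus_subset_disc _)⟩
  have he : ⋂ n, annulus (δ n) = ∅ := by
    ext x
    simp only [Set.mem_iInter, Set.mem_empty_iff_false, iff_false, not_forall]
    by_cases hx : ‖x‖ < 1
    · obtain ⟨n, hn⟩ := ((tendsto_order.1 hδ0).2 (1 - ‖x‖) (by linarith)).exists
      exact ⟨n, fun h => by linarith [h.1]⟩
    · exact ⟨0, fun h => hx h.2⟩
  rw [he] at h
  simpa using h

section cutoffEstimates
variable {φ w : Plane → ℝ} {d : Fin 2 → Plane → ℝ} {δ : ℝ}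

theorem integral_annulus_sq_le_add {f g : Plane → ℝ} (hf : MemLp f 2 discMeasure)
    (hg : MemLp g 2 discMeasure) :
    ∫ x in annulus δ, f x ^ 2 ≤
      2 * (∫ x in disc, (f x - g x) ^ 2) + 2 * ∫ x in annulus δ, g x ^ 2 := by
  have hs : annulus δ ⊆ disc := annulus_subset_disc δ
  have i₁ : IntegrableOn (fun x => (f x - g x) ^ 2) disc := (hf.sub hg).integrable_sq
  have i₂ : IntegrableOn (fun x => g x ^ 2) disc := hg.integrable_sq
  have i₃ : IntegrableOn (fun x => f x ^ 2) disc := hf.integrable_sq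
  have h1 : ∫ x in annulus δ, f x ^ 2 ≤
      ∫ x in annulus δ, (2 * (f x - g x) ^ 2 + 2 * g x ^ 2) := by
    refine integral_mono (i₃.mono_set hs)
      (((i₁.mono_set hs).const_mul 2).add ((i₂.mono_set hs).const_mul 2)) fun x => ?_
    show f x ^ 2 ≤ 2 * (f x - g x) ^ 2 + 2 * g x ^ 2
    nlinarith [sq_nonneg (f x - 2 * g x)]
  rw [integral_add ((i₁.mono_set hs).const_mul 2) ((i₂.mono_set hs).const_mul 2),
    integral_const_mul, integral_const_mul] at h1
  have h2 : ∫ x in annulus δ, (f x - g x) ^ 2 ≤ ∫ x in disc, (f x - g x) ^ 2 :=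
    setIntegral_mono_set i₁ (Eventually.of_forall fun x => sq_nonneg _)
      (Eventually.of_forall hs)
  linarith

theorem integral_cutoff_mul_sub_sq_le (hφ : ContDiff ℝ ∞ φ) (hw : MemLp w 2 discMeasure)
    (hδ : 0 < δ) (hδ2 : δ < 1 / 2) :
    ∫ x in disc, (cutoff δ x * φ x - w x) ^ 2 ≤
      2 * (∫ x in disc, (φ x - w x) ^ 2) + 2 * ∫ x in annulus δ, w x ^ 2 := by
  have hφm := memLp_disc_of_continuous hφ.continuous 2
  have hψm := memLp_disc_of_continuous ((contDiff_cutoff δ).mul hφ).continuous 2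
  have i₁ : IntegrableOn (fun x => (φ x - w x) ^ 2) disc := (hφm.sub hw).integrable_sq
  have i₂ : IntegrableOn ((annulus δ).indicator fun x => w x ^ 2) disc :=
    IntegrableOn.indicator hw.integrable_sq (measurableSet_annulus δ)
  rw [← integral_disc_indicator_annulus, ← integral_const_mul, ← integral_const_mul,
    ← integral_add (i₁.const_mul 2) (i₂.const_mul 2)]
  refine setIntegral_mono_on (hψm.sub hw).integrable_sq ((i₁.const_mul 2).add (i₂.const_mul 2))
    measurableSet_disc fun x hx => ?_
  -- In the layer `χφ - w = χ(φ - w) - (1 - χ)w`; off the layer `χ = 1`.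
  by_cases hxa : x ∈ annulus δ
  · rw [Set.indicator_of_mem hxa]
    have h0 := cutoff_nonneg δ x
    have h1 := cutoff_le_one δ x
    have e1 : cutoff δ x ^ 2 ≤ 1 := by nlinarith
    have e2 : (1 - cutoff δ x) ^ 2 ≤ 1 := by nlinarith
    nlinarith [sq_nonneg (cutoff δ x * (φ x - w x) + (1 - cutoff δ x) * w x),
      mul_le_mul_of_nonneg_right e1 (sq_nonneg (φ x - w x)),
      mul_le_mul_of_nonneg_right e2 (sq_nonneg (w x))]
  · rw [Set.indicator_of_notMem hxa, cutoff_eq_one hδ hδ2 hx hxa]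
    nlinarith [sq_nonneg (φ x - w x)]

/-- The dangerous term of the product rule is `φ ∂χ`, of size `C/δ · |φ|` in the layer; the boundary
layer estimate for the smooth `φ` reduces it to boundary values over `δ` plus gradients. These
gradients are then compared with the limit `d`, whose energy in a thin layer is small. -/
theorem integral_partialDeriv_cutoff_mul_sub_sq_le (hφ : ContDiff ℝ ∞ φ)
    (hd : ∀ j, MemLp (d j) 2 discMeasure) (hδ : 0 < δ) (hδ2 : δ < 1 / 2) {C : ℝ}
    (hC : ∀ x ∈ disc, ∀ j, |partialDeriv j (cutoff δ) x| ≤ C / δ) (j : Fin 2) :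
    ∫ x in disc, (partialDeriv j (fun y => cutoff δ y * φ y) x - d j x) ^ 2 ≤
      3 * (∫ x in disc, (partialDeriv j φ x - d j x) ^ 2) + 3 * (∫ x in annulus δ, d j x ^ 2) +
      3 * C ^ 2 * (2 / δ * (∫ θ, φ (circlePoint θ) ^ 2 ∂angleMeasure) +
        8 * ∑ i, (2 * (∫ x in disc, (partialDeriv i φ x - d i x) ^ 2) +
          2 * ∫ x in annulus δ, d i x ^ 2)) := by
  have hχ := contDiff_cutoff δ
  have hdm := fun i => memLp_disc_of_continuous (hφ.partialDeriv i).continuous 2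
  have hφm := memLp_disc_of_continuous hφ.continuous 2
  have hψm := memLp_disc_of_continuous ((hχ.mul hφ).partialDeriv j).continuous 2
  have i₁ : IntegrableOn (fun x => (partialDeriv j φ x - d j x) ^ 2) disc :=
    ((hdm j).sub (hd j)).integrable_sq
  have i₂ : IntegrableOn ((annulus δ).indicator fun x => d j x ^ 2) disc :=
    IntegrableOn.indicator (hd j).integrable_sq (measurableSet_annulus δ)
  have i₃ : IntegrableOn ((annulus δ).indicator fun x => φ x ^ 2) disc :=
    IntegrableOn.indicator hφm.integrable_sq (measurableSet_annulus δ)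
  have hmain : ∫ x in disc, (partialDeriv j (fun y => cutoff δ y * φ y) x - d j x) ^ 2 ≤
      3 * (∫ x in disc, (partialDeriv j φ x - d j x) ^ 2) + 3 * (∫ x in annulus δ, d j x ^ 2) +
        3 * (C / δ) ^ 2 * ∫ x in annulus δ, φ x ^ 2 := by
    have i₁₂ : IntegrableOn (fun x => 3 * (partialDeriv j φ x - d j x) ^ 2 +
        3 * (annulus δ).indicator (fun x => d j x ^ 2) x) disc :=
      (i₁.const_mul 3).add (i₂.const_mul 3)
    rw [← integral_disc_indicator_annulus, ← integral_disc_indicator_annulus,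
      ← integral_const_mul, ← integral_const_mul, ← integral_const_mul,
      ← integral_add (i₁.const_mul 3) (i₂.const_mul 3), ← integral_add i₁₂ (i₃.const_mul _)]
    refine setIntegral_mono_on (hψm.sub (hd j)).integrable_sq (i₁₂.add (i₃.const_mul _))
      measurableSet_disc fun x hx => ?_
    rw [partialDeriv_mul _ (hχ.differentiableAt_infty x) (hφ.differentiableAt_infty x)]
    by_cases hxa : x ∈ annulus δ
    · simp only [Set.indicator_of_mem hxa]
      have h0 := cutoff_nonneg δ x
      have h1 := cutoff_le_one δ x
      have e1 : cutoff δ x ^ 2 ≤ 1 := by nlinarith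
      have e2 : (1 - cutoff δ x) ^ 2 ≤ 1 := by nlinarith
      have e3 : partialDeriv j (cutoff δ) x ^ 2 ≤ (C / δ) ^ 2 := by
        rw [← sq_abs]
        exact pow_le_pow_left₀ (abs_nonneg _) (hC x hx j) 2
      have m1 := mul_le_mul_of_nonneg_right e1 (sq_nonneg (partialDeriv j φ x - d j x))
      have m2 := mul_le_mul_of_nonneg_right e2 (sq_nonneg (d j x))
      have m3 := mul_le_mul_of_nonneg_right e3 (sq_nonneg (φ x))
      have : ∀ a b c : ℝ, (a + b - c) ^ 2 ≤ 3 * a ^ 2 + 3 * b ^ 2 + 3 * c ^ 2 := fun a b c => by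
        nlinarith [sq_nonneg (a - b), sq_nonneg (a + c), sq_nonneg (b + c)]
      have t := this (cutoff δ x * (partialDeriv j φ x - d j x))
        (partialDeriv j (cutoff δ) x * φ x) ((1 - cutoff δ x) * d j x)
      simp only [mul_pow] at t
      refine le_trans (le_of_eq ?_) (t.trans ?_)
      · ring
      · linarith
    · have hz : partialDeriv j (cutoff δ) x = 0 := by
        rw [partialDeriv_cutoff, deriv_smoothTransition_eq_zero (one_lt_cutoff_arg hδ hδ2 hx hxa),
          zero_mul]
      simp only [Set.indicator_of_notMem hxa]
      rw [hz, cutoff_eq_one hδ hδ2 hx hxa]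
      nlinarith [sq_nonneg (partialDeriv j φ x - d j x)]
  refine hmain.trans (add_le_add le_rfl ?_)
  have hb := integral_annulus_sq_le hφ hδ hδ2.le
  have hsplit : ∫ x in annulus δ, (partialDeriv 0 φ x ^ 2 + partialDeriv 1 φ x ^ 2) =
      (∫ x in annulus δ, partialDeriv 0 φ x ^ 2) + ∫ x in annulus δ, partialDeriv 1 φ x ^ 2 :=
    integral_add ((hdm 0).integrable_sq.mono_measure
        (Measure.restrict_mono (annulus_subset_disc δ) le_rfl))
      ((hdm 1).integrable_sq.mono_measure (Measure.restrict_mono (annulus_subset_disc δ) le_rfl))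
  have g := fun i => integral_annulus_sq_le_add (δ := δ) (hdm i) (hd i)
  have g' : ∫ x in annulus δ, (partialDeriv 0 φ x ^ 2 + partialDeriv 1 φ x ^ 2) ≤
      ∑ i, (2 * (∫ x in disc, (partialDeriv i φ x - d i x) ^ 2) +
          2 * ∫ x in annulus δ, d i x ^ 2) := by
    rw [hsplit, Fin.sum_univ_two]
    exact add_le_add (g 0) (g 1)
  have hb' := hb.trans (add_le_add le_rfl (mul_le_mul_of_nonneg_left g' (by positivity)))
  refine (mul_le_mul_of_nonneg_left hb' (by positivity)).trans (le_of_eq ?_)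
  field_simp

end cutoffEstimates

/-- A diagonal choice: for the layer of width `δ k` the approximant `φ (N k)` is taken so far along
that its boundary integral is at most `δ k ^ 2`, whence the critical term is at most `2 * δ k`. The
shift by 3 keeps the widths below `1/2`. -/
theorem exists_test_approximation {φ : ℕ → Plane → ℝ} {w : Plane → ℝ} {d : Fin 2 → Plane → ℝ}
    (hφ : ∀ n, ContDiff ℝ ∞ (φ n)) (hw : TendstoL2 discMeasure φ w)
    (hd : ∀ j, TendstoL2 discMeasure (fun n => partialDeriv j (φ n)) (d j))
    (htr : Tendsto (fun n => ∫ θ, φ n (circlePoint θ) ^ 2 ∂angleMeasure) atTop (𝓝 0)) :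
    ∃ ψ : ℕ → Plane → ℝ, (∀ n, IsTestFunction (ψ n)) ∧ TendstoL2 discMeasure ψ w ∧
      ∀ j, TendstoL2 discMeasure (fun n => partialDeriv j (ψ n)) (d j) := by
  set δ : ℕ → ℝ := fun k => 1 / ((k : ℝ) + 3) with hδdef
  have hδ : ∀ k, 0 < δ k := fun k => by positivity
  have hδ2 : ∀ k, δ k < 1 / 2 := fun k => by
    have : (0 : ℝ) ≤ k := k.cast_nonneg
    apply one_div_lt_one_div_of_lt <;> linarith
  have hδa : Antitone δ := fun m n hmn => by
    have : (m : ℝ) ≤ n := by exact_mod_cast hmn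
    apply one_div_le_one_div_of_le (by positivity)
    linarith
  have hδ0 : Tendsto δ atTop (𝓝 0) := by
    have := (tendsto_add_atTop_iff_nat 2).2 (tendsto_one_div_add_atTop_nhds_zero_nat (𝕜 := ℝ))
    refine this.congr fun k => ?_
    simp only [hδdef]
    push_cast
    congr 1
    ring
  have hex : ∀ k, ∃ n, k ≤ n ∧ ∫ θ, φ n (circlePoint θ) ^ 2 ∂angleMeasure ≤ δ k ^ 2 := fun k => by
    have h1 := (tendsto_order.1 htr).2 (δ k ^ 2) (by have := hδ k; positivity)
    obtain ⟨n, h2, h3⟩ := (h1.and (eventually_ge_atTop k)).exists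
    exact ⟨n, h3, h2.le⟩
  choose N hN hτ using hex
  have hNt : Tendsto N atTop atTop := tendsto_atTop_mono hN tendsto_id
  obtain ⟨C, hC0, hC⟩ := exists_bound_partialDeriv_cutoff
  have htest : ∀ k, IsTestFunction fun x => cutoff (δ k) x * φ (N k) x := fun k =>
    (isTestFunction_cutoff (hδ k)).mul_right (hφ _)
  refine ⟨fun k x => cutoff (δ k) x * φ (N k) x, htest, ?_, fun j => ?_⟩
  · refine TendstoL2.of_integral_sub_sq (fun k => memLp_disc_of_continuous (htest k).1.continuous 2)
      hw.memLp_lim ?_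
    have hlim := ((hw.tendsto_integral_sub_sq.comp hNt).const_mul 2).add
      ((tendsto_integral_annulus hw.memLp_lim.integrable_sq hδa hδ0).const_mul 2)
    simp only [mul_zero, add_zero] at hlim
    exact squeeze_zero (fun k => integral_nonneg fun x => sq_nonneg _)
      (fun k => integral_cutoff_mul_sub_sq_le (hφ (N k)) hw.memLp_lim (hδ k) (hδ2 k)) hlim
  · have hdl := fun i => (hd i).memLp_lim
    refine TendstoL2.of_integral_sub_sq (fun k => memLp_disc_of_continuous
      ((htest k).1.partialDeriv j).continuous 2) (hdl j) ?_
    have l₁ := fun i => (hd i).tendsto_integral_sub_sq.comp hNt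
    have l₂ := fun i => tendsto_integral_annulus (hdl i).integrable_sq hδa hδ0
    have l₃ : Tendsto (fun k => 2 / δ k * ∫ θ, φ (N k) (circlePoint θ) ^ 2 ∂angleMeasure) atTop
        (𝓝 0) := by
      have h2 : Tendsto (fun k => 2 * δ k) atTop (𝓝 0) := by simpa using hδ0.const_mul 2
      refine squeeze_zero (fun k => mul_nonneg (div_nonneg zero_le_two (hδ k).le)
        (integral_nonneg fun x => sq_nonneg _)) (fun k => ?_) h2
      have h3 := hδ k
      refine (mul_le_mul_of_nonneg_left (hτ k) (by positivity)).trans (le_of_eq ?_)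
      field_simp
    have l₄ := tendsto_finsetSum Finset.univ
      fun i (_ : i ∈ (Finset.univ : Finset (Fin 2))) =>
        ((l₁ i).const_mul 2).add ((l₂ i).const_mul 2)
    have hlim := (((l₁ j).const_mul 3).add ((l₂ j).const_mul 3)).add
      ((l₃.add (l₄.const_mul 8)).const_mul (3 * C ^ 2))
    simp only [mul_zero, add_zero, Finset.sum_const_zero] at hlim
    exact squeeze_zero (fun k => integral_nonneg fun x => sq_nonneg _)
      (fun k => integral_partialDeriv_cutoff_mul_sub_sq_le (hφ (N k)) hdl (hδ k) (hδ2 k)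
        (hC (δ k) (hδ k)) j) hlim

/-! ### Pressures with a bounded scaled gradient -/

/-- `|R ∂_R l| ≤ KR` and `|∂_θ l| ≤ KT` almost everywhere, in the weak sense. -/
def ScaledGradBound (l : Plane → ℝ) (KR KT : ℝ) : Prop :=
  ∃ G : Fin 2 → Plane → ℝ, (∀ j, HasWeakPartial l j (G j)) ∧
    (∀ᵐ x ∂discMeasure, |G 0 x * x 0 + G 1 x * x 1| ≤ KR) ∧
    ∀ᵐ x ∂discMeasure, |G 1 x * x 0 - G 0 x * x 1| ≤ KT

theorem WeaklyDifferentiable.hasWeakPartial {p : Plane → ℝ} (hp : WeaklyDifferentiable p)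
    (j : Fin 2) : HasWeakPartial p j (weakPartial p j) := by
  rw [weakPartial, dif_pos (hp j)]
  exact (hp j).choose_spec

/-- The density vanishes only at the origin, where `0⁻¹ = 0`, and a point is Lebesgue null. -/
theorem ae_discMeasure_of_ae_invR {P : Plane → Prop} (h : ∀ᵐ x ∂discMeasureInvR, P x) :
    ∀ᵐ x ∂discMeasure, P x := by
  rw [discMeasureInvR, ae_withDensity_iff (by fun_prop)] at h
  filter_upwards [h, ae_ne_zero] with x hx hx0
  refine hx ?_
  simpa using hx0

theorem radialPart_scaledGrad (p : Plane → ℝ) {x : Plane} (hx : x ≠ 0) :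
    radialPart (scaledGrad p) x = weakPartial p 0 x * x 0 + weakPartial p 1 x * x 1 := by
  have : ‖x‖ ≠ 0 := norm_ne_zero_iff.2 hx
  simp only [radialPart, scaledGrad, weakGrad, PiLp.smul_apply, smul_eq_mul]
  field_simp

theorem angularPart_scaledGrad (p : Plane → ℝ) {x : Plane} (hx : x ≠ 0) :
    angularPart (scaledGrad p) x = weakPartial p 1 x * x 0 - weakPartial p 0 x * x 1 := by
  have : ‖x‖ ≠ 0 := norm_ne_zero_iff.2 hx
  simp only [angularPart, scaledGrad, weakGrad, PiLp.smul_apply, smul_eq_mul]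
  field_simp

theorem ae_abs_le_of_eLpNorm_top_le {f : Plane → ℝ} {K : ℝ} (hK : 0 ≤ K)
    (h : eLpNorm f ∞ discMeasureInvR ≤ ENNReal.ofReal K) : ∀ᵐ x ∂discMeasure, |f x| ≤ K := by
  refine ae_discMeasure_of_ae_invR ?_
  rw [eLpNorm_exponent_top] at h
  filter_upwards [ae_le_eLpNormEssSup (f := f) (μ := discMeasureInvR)] with x hx
  have := hx.trans h
  rw [Real.enorm_eq_ofReal_abs] at this
  exact (ENNReal.ofReal_le_ofReal_iff hK).1 this

theorem ae_bounds_of_polarSupNorm_le {p : Plane → ℝ} {K : ℝ} (hK : 0 ≤ K)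
    (h : polarSupNorm (scaledGrad p) ≤ ENNReal.ofReal K) :
    (∀ᵐ x ∂discMeasure, |weakPartial p 0 x * x 0 + weakPartial p 1 x * x 1| ≤ K) ∧
    ∀ᵐ x ∂discMeasure, |weakPartial p 1 x * x 0 - weakPartial p 0 x * x 1| ≤ K := by
  constructor
  · filter_upwards [ae_abs_le_of_eLpNorm_top_le hK ((le_max_left _ _).trans h), ae_ne_zero]
      with x hx hx0
    rwa [radialPart_scaledGrad p hx0] at hx
  · filter_upwards [ae_abs_le_of_eLpNorm_top_le hK ((le_max_right _ _).trans h), ae_ne_zero]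
      with x hx hx0
    rwa [angularPart_scaledGrad p hx0] at hx

theorem scaledGradBound_of_polarSupNorm_le {p : Plane → ℝ} (hp : WeaklyDifferentiable p) {K : ℝ}
    (hK : 0 ≤ K) (h : polarSupNorm (scaledGrad p) ≤ ENNReal.ofReal K) : ScaledGradBound p K K :=
  ⟨_, hp.hasWeakPartial, (ae_bounds_of_polarSupNorm_le hK h).1,
    (ae_bounds_of_polarSupNorm_le hK h).2⟩

theorem scaledGradBound_of_dependsOnlyOnRadius {p : Plane → ℝ} (hp : WeaklyDifferentiable p)
    {K : ℝ} (hK : 0 ≤ K) (h : polarSupNorm (scaledGrad p) ≤ ENNReal.ofReal K)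
    (hrad : DependsOnlyOnRadius p) : ScaledGradBound p K 0 := by
  refine ⟨_, hp.hasWeakPartial, (ae_bounds_of_polarSupNorm_le hK h).1, ?_⟩
  filter_upwards [ae_angular_eq_zero hp.hasWeakPartial hrad] with x hx
  rw [hx, abs_zero]

theorem scaledGradBound_of_dependsOnlyOnAngle {p : Plane → ℝ} (hp : WeaklyDifferentiable p)
    {K : ℝ} (hK : 0 ≤ K) (h : polarSupNorm (scaledGrad p) ≤ ENNReal.ofReal K)
    (hang : DependsOnlyOnAngle p) : ScaledGradBound p 0 K := by
  refine ⟨_, hp.hasWeakPartial, ?_, (ae_bounds_of_polarSupNorm_le hK h).2⟩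
  filter_upwards [ae_radial_eq_zero hp.hasWeakPartial hang] with x hx
  rw [hx, abs_zero]

theorem abs_mul_norm_le_of_polar_bounds {g₀ g₁ KR KT : ℝ} {x : Plane}
    (hR : |g₀ * x 0 + g₁ * x 1| ≤ KR) (hT : |g₁ * x 0 - g₀ * x 1| ≤ KT) :
    |g₀| * ‖x‖ ≤ KR + KT ∧ |g₁| * ‖x‖ ≤ KR + KT := by
  have hKR := (abs_nonneg _).trans hR
  have hKT := (abs_nonneg _).trans hT
  have e : (g₀ ^ 2 + g₁ ^ 2) * ‖x‖ ^ 2 =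
      (g₀ * x 0 + g₁ * x 1) ^ 2 + (g₁ * x 0 - g₀ * x 1) ^ 2 := by
    rw [Plane.norm_sq_eq]; ring
  have a₁ := sq_le_sq' (abs_le.1 hR).1 (abs_le.1 hR).2
  have a₂ := sq_le_sq' (abs_le.1 hT).1 (abs_le.1 hT).2
  have hK := mul_nonneg hKR hKT
  constructor
  · refine abs_le_of_sq_le_sq' ?_ (add_nonneg hKR hKT) |>.2
    rw [mul_pow, sq_abs]
    nlinarith [mul_nonneg (sq_nonneg g₁) (sq_nonneg ‖x‖)]
  · refine abs_le_of_sq_le_sq' ?_ (add_nonneg hKR hKT) |>.2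
    rw [mul_pow, sq_abs]
    nlinarith [mul_nonneg (sq_nonneg g₀) (sq_nonneg ‖x‖)]

/-- The chain rule multiplies both polar components by the same derivative, of modulus at most one,
so the constants do not change. -/
theorem ScaledGradBound.truncate {p : Plane → ℝ} {KR KT : ℝ} (h : ScaledGradBound p KR KT)
    (n : ℕ) : ScaledGradBound (fun x => truncate n (p x)) KR KT := by
  obtain ⟨G, hG, hR, hT⟩ := h
  have key : ∀ j, ∀ᵐ x ∂discMeasure, |G j x| * ‖x‖ ≤ KR + KT := by
    intro j
    filter_upwards [hR, hT] with x hx hx'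
    fin_cases j
    · exact (abs_mul_norm_le_of_polar_bounds hx hx').1
    · exact (abs_mul_norm_le_of_polar_bounds hx hx').2
  refine ⟨fun j x => deriv (SmallPressure.truncate n) (p x) * G j x, fun j =>
    (hG j).comp (key j) (contDiff_truncate n) (abs_truncate_le_const n) (abs_deriv_truncate_le n),
    ?_, ?_⟩
  · filter_upwards [hR] with x hx
    rw [mul_assoc, mul_assoc, ← mul_add, abs_mul]
    exact (mul_le_of_le_one_left (abs_nonneg _) (abs_deriv_truncate_le n _)).trans hx
  · filter_upwards [hT] with x hx
    rw [mul_assoc, mul_assoc, ← mul_sub, abs_mul]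
    exact (mul_le_of_le_one_left (abs_nonneg _) (abs_deriv_truncate_le n _)).trans hx

theorem memLp_truncate {p : Plane → ℝ} (hp : LocallyIntegrableOn p disc) (n : ℕ) :
    MemLp (fun x => truncate n (p x)) ∞ discMeasure :=
  memLp_of_bound_on_disc ((contDiff_truncate n).continuous.comp_aestronglyMeasurable
    (hp.aestronglyMeasurable)) (fun x _ => abs_truncate_le_const n (p x)) ∞

/-! ### Fields of matrices -/

theorem frob_eq (A B : Mat2) :
    frob A B = A 0 0 * B 0 0 + A 0 1 * B 0 1 + (A 1 0 * B 1 0 + A 1 1 * B 1 1) := by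
  simp [frob, Fin.sum_univ_two]

theorem cof_apply (A : Mat2) : cof A 0 0 = A 1 1 ∧ cof A 0 1 = -A 1 0 ∧ cof A 1 0 = -A 0 1 ∧
    cof A 1 1 = A 0 0 := by
  simp [cof, Matrix.adjugate_fin_two]

theorem frob_cof_eq (A B : Mat2) : frob (cof A) B =
    A 1 1 * B 0 0 - A 1 0 * B 0 1 - A 0 1 * B 1 0 + A 0 0 * B 1 1 := by
  obtain ⟨h₁, h₂, h₃, h₄⟩ := cof_apply A
  rw [frob_eq, h₁, h₂, h₃, h₄]
  ring

/-- The determinant is a quadratic form on planar matrices with polarisation `cof`. For two matrices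
of determinant one this makes the linear term in their difference equal to minus its determinant. -/
theorem det_add_eq (A B : Mat2) : (A + B).det = A.det + frob (cof A) B + B.det := by
  simp only [Matrix.det_fin_two, frob_cof_eq, Matrix.add_apply]
  ring

theorem frob_self_nonneg (A : Mat2) : 0 ≤ frob A A := by
  rw [frob_eq]
  nlinarith [sq_nonneg (A 0 0), sq_nonneg (A 0 1), sq_nonneg (A 1 0), sq_nonneg (A 1 1)]

/-- A matrix field with square integrable entries. -/
def MatMemL2 (A : Plane → Mat2) : Prop := ∀ i j, MemLp (fun x => A x i j) 2 discMeasure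

/-- Entrywise convergence in `L²` of matrix fields. -/
def MatTendsto (F : ℕ → Plane → Mat2) (A : Plane → Mat2) : Prop :=
  ∀ i j, TendstoL2 discMeasure (fun n x => F n x i j) (fun x => A x i j)

theorem MatMemL2.tendsto {A : Plane → Mat2} (h : MatMemL2 A) : MatTendsto (fun _ => A) A :=
  fun i j => TendstoL2.const (h i j)

theorem MatTendsto.memL2 {F : ℕ → Plane → Mat2} {A : Plane → Mat2} (h : MatTendsto F A) :
    MatMemL2 A := fun i j => (h i j).memLp_lim

theorem MatTendsto.memL2_seq {F : ℕ → Plane → Mat2} {A : Plane → Mat2} (h : MatTendsto F A)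
    (n : ℕ) : MatMemL2 (F n) := fun i j => (h i j).memLp_seq n

theorem MatTendsto.sub {F F' : ℕ → Plane → Mat2} {A A' : Plane → Mat2} (h : MatTendsto F A)
    (h' : MatTendsto F' A') : MatTendsto (fun n x => F n x - F' n x) (fun x => A x - A' x) :=
  fun i j => (h i j).sub (h' i j)

theorem MatMemL2.sub {A B : Plane → Mat2} (hA : MatMemL2 A) (hB : MatMemL2 B) :
    MatMemL2 (fun x => A x - B x) := fun i j => (hA i j).sub (hB i j)

theorem TendstoL2.neg {X : Type*} [MeasurableSpace X] {μ : Measure X} {f : ℕ → X → ℝ} {g : X → ℝ}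
    (h : TendstoL2 μ f g) : TendstoL2 μ (fun n x => -f n x) (fun x => -g x) := by
  simpa using (TendstoL2.const (g := fun _ : X => (0 : ℝ)) (μ := μ) (by simp)).sub h

theorem MatTendsto.cof {F : ℕ → Plane → Mat2} {A : Plane → Mat2} (h : MatTendsto F A) :
    MatTendsto (fun n x => cof (F n x)) (fun x => cof (A x)) := by
  intro i j
  fin_cases i <;> fin_cases j
  · simpa [(cof_apply _).1] using h 1 1
  · simpa [(cof_apply _).2.1] using (h 1 0).neg
  · simpa [(cof_apply _).2.2.1] using (h 0 1).neg
  · simpa [(cof_apply _).2.2.2] using h 0 0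

theorem MatMemL2.cof {A : Plane → Mat2} (h : MatMemL2 A) : MatMemL2 (fun x => cof (A x)) :=
  h.tendsto.cof.memL2

theorem MatMemL2.integrable_mul_entry {A B : Plane → Mat2} (hA : MatMemL2 A) (hB : MatMemL2 B)
    {l : Plane → ℝ} (hl : MemLp l ∞ discMeasure) (i j : Fin 2) :
    Integrable (fun x => l x * (A x i j * B x i j)) discMeasure := by
  have h : MemLp (fun x => l x * A x i j) 2 discMeasure := (hA i j).mul' hl
  simpa only [mul_assoc, Pi.mul_def] using h.integrable_mul (hB i j)

theorem MatMemL2.integrable_mul_frob {A B : Plane → Mat2} (hA : MatMemL2 A) (hB : MatMemL2 B)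
    {l : Plane → ℝ} (hl : MemLp l ∞ discMeasure) :
    Integrable (fun x => l x * frob (A x) (B x)) discMeasure := by
  have key := fun i j => hA.integrable_mul_entry hB hl i j
  refine (((key 0 0).add (key 0 1)).add ((key 1 0).add (key 1 1))).congr (Eventually.of_forall fun x => ?_)
  simp only [Pi.add_apply, frob_eq]
  ring

theorem MatMemL2.integrable_frob {A B : Plane → Mat2} (hA : MatMemL2 A) (hB : MatMemL2 B) :
    Integrable (fun x => frob (A x) (B x)) discMeasure := by
  simpa using hA.integrable_mul_frob hB (memLp_top_const (1 : ℝ))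

theorem MatTendsto.tendsto_integral_mul_frob {F F' : ℕ → Plane → Mat2} {A A' : Plane → Mat2}
    (h : MatTendsto F A) (h' : MatTendsto F' A') {l : Plane → ℝ} (hl : MemLp l ∞ discMeasure) :
    Tendsto (fun n => ∫ x in disc, l x * frob (F n x) (F' n x)) atTop
      (𝓝 (∫ x in disc, l x * frob (A x) (A' x))) := by
  have key : ∀ {A B : Plane → Mat2}, MatMemL2 A → MatMemL2 B →
      ∫ x in disc, l x * frob (A x) (B x) =
        (∫ x, l x * (A x 0 0 * B x 0 0) ∂discMeasure) +
          (∫ x, l x * (A x 0 1 * B x 0 1) ∂discMeasure) +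
        ((∫ x, l x * (A x 1 0 * B x 1 0) ∂discMeasure) +
          ∫ x, l x * (A x 1 1 * B x 1 1) ∂discMeasure) := by
    intro A B hA hB
    have i := fun i j => hA.integrable_mul_entry hB hl i j
    have i₁ := (i 0 0).add (i 0 1)
    have i₂ := (i 1 0).add (i 1 1)
    rw [← integral_add (i 0 0) (i 0 1), ← integral_add (i 1 0) (i 1 1)]
    refine Eq.trans ?_ (integral_add i₁ i₂)
    refine integral_congr_ae (Eventually.of_forall fun x => ?_)
    simp only [frob_eq]
    ring
  simp only [key h.memL2 h'.memL2, fun n => key (h.memL2_seq n) (h'.memL2_seq n)]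
  have t := fun i j => (h i j).tendsto_integral_mul_mul (h' i j) hl
  exact ((t 0 0).add (t 0 1)).add ((t 1 0).add (t 1 1))

theorem MatTendsto.tendsto_integral_frob {F F' : ℕ → Plane → Mat2} {A A' : Plane → Mat2}
    (h : MatTendsto F A) (h' : MatTendsto F' A') :
    Tendsto (fun n => ∫ x in disc, frob (F n x) (F' n x)) atTop
      (𝓝 (∫ x in disc, frob (A x) (A' x))) := by
  simpa using h.tendsto_integral_mul_frob h' (memLp_top_const (1 : ℝ))

/-! ### Bounds for the pairing of the pressure with Jacobians -/

theorem det_classicalJacobian (η : Plane → Plane) (x : Plane) :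
    (classicalJacobian η x).det = bracket (fun y => η y 0) (fun y => η y 1) x := by
  simp [Matrix.det_fin_two, classicalJacobian, bracket]

theorem frob_cof_classicalJacobian (w η : Plane → Plane) (x : Plane) :
    frob (cof (classicalJacobian w x)) (classicalJacobian η x) =
      bracket (fun y => w y 0) (fun y => η y 1) x - bracket (fun y => w y 1) (fun y => η y 0) x := by
  simp only [frob_cof_eq, classicalJacobian, bracket, Matrix.of_apply]
  ring

theorem continuous_partialDeriv {φ : Plane → ℝ} (hφ : ContDiff ℝ ∞ φ) (j : Fin 2) :
    Continuous (partialDeriv j φ) := (hφ.partialDeriv j).continuous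

theorem continuous_bracket {a b : Plane → ℝ} (ha : ContDiff ℝ ∞ a) (hb : ContDiff ℝ ∞ b) :
    Continuous (bracket a b) :=
  ((continuous_partialDeriv ha 0).mul (continuous_partialDeriv hb 1)).sub
    ((continuous_partialDeriv ha 1).mul (continuous_partialDeriv hb 0))

theorem integrable_mul_bracket {l : Plane → ℝ} (hl : MemLp l ∞ discMeasure) {a b : Plane → ℝ}
    (ha : ContDiff ℝ ∞ a) (hb : ContDiff ℝ ∞ b) :
    Integrable (fun x => l x * bracket a b x) discMeasure := by
  have := MemLp.integrable_mul (p := ∞) (q := 1) hl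
    (memLp_disc_of_continuous (continuous_bracket ha hb) 1)
  exact this

theorem dirichlet_add_dirichlet {η : Plane → Plane} (hη : ∀ i, ContDiff ℝ ∞ (fun x => η x i)) :
    dirichlet (fun x => η x 0) + dirichlet (fun x => η x 1) =
      ∫ x in disc, frob (classicalJacobian η x) (classicalJacobian η x) := by
  unfold dirichlet
  rw [← integral_add (integrableOn_grad_sq (hη 0)) (integrableOn_grad_sq (hη 1))]
  refine integral_congr_ae (Eventually.of_forall fun x => ?_)
  simp only [frob_eq, classicalJacobian, Matrix.of_apply]
  ring

theorem matMemL2_classicalJacobian {η : Plane → Plane}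
    (hη : ∀ i, ContDiff ℝ ∞ (fun x => η x i)) : MatMemL2 (classicalJacobian η) := fun i j =>
  memLp_disc_of_continuous (continuous_partialDeriv (hη i) j) 2

theorem classicalJacobian_sub {w η : Plane → Plane} (hw : ∀ i, ContDiff ℝ ∞ (fun x => w x i))
    (hη : ∀ i, ContDiff ℝ ∞ (fun x => η x i)) (x : Plane) :
    classicalJacobian (fun y => w y - η y) x = classicalJacobian w x - classicalJacobian η x := by
  ext i j
  exact partialDeriv_sub j ((hw i).differentiableAt_infty x) ((hη i).differentiableAt_infty x)

theorem abs_integral_mul_frob_cof_le {l : Plane → ℝ} (hlm : MemLp l ∞ discMeasure) {KR KT : ℝ}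
    (hl : ScaledGradBound l KR KT) (hKR : 0 ≤ KR) (hKT : 0 ≤ KT) {w η : Plane → Plane}
    (hw : ∀ i, ContDiff ℝ ∞ (fun x => w x i)) (hη : ∀ i, IsTestFunction (fun x => η x i))
    {c : ℝ} (hc : 0 < c) :
    |∫ x in disc, l x * frob (cof (classicalJacobian w x)) (classicalJacobian η x)| ≤
      2 * (KR + KT) * (c * (∫ x in disc, frob (classicalJacobian w x) (classicalJacobian w x)) +
        c⁻¹ * ∫ x in disc, frob (classicalJacobian η x) (classicalJacobian η x)) := by
  obtain ⟨G, hG, hR, hT⟩ := hl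
  rw [← dirichlet_add_dirichlet hw, ← dirichlet_add_dirichlet fun i => (hη i).1]
  have h₁ := abs_integral_mul_bracket_le_dirichlet hG hKR hKT hR hT (hw 0) (hη 1) hc
  have h₂ := abs_integral_mul_bracket_le_dirichlet hG hKR hKT hR hT (hw 1) (hη 0) hc
  simp only [frob_cof_classicalJacobian, mul_sub]
  have e := integral_sub (integrable_mul_bracket hlm (hw 0) (hη 1).1)
    (integrable_mul_bracket hlm (hw 1) (hη 0).1)
  rw [discMeasure] at e
  rw [e]
  refine (abs_sub _ _).trans ?_
  linarith

theorem abs_integral_mul_frob_cof_le_of_tendsto {l : Plane → ℝ} (hlm : MemLp l ∞ discMeasure)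
    {KR KT : ℝ} (hl : ScaledGradBound l KR KT) (hKR : 0 ≤ KR) (hKT : 0 ≤ KT)
    {w : ℕ → Plane → Plane} {U : Plane → Mat2} (hw : ∀ n i, ContDiff ℝ ∞ (fun x => w n x i))
    (hU : MatTendsto (fun n => classicalJacobian (w n)) U) {η : Plane → Plane}
    (hη : ∀ i, IsTestFunction (fun x => η x i)) {c : ℝ} (hc : 0 < c) :
    |∫ x in disc, l x * frob (cof (U x)) (classicalJacobian η x)| ≤
      2 * (KR + KT) * (c * (∫ x in disc, frob (U x) (U x)) +
        c⁻¹ * ∫ x in disc, frob (classicalJacobian η x) (classicalJacobian η x)) := by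
  have hJ := (matMemL2_classicalJacobian fun i => (hη i).1).tendsto
  refine le_of_tendsto_of_tendsto' (hU.cof.tendsto_integral_mul_frob hJ hlm).abs
    (((hU.tendsto_integral_frob hU).const_mul c).add_const _ |>.const_mul _) fun n => ?_
  exact abs_integral_mul_frob_cof_le hlm hl hKR hKT (hw n) hη hc

/-- The matrix field `∇(η k) - D` is reached as the `L²` limit of gradients of the test maps `η k -
η n`. Boundedness of `l` is needed only to pass to the limit; the constant sees its gradient bounds
alone and so survives the removal of the truncation. -/
theorem abs_integral_mul_frob_cof_sub_le {l : Plane → ℝ} (hlm : MemLp l ∞ discMeasure)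
    {KR KT : ℝ} (hl : ScaledGradBound l KR KT) (hKR : 0 ≤ KR) (hKT : 0 ≤ KT)
    {w η : ℕ → Plane → Plane} {U D : Plane → Mat2}
    (hw : ∀ n i, ContDiff ℝ ∞ (fun x => w n x i))
    (hU : MatTendsto (fun n => classicalJacobian (w n)) U)
    (hη : ∀ n i, IsTestFunction (fun x => η n x i))
    (hD : MatTendsto (fun n => classicalJacobian (η n)) D) (k : ℕ) {c : ℝ} (hc : 0 < c) :
    |∫ x in disc, l x * frob (cof (U x)) (classicalJacobian (η k) x - D x)| ≤
      2 * (KR + KT) * (c * (∫ x in disc, frob (U x) (U x)) +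
        c⁻¹ * ∫ x in disc, frob (classicalJacobian (η k) x - D x)
          (classicalJacobian (η k) x - D x)) := by
  have hJ : MatTendsto (fun n x => classicalJacobian (η k) x - classicalJacobian (η n) x)
      (fun x => classicalJacobian (η k) x - D x) := (hD.memL2_seq k).tendsto.sub hD
  refine le_of_tendsto_of_tendsto' (hU.memL2.cof.tendsto.tendsto_integral_mul_frob hJ hlm).abs
    (((hJ.tendsto_integral_frob hJ).const_mul _).const_add _ |>.const_mul _) fun n => ?_
  have := abs_integral_mul_frob_cof_le_of_tendsto hlm hl hKR hKT hw hU
    (η := fun x => η k x - η n x) (fun i => (hη k i).sub (hη n i)) hc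
  simpa only [classicalJacobian_sub (fun i => (hη k i).1) fun i => (hη n i).1] using this

/-- The bound of the quadratic pressure term. -/
def quadBound (KR KT c : ℝ) (η : Plane → Plane) : ℝ :=
  KR * (angularEnergy (fun x => η x 0) + angularEnergy (fun x => η x 1)) +
    KT / 2 * (c * (fluctuation (fun x => η x 0) + fluctuation (fun x => η x 1)) +
      c⁻¹ * (radialSumEnergy (fun x => η x 0) + radialSumEnergy (fun x => η x 1)))

theorem det_eq_half_frob_cof (A : Mat2) : A.det = 1 / 2 * frob (cof A) A := by
  rw [frob_cof_eq, Matrix.det_fin_two]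
  ring

/-- For bounded `l` the integral is continuous in the `L²` topology of the gradients. A bound along
a subsequence suffices, which is the form the uniqueness argument exploits. -/
theorem two_mul_abs_integral_mul_det_le {l : Plane → ℝ} (hlm : MemLp l ∞ discMeasure)
    {KR KT : ℝ} (hl : ScaledGradBound l KR KT) (hKR : 0 ≤ KR) (hKT : 0 ≤ KT)
    {η : ℕ → Plane → Plane} {D : Plane → Mat2} (hη : ∀ n i, IsTestFunction (fun x => η n x i))
    (hD : MatTendsto (fun n => classicalJacobian (η n)) D) {c β : ℝ} (hc : 0 < c)
    (hβ : ∃ᶠ n in atTop, quadBound KR KT c (η n) ≤ β) :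
    2 * |∫ x in disc, l x * (D x).det| ≤ β := by
  obtain ⟨G, hG, hR, hT⟩ := hl
  have e : ∀ A : Plane → Mat2, ∫ x in disc, l x * (A x).det =
      1 / 2 * ∫ x in disc, l x * frob (cof (A x)) (A x) := fun A => by
    rw [← integral_const_mul]
    congr 1 with x
    rw [det_eq_half_frob_cof]
    ring
  have ht : Tendsto (fun n => 2 * |∫ x in disc, l x * (classicalJacobian (η n) x).det|) atTop
      (𝓝 (2 * |∫ x in disc, l x * (D x).det|)) := by
    simp only [e]
    exact (((hD.cof.tendsto_integral_mul_frob hD hlm).const_mul _).abs).const_mul _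
  refine le_of_tendsto_of_frequently ht (hβ.mono fun n hn => le_trans ?_ hn)
  simp only [det_classicalJacobian]
  exact two_mul_abs_integral_mul_bracket_self_le hG hKR hKT hR hT (hη n 0).1 (hη n 1) hc

/-- The pressure term of the Euler-Lagrange equation, for test maps whose gradients tend to the
difference `D` of the gradients of two maps with Jacobian determinant one. -/
theorem two_mul_abs_integral_pressure_le {p : Plane → ℝ} {KR KT : ℝ}
    (hp : ScaledGradBound p KR KT) (hKR : 0 ≤ KR) (hKT : 0 ≤ KT)
    {w η : ℕ → Plane → Plane} {U D : Plane → Mat2}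
    (hw : ∀ n i, ContDiff ℝ ∞ (fun x => w n x i))
    (hU : MatTendsto (fun n => classicalJacobian (w n)) U)
    (hη : ∀ n i, IsTestFunction (fun x => η n x i))
    (hD : MatTendsto (fun n => classicalJacobian (η n)) D)
    (hdet : ∀ᵐ x ∂discMeasure, frob (cof (U x)) (D x) + (D x).det = 0) {c β : ℝ} (hc : 0 < c)
    (hβ : ∃ᶠ n in atTop, quadBound KR KT c (η n) ≤ β) (k : ℕ)
    (hint : IntegrableOn (fun x => p x * frob (cof (U x)) (classicalJacobian (η k) x)) disc)
    {s : ℝ} (hs : 0 < s) :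
    2 * |∫ x in disc, p x * frob (cof (U x)) (classicalJacobian (η k) x)| ≤
      β + 4 * (KR + KT) * (s * (∫ x in disc, frob (U x) (U x)) +
        s⁻¹ * ∫ x in disc, frob (classicalJacobian (η k) x - D x)
          (classicalJacobian (η k) x - D x)) := by
  have hpl : LocallyIntegrableOn p disc := by
    obtain ⟨G, hG, -, -⟩ := hp
    exact (hG 0).1
  have hF : AEStronglyMeasurable (fun x => frob (cof (U x)) (classicalJacobian (η k) x))
      (volume.restrict disc) := (hU.memL2.cof.integrable_frob (hD.memL2_seq k)).1
  -- For a fixed test map the truncation is removed by dominated convergence; the majorant is the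
  -- integrability contained in the stationarity condition.
  have ht : Tendsto (fun n => ∫ x in disc, truncate n (p x) *
      frob (cof (U x)) (classicalJacobian (η k) x)) atTop
      (𝓝 (∫ x in disc, p x * frob (cof (U x)) (classicalJacobian (η k) x))) := by
    refine tendsto_integral_of_dominated_convergence _ (fun n => (memLp_truncate hpl n).1.mul hF)
      hint.norm (fun n => Eventually.of_forall fun x => ?_)
      (Eventually.of_forall fun x => (tendsto_truncate (p x)).mul_const _)
    rw [norm_mul, norm_mul]
    exact mul_le_mul_of_nonneg_right (abs_truncate_le n (p x)) (norm_nonneg _)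
  refine le_of_tendsto (ht.abs.const_mul 2) (Eventually.of_forall fun n => ?_)
  have hlm := memLp_truncate hpl n
  have hl := hp.truncate n
  have h₁ := abs_integral_mul_frob_cof_sub_le hlm hl hKR hKT hw hU hη hD k hs
  have h₂ := two_mul_abs_integral_mul_det_le hlm hl hKR hKT hη hD hc hβ
  -- The constraint replaces `cof U · D` by `-det D`. The first integral tends to zero with the
  -- approximation error, and the second is the quadratic term.
  have e₁ : ∫ x in disc, truncate n (p x) * frob (cof (U x)) (classicalJacobian (η k) x) =
      (∫ x in disc, truncate n (p x) * frob (cof (U x)) (classicalJacobian (η k) x - D x)) -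
        ∫ x in disc, truncate n (p x) * (D x).det := by
    have hi₁ := hU.memL2.cof.integrable_mul_frob ((hD.memL2_seq k).sub hD.memL2) hlm
    have hi₂ := (hD.memL2.cof.integrable_mul_frob hD.memL2 hlm).const_mul (1 / 2)
    have hi₃ : Integrable (fun x => truncate n (p x) * (D x).det) discMeasure := by
      refine hi₂.congr (Eventually.of_forall fun x => ?_)
      simp only [det_eq_half_frob_cof (D x)]
      ring
    refine Eq.trans ?_ (integral_sub hi₁ hi₃)
    refine integral_congr_ae ?_
    filter_upwards [hdet] with x hx
    simp only [frob_cof_eq, Matrix.sub_apply] at hx ⊢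
    linear_combination (truncate n (p x)) * hx
  rw [e₁]
  have h₃ := abs_sub (∫ x in disc, truncate n (p x) * frob (cof (U x))
    (classicalJacobian (η k) x - D x)) (∫ x in disc, truncate n (p x) * (D x).det)
  linarith

/-! ### Comparison of a stationary point with a competitor -/

instance : IsFiniteMeasure angleMeasure := by
  unfold angleMeasure
  infer_instance

theorem HasTrace.exists_smooth {w : Plane → ℝ} {h : ℝ → ℝ} (hw : MemW12 w) (ht : HasTrace w h) :
    ∃ φ : ℕ → Plane → ℝ, (∀ n, ContDiff ℝ ∞ (φ n)) ∧ TendstoL2 discMeasure φ w ∧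
      (∀ j, TendstoL2 discMeasure (fun n => partialDeriv j (φ n)) (weakPartial w j)) ∧
      Tendsto (fun n => eLpNorm (fun θ => φ n (circlePoint θ) - h θ) 2 angleMeasure) atTop
        (𝓝 0) := by
  obtain ⟨φ, hφ, h₀, h₁, h₂⟩ := ht
  exact ⟨φ, hφ, ⟨fun n => memLp_disc_of_continuous (hφ n).continuous 2, hw.1, h₀⟩,
    fun j => ⟨fun n => memLp_disc_of_continuous (continuous_partialDeriv (hφ n) j) 2,
      hw.2.2 j, h₁ j⟩, h₂⟩

/-- Smooth approximations of `u` and `v` both tend to `h` on the circle, so their differences have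
boundary values tending to zero. -/
theorem exists_test_of_hasTrace {u v : Plane → ℝ} (hu : MemW12 u) (hv : MemW12 v) {h : ℝ → ℝ}
    (hh : AEStronglyMeasurable h angleMeasure) (hut : HasTrace u h) (hvt : HasTrace v h) :
    ∃ ψ : ℕ → Plane → ℝ, (∀ n, IsTestFunction (ψ n)) ∧
      TendstoL2 discMeasure ψ (fun x => v x - u x) ∧
      ∀ j, TendstoL2 discMeasure (fun n => partialDeriv j (ψ n))
        (fun x => weakPartial v j x - weakPartial u j x) := by
  obtain ⟨φ, hφ, hφ₀, hφ₁, hφ₂⟩ := hvt.exists_smooth hv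
  obtain ⟨χ, hχ, hχ₀, hχ₁, hχ₂⟩ := hut.exists_smooth hu
  have hc : ∀ {f : Plane → ℝ}, ContDiff ℝ ∞ f → Continuous fun θ => f (circlePoint θ) :=
    fun hf => hf.continuous.comp continuous_circlePoint
  refine exists_test_approximation (φ := fun n x => φ n x - χ n x)
    (d := fun j x => weakPartial v j x - weakPartial u j x)
    (fun n => (hφ n).sub (hχ n)) (hφ₀.sub hχ₀) (fun j => ?_) ?_
  · have e : (fun n => partialDeriv j (fun x => φ n x - χ n x)) =
        fun n x => partialDeriv j (φ n) x - partialDeriv j (χ n) x := by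
      ext n x
      exact partialDeriv_sub j ((hφ n).differentiableAt_infty x) ((hχ n).differentiableAt_infty x)
    rw [e]
    exact (hφ₁ j).sub (hχ₁ j)
  · have hm : ∀ n, MemLp (fun θ => φ n (circlePoint θ) - χ n (circlePoint θ)) 2 angleMeasure := by
      intro n
      have hcn : Continuous fun θ => φ n (circlePoint θ) - χ n (circlePoint θ) :=
        (hc (hφ n)).sub (hc (hχ n))
      obtain ⟨C, hC⟩ := (isCompact_Icc (a := -Real.pi) (b := Real.pi)).exists_bound_of_continuousOn
        hcn.continuousOn
      exact MemLp.of_bound hcn.aestronglyMeasurable C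
        (ae_restrict_of_forall_mem measurableSet_Ioc fun θ hθ => hC θ (Set.Ioc_subset_Icc_self hθ))
    refine (tendsto_eLpNorm_two_iff hm).1 ?_
    have hs := hφ₂.add hχ₂
    rw [add_zero] at hs
    refine tendsto_of_tendsto_of_tendsto_of_le_of_le tendsto_const_nhds hs (fun _ => zero_le)
      fun n => ?_
    have := eLpNorm_sub_le (p := 2) ((hc (hφ n)).aestronglyMeasurable.sub hh)
      ((hc (hχ n)).aestronglyMeasurable.sub hh) (by norm_num)
    refine le_trans (le_of_eq ?_) this
    congr 1
    ext θ
    simp only [Pi.sub_apply]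
    ring

theorem tensorApply_sub (T : Tensor4) (A B : Mat2) :
    tensorApply T (A - B) = tensorApply T A - tensorApply T B := by
  ext i j
  simp only [tensorApply, Matrix.of_apply, Matrix.sub_apply, mul_sub, Finset.sum_sub_distrib]

theorem frob_tensorApply_comm {T : Tensor4} (hT : T.IsSymm) (A B : Mat2) :
    frob (tensorApply T A) B = frob (tensorApply T B) A := by
  have h : ∀ r s, T r s = T s r := fun r s => hT.apply s r
  simp only [frob, tensorApply, Matrix.of_apply, Fin.sum_univ_two]
  rw [h (0, 1) (0, 0), h (1, 0) (0, 0), h (1, 1) (0, 0), h (1, 0) (0, 1), h (1, 1) (0, 1),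
    h (1, 1) (1, 0)]
  ring

theorem MatMemL2.tensorApply {M : Plane → Tensor4}
    (hM : ∀ r s, MemLp (fun x => M x r s) ∞ discMeasure) {A : Plane → Mat2} (hA : MatMemL2 A) :
    MatMemL2 (fun x => tensorApply (M x) (A x)) := by
  intro i j
  have h : ∀ k l, MemLp (fun x => M x (i, j) (k, l) * A x k l) 2 discMeasure := fun k l =>
    (hA k l).mul' (hM (i, j) (k, l))
  simp only [SmallPressure.tensorApply, Matrix.of_apply, Fin.sum_univ_two]
  exact ((h 0 0).add (h 0 1)).add ((h 1 0).add (h 1 1))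

theorem integral_frob_tensorApply_eq {M : Plane → Tensor4}
    (hM : ∀ r s, MemLp (fun x => M x r s) ∞ discMeasure)
    (hsymm : ∀ᵐ x ∂discMeasure, (M x).IsSymm) {U V : Plane → Mat2} (hU : MatMemL2 U)
    (hV : MatMemL2 V) :
    ∫ x in disc, frob (tensorApply (M x) (V x)) (V x) =
      (∫ x in disc, frob (tensorApply (M x) (U x)) (U x)) +
        (∫ x in disc, frob (tensorApply (M x) (V x - U x)) (V x - U x)) +
        2 * ∫ x in disc, frob (tensorApply (M x) (U x)) (V x - U x) := by
  have hD := hV.sub hU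
  have i₁ := (hU.tensorApply hM).integrable_frob hU
  have i₂ := (hD.tensorApply hM).integrable_frob hD
  have i₃ := ((hU.tensorApply hM).integrable_frob hD).const_mul 2
  rw [discMeasure] at i₁ i₂ i₃
  have i₁₂ : IntegrableOn (fun x => frob (tensorApply (M x) (U x)) (U x) +
    frob (tensorApply (M x) (V x - U x)) (V x - U x)) disc := i₁.add i₂
  rw [← integral_const_mul, ← integral_add i₁ i₂, ← integral_add i₁₂ i₃]
  refine integral_congr_ae ?_
  filter_upwards [hsymm] with x hx
  have h := frob_tensorApply_comm hx (V x) (U x)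
  have hs : ∀ A B C : Mat2, frob A (B - C) = frob A B - frob A C := fun A B C => by
    simp only [frob_eq, Matrix.sub_apply]; ring
  have hs' : ∀ A B C : Mat2, frob (A - B) C = frob A C - frob B C := fun A B C => by
    simp only [frob_eq, Matrix.sub_apply]; ring
  simp only [tensorApply_sub, hs, hs']
  linarith

/-- Comparison of the energies of a stationary point `u` and a competitor `v`: test maps
approximating `v - u` control the difference of the energies through the bound `quadBound` of the
pressure term. -/
theorem exists_test_maps_energy_le {M : Plane → Tensor4}
    (hM : ∀ r s, MemLp (fun x => M x r s) ∞ discMeasure)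
    (hsymm : ∀ᵐ x ∂discMeasure, (M x).IsSymm) {ν : ℝ}
    (hconv : ∀ᵐ x ∂discMeasure, ∀ ξ : Mat2, ν * frob ξ ξ ≤ frob (tensorApply (M x) ξ) ξ)
    {b : Plane} {g : ℝ → Plane} (hg : ∀ i, MemW12Circle (fun θ => g θ i))
    {u v : Plane → Plane} (hu : u ∈ admissible g b) (hv : v ∈ admissible g b) {p : Plane → ℝ}
    (hup : IsStationaryWithPressure M u p) :
    ∃ (η : ℕ → Plane → Plane) (D : Plane → Mat2), (∀ n i, IsTestFunction (fun x => η n x i)) ∧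
      (∀ i, TendstoL2 discMeasure (fun n x => η n x i) (fun x => v x i - u x i)) ∧
      MatTendsto (fun n => classicalJacobian (η n)) D ∧
      ∀ KR KT : ℝ, 0 ≤ KR → 0 ≤ KT → ScaledGradBound p KR KT → ∀ c : ℝ, 0 < c → ∀ β : ℝ,
        (∃ᶠ n in atTop, quadBound KR KT c (η n) ≤ β) →
          energy M u + ν * ∫ x in disc, frob (D x) (D x) ≤ energy M v + β := by
  have hgm : ∀ i, AEStronglyMeasurable (fun θ => g θ i + b i) angleMeasure := fun i =>
    (hg i).1.1.add_const _
  choose ψ hψ hψ₀ hψ₁ using fun i =>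
    exists_test_of_hasTrace (hu.1 i) (hv.1 i) (hgm i) (hu.2.2 i) (hv.2.2 i)
  choose φ hφ _ hφ₁ _ using fun i => (hu.2.2 i).exists_smooth (hu.1 i)
  set U : Plane → Mat2 := weakJacobian u with hUdef
  set V : Plane → Mat2 := weakJacobian v with hVdef
  have hD : MatTendsto (fun n => classicalJacobian (fun x => WithLp.toLp 2 fun i => ψ i n x))
    (fun x => V x - U x) := fun i j => hψ₁ i j
  have hU : MatTendsto (fun n => classicalJacobian (fun x => WithLp.toLp 2 fun i => φ i n x)) U :=
    fun i j => hφ₁ i j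
  have hV : MatMemL2 V := fun i j => (hv.1 i).2.2 j
  refine ⟨fun n x => WithLp.toLp 2 fun i => ψ i n x, fun x => V x - U x,
    fun n i => hψ i n, hψ₀, hD, fun KR KT hKR hKT hp c hc β hβ => ?_⟩
  have hdet : ∀ᵐ x ∂discMeasure, frob (cof (U x)) (V x - U x) + (V x - U x).det = 0 := by
    filter_upwards [hu.2.1, hv.2.1] with x h₁ h₂
    have := det_add_eq (U x) (V x - U x)
    rw [add_sub_cancel, h₁, h₂] at this
    linarith
  have hX := (hU.memL2.tensorApply hM).tendsto.tendsto_integral_frob hD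
  have hz : Tendsto (fun n => ∫ x in disc,
      frob (classicalJacobian (fun x => WithLp.toLp 2 fun i => ψ i n x) x - (V x - U x))
        (classicalJacobian (fun x => WithLp.toLp 2 fun i => ψ i n x) x - (V x - U x))) atTop
      (𝓝 0) := by
    have h := hD.sub hD.memL2.tendsto
    simpa [frob] using h.tendsto_integral_frob h
  -- The limit in the test maps is taken for fixed `s`, which removes the error multiplied by `s⁻¹`;
  -- only afterwards does `s` tend to zero to remove the other one.
  have key : ∀ s : ℝ, 0 < s →
      2 * |∫ x in disc, frob (tensorApply (M x) (U x)) (V x - U x)| ≤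
        β + 4 * (KR + KT) * (s * (∫ x in disc, frob (U x) (U x)) + s⁻¹ * 0) := by
    intro s hs
    refine le_of_tendsto_of_tendsto' (hX.abs.const_mul 2)
      ((((hz.const_mul s⁻¹).const_add _).const_mul _).const_add β) fun k => ?_
    obtain ⟨h₁, h₂⟩ := hup (fun x => WithLp.toLp 2 fun i => ψ i k x) fun i => hψ i k
    rw [h₂, abs_neg]
    exact two_mul_abs_integral_pressure_le hp hKR hKT (fun n i => hφ i n) hU (fun n i => hψ i n)
      hD hdet hc hβ k h₁ hs
  have hlim : 2 * |∫ x in disc, frob (tensorApply (M x) (U x)) (V x - U x)| ≤ β := by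
    have ht : Tendsto (fun s : ℝ => β + 4 * (KR + KT) *
        (s * (∫ x in disc, frob (U x) (U x)) + s⁻¹ * 0)) (𝓝[>] 0) (𝓝 β) := by
      refine Tendsto.mono_left ?_ nhdsWithin_le_nhds
      have : Continuous fun s : ℝ => β + 4 * (KR + KT) *
        (s * (∫ x in disc, frob (U x) (U x)) + 0) := by fun_prop
      simpa using this.tendsto 0
    exact ge_of_tendsto ht (eventually_mem_nhdsWithin.mono key)
  have hE := integral_frob_tensorApply_eq hM hsymm hU.memL2 hV
  have hQ : ν * (∫ x in disc, frob (V x - U x) (V x - U x)) ≤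
      ∫ x in disc, frob (tensorApply (M x) (V x - U x)) (V x - U x) := by
    rw [← integral_const_mul]
    refine integral_mono_ae ((hD.memL2.integrable_frob hD.memL2).const_mul ν)
      ((hD.memL2.tensorApply hM).integrable_frob hD.memL2) ?_
    filter_upwards [hconv] with x hx
    exact hx _
  have h₄ := neg_abs_le (∫ x in disc, frob (tensorApply (M x) (U x)) (V x - U x))
  simp only [energy]
  linarith

/-! ### Consequences of the comparison of energies -/

/-- The divergence of `x φ²` is `2φ² + 2φ dR φ`, has zero integral, and is at least `φ² - (dR φ)²`.
On the unit disc `(dR φ)² ≤ R⁻² (dR φ)²`. -/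
theorem integral_sq_le_radialEnergy {φ : Plane → ℝ} (hφ : IsTestFunction φ) :
    ∫ x in disc, φ x ^ 2 ≤ radialEnergy φ := by
  have hd : ∀ j, IsTestFunction (fun x : Plane => x j * (φ x * φ x)) := fun j =>
    (hφ.mul_left hφ.1).mul_left (contDiff_coord j)
  have h₀ : ∀ j, ∫ x, partialDeriv j (fun x : Plane => x j * (φ x * φ x)) x = 0 := fun j =>
    integral_partialDeriv_eq_zero (hd j).1 (hd j).2.1 j
  have hdisc : ∀ j, ∫ x in disc, partialDeriv j (fun x : Plane => x j * (φ x * φ x)) x = 0 := by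
    intro j
    rw [← h₀ j]
    exact setIntegral_eq_integral_of_forall_compl_eq_zero fun x hx =>
      ((hd j).partialDeriv j).eq_zero hx
  have e : ∀ j x, partialDeriv j (fun x : Plane => x j * (φ x * φ x)) x =
      φ x ^ 2 + 2 * (x j * (φ x * partialDeriv j φ x)) := by
    intro j x
    have hφx := hφ.1.differentiableAt_infty x
    have hφφ : DifferentiableAt ℝ (fun y => φ y * φ y) x := hφx.mul hφx
    rw [partialDeriv_mul j ((contDiff_coord j).differentiableAt_infty x) hφφ,
      partialDeriv_mul j hφx hφx]
    simp only [partialDeriv_coord, if_true]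
    ring
  have i₁ : ∀ j, IntegrableOn (partialDeriv j (fun x : Plane => x j * (φ x * φ x))) disc :=
    fun j => integrableOn_disc_of_continuous (continuous_partialDeriv (hd j).1 j)
  have i₂ : IntegrableOn (fun x => φ x ^ 2) disc :=
    integrableOn_disc_of_continuous (hφ.1.continuous.pow 2)
  have i₃ := integrableOn_radialEnergy hφ.1
  have hs : ∫ x in disc, (partialDeriv 0 (fun x : Plane => x 0 * (φ x * φ x)) x +
      partialDeriv 1 (fun x : Plane => x 1 * (φ x * φ x)) x) = 0 := by
    rw [integral_add (i₁ 0) (i₁ 1), hdisc, hdisc, add_zero]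
  have hle : (∫ x in disc, φ x ^ 2) - radialEnergy φ ≤ 0 := by
    rw [radialEnergy, ← integral_sub i₂ i₃, ← hs]
    refine setIntegral_mono_on (i₂.sub i₃) ((i₁ 0).add (i₁ 1)) measurableSet_disc fun x hx => ?_
    have hR : dR φ x ^ 2 ≤ invSq x * dR φ x ^ 2 := by
      rcases eq_or_ne x 0 with rfl | hx0
      · simp [dR]
      · have h1 : ‖x‖ ^ 2 ≤ 1 := by
          have : ‖x‖ < 1 := by simpa [disc] using hx
          exact pow_le_one₀ (norm_nonneg x) this.le
        have h2 := invSq_mul_norm_sq hx0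
        have h3 : 1 ≤ invSq x := by nlinarith [invSq_nonneg x]
        exact le_mul_of_one_le_left (sq_nonneg _) h3
    rw [e, e]
    have hRdef : dR φ x = x 0 * partialDeriv 0 φ x + x 1 * partialDeriv 1 φ x := rfl
    have hmul : φ x * dR φ x = x 0 * (φ x * partialDeriv 0 φ x) +
        x 1 * (φ x * partialDeriv 1 φ x) := by
      rw [hRdef]
      ring
    have hsq := sq_nonneg (φ x + dR φ x)
    rw [add_sq, mul_assoc, hmul] at hsq
    linarith
  linarith

theorem dR_sub {φ ψ : Plane → ℝ} (hφ : ContDiff ℝ ∞ φ) (hψ : ContDiff ℝ ∞ ψ) (x : Plane) :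
    dR (fun y => φ y - ψ y) x = dR φ x - dR ψ x := by
  simp only [dR, partialDeriv_sub _ (hφ.differentiableAt_infty x) (hψ.differentiableAt_infty x)]
  ring

theorem integral_sub_circMean_sq_le {φ : Plane → ℝ} (hφ : IsTestFunction φ) :
    ∫ x in disc, (φ x - circMean φ x) ^ 2 ≤ radialFluctuation φ := by
  refine (integral_sq_le_radialEnergy (hφ.sub hφ.circMean)).trans (le_of_eq ?_)
  simp only [radialEnergy, radialFluctuation, dR_sub hφ.1 hφ.circMean.1, dR_circMean hφ.1]

/-- Wirtinger's inequality with the rotation invariant weight `R⁻²` restricted to the small ball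
handles the singularity; outside that ball the weight is at most `δ⁻²`. -/
theorem fluctuation_le_split {φ : Plane → ℝ} (hφ : ContDiff ℝ ∞ φ) {δ : ℝ} (hδ : 0 < δ) :
    fluctuation φ ≤ (∫ x in disc, (Metric.ball (0 : Plane) δ).indicator (fun _ => (1 : ℝ)) x *
        (partialDeriv 0 φ x ^ 2 + partialDeriv 1 φ x ^ 2)) +
      (δ ^ 2)⁻¹ * ∫ x in disc, (φ x - circMean φ x) ^ 2 := by
  set w : Plane → ℝ := fun x => (Metric.ball (0 : Plane) δ).indicator (fun _ => (1 : ℝ)) x * invSq x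
    with hw
  have hχ : Measurable ((Metric.ball (0 : Plane) δ).indicator (fun _ => (1 : ℝ))) :=
    measurable_const.indicator measurableSet_ball
  have hχ0 : ∀ x, 0 ≤ (Metric.ball (0 : Plane) δ).indicator (fun _ => (1 : ℝ)) x := fun x =>
    Set.indicator_nonneg (fun _ _ => zero_le_one) x
  have hχ1 : ∀ x, (Metric.ball (0 : Plane) δ).indicator (fun _ => (1 : ℝ)) x ≤ 1 := fun x =>
    Set.indicator_le_self' (fun _ _ => zero_le_one) x
  have hχb : ∀ᵐ x ∂(volume.restrict disc),
      ‖(Metric.ball (0 : Plane) δ).indicator (fun _ => (1 : ℝ)) x‖ ≤ 1 :=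
    Eventually.of_forall fun x => by rw [Real.norm_of_nonneg (hχ0 x)]; exact hχ1 x
  have hint : IntegrableOn (fun x => w x * dTheta φ x ^ 2) disc := by
    simp only [hw, mul_assoc]
    exact (integrableOn_angularEnergy hφ).bdd_mul hχ.aestronglyMeasurable hχb
  have hgi := (integrableOn_grad_sq hφ).bdd_mul hχ.aestronglyMeasurable hχb
  obtain ⟨i₁, h₁⟩ := weighted_wirtinger (hχ.mul measurable_invSq)
    (fun x => mul_nonneg (hχ0 x) (invSq_nonneg x)) (fun α x => by
      simp only [Pi.mul_apply, invSq_rot, Set.indicator, mem_ball_zero_iff, norm_rot]) hφ hint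
  have i₂ : IntegrableOn (fun x => (δ ^ 2)⁻¹ * (φ x - circMean φ x) ^ 2) disc :=
    integrableOn_disc_of_continuous (continuous_const.mul
      ((hφ.continuous.sub hφ.circMean.continuous).pow 2))
  have h₂ : fluctuation φ ≤ (∫ x in disc, w x * (φ x - circMean φ x) ^ 2) +
      ∫ x in disc, (δ ^ 2)⁻¹ * (φ x - circMean φ x) ^ 2 := by
    rw [fluctuation]
    refine le_trans (setIntegral_mono_on (integrableOn_fluctuation hφ) (i₁.add i₂)
      measurableSet_disc fun x _ => ?_) (le_of_eq (integral_add i₁ i₂))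
    simp only [Pi.add_apply, Pi.mul_apply]
    by_cases hx : x ∈ Metric.ball (0 : Plane) δ
    · rw [Set.indicator_of_mem hx, one_mul]
      have : 0 ≤ (δ ^ 2)⁻¹ * (φ x - circMean φ x) ^ 2 := by positivity
      linarith
    · rw [Set.indicator_of_notMem hx, zero_mul, zero_mul, zero_add]
      refine mul_le_mul_of_nonneg_right ?_ (sq_nonneg _)
      rw [mem_ball_zero_iff, not_lt] at hx
      exact inv_anti₀ (by positivity) (pow_le_pow_left₀ hδ.le hx 2)
  have h₃ : ∫ x in disc, w x * dTheta φ x ^ 2 ≤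
      ∫ x in disc, (Metric.ball (0 : Plane) δ).indicator (fun _ => (1 : ℝ)) x *
        (partialDeriv 0 φ x ^ 2 + partialDeriv 1 φ x ^ 2) := by
    refine setIntegral_mono_on hint hgi measurableSet_disc fun x _ => ?_
    rw [mul_assoc]
    refine mul_le_mul_of_nonneg_left ?_ (hχ0 x)
    have := invSq_mul_le (φ := φ) x
    have := mul_nonneg (invSq_nonneg x) (sq_nonneg (dR φ x))
    linarith
  rw [integral_const_mul] at h₂
  have h₁' : ∫ x in disc, w x * (φ x - circMean φ x) ^ 2 ≤ ∫ x in disc, w x * dTheta φ x ^ 2 := h₁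
  linarith

theorem tendsto_integral_ball_mul {f : Plane → ℝ} (hf : Integrable f discMeasure) :
    Tendsto (fun n : ℕ => ∫ x in disc, (Metric.ball (0 : Plane) (1 / ((n : ℝ) + 1))).indicator
      (fun _ => (1 : ℝ)) x * f x) atTop (𝓝 0) := by
  have h := tendsto_integral_of_dominated_convergence (μ := discMeasure) (fun x => ‖f x‖)
    (F := fun (n : ℕ) x => (Metric.ball (0 : Plane) (1 / ((n : ℝ) + 1))).indicator
      (fun _ => (1 : ℝ)) x * f x) (f := fun _ => (0 : ℝ))
    (fun n => ((measurable_const.indicator measurableSet_ball).aestronglyMeasurable).mul hf.1)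
    hf.norm (fun n => Eventually.of_forall fun x => ?_) ?_
  · simpa [discMeasure] using h
  · rw [norm_mul]
    refine mul_le_of_le_one_left (norm_nonneg _) ?_
    exact (norm_indicator_le_norm_self _ _).trans (by simp)
  · filter_upwards [ae_ne_zero] with x hx
    refine tendsto_const_nhds.congr' ?_
    filter_upwards [tendsto_one_div_add_atTop_nhds_zero_nat.eventually
      (gt_mem_nhds (norm_pos_iff.2 hx))] with n hn
    rw [Set.indicator_of_notMem, zero_mul]
    rw [mem_ball_zero_iff, not_lt]
    exact hn.le

/-- If the radial energies of the fluctuations of test functions with convergent gradients tend to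
zero, so do their weighted fluctuations. -/
theorem tendsto_fluctuation {η : ℕ → Plane → ℝ} (hη : ∀ n, IsTestFunction (η n))
    {d : Fin 2 → Plane → ℝ}
    (hd : ∀ j, TendstoL2 discMeasure (fun n => partialDeriv j (η n)) (d j))
    (h : Tendsto (fun n => radialFluctuation (η n)) atTop (𝓝 0)) :
    Tendsto (fun n => fluctuation (η n)) atTop (𝓝 0) := by
  have hdi : Integrable (fun x => d 0 x ^ 2 + d 1 x ^ 2) discMeasure :=
    (hd 0).memLp_lim.integrable_sq.add (hd 1).memLp_lim.integrable_sq
  refine tendsto_order.2 ⟨fun a ha => Eventually.of_forall fun n =>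
    ha.trans_le (fluctuation_nonneg _), fun ε hε => ?_⟩
  -- The limit gradient has energy below `ε` in a small enough ball, and strong convergence carries
  -- this over to the test functions. Away from the ball the unweighted fluctuation is controlled by
  -- `radialFluctuation`.
  obtain ⟨m, hm⟩ := ((tendsto_integral_ball_mul hdi).eventually (gt_mem_nhds hε)).exists
  set δ : ℝ := 1 / ((m : ℝ) + 1) with hδdef
  have hδ : 0 < δ := Nat.one_div_pos_of_nat
  have hχ : MemLp ((Metric.ball (0 : Plane) δ).indicator (fun _ => (1 : ℝ))) ∞ discMeasure :=
    memLp_of_bound_on_disc (measurable_const.indicator measurableSet_ball).aestronglyMeasurable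
      (C := 1) (fun x _ => by
        rw [← Real.norm_eq_abs]
        exact (norm_indicator_le_norm_self _ _).trans (by simp)) ∞
  have hE : ∀ a b : Plane → ℝ, MemLp a 2 discMeasure → MemLp b 2 discMeasure →
      ∫ x in disc, (Metric.ball (0 : Plane) δ).indicator (fun _ => (1 : ℝ)) x *
        (a x ^ 2 + b x ^ 2) =
      (∫ x, (Metric.ball (0 : Plane) δ).indicator (fun _ => (1 : ℝ)) x * (a x * a x) ∂discMeasure) +
      ∫ x, (Metric.ball (0 : Plane) δ).indicator (fun _ => (1 : ℝ)) x * (b x * b x)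
        ∂discMeasure := by
    intro a b ha hb
    have key : ∀ a : Plane → ℝ, MemLp a 2 discMeasure → Integrable (fun x =>
        (Metric.ball (0 : Plane) δ).indicator (fun _ => (1 : ℝ)) x * (a x * a x)) discMeasure :=
      fun a ha => by
        have h' : MemLp (fun x => (Metric.ball (0 : Plane) δ).indicator (fun _ => (1 : ℝ)) x * a x)
          2 discMeasure := ha.mul' hχ
        simpa only [mul_assoc, Pi.mul_def] using h'.integrable_mul ha
    rw [← integral_add (key a ha) (key b hb)]
    refine integral_congr_ae (Eventually.of_forall fun x => ?_)
    ring
  have ht : Tendsto (fun n => (∫ x in disc, (Metric.ball (0 : Plane) δ).indicator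
        (fun _ => (1 : ℝ)) x * (partialDeriv 0 (η n) x ^ 2 + partialDeriv 1 (η n) x ^ 2)) +
      (δ ^ 2)⁻¹ * radialFluctuation (η n)) atTop
      (𝓝 (∫ x in disc, (Metric.ball (0 : Plane) δ).indicator (fun _ => (1 : ℝ)) x *
        (d 0 x ^ 2 + d 1 x ^ 2))) := by
    have t₁ := ((hd 0).tendsto_integral_mul_mul (hd 0) hχ).add
      ((hd 1).tendsto_integral_mul_mul (hd 1) hχ)
    simp only [hE _ _ (hd 0).memLp_lim (hd 1).memLp_lim,
      fun n => hE _ _ ((hd 0).memLp_seq n) ((hd 1).memLp_seq n)]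
    simpa using t₁.add (h.const_mul (δ ^ 2)⁻¹)
  filter_upwards [ht.eventually (gt_mem_nhds hm)] with n hn
  refine lt_of_le_of_lt ((fluctuation_le_split (hη n).1 hδ).trans ?_) hn
  have := integral_sub_circMean_sq_le (hη n)
  gcongr

/-- If `R n ≥ ε` infinitely often, then `A n - R n ≤ L - ε / 2` infinitely often, and the hypothesis
returns the absurd `L ≤ L - ε / 2`. It turns a leftover term in the energy comparison into a null
sequence. -/
theorem tendsto_zero_of_forall_frequently_le {A R : ℕ → ℝ} {L : ℝ} (hA : Tendsto A atTop (𝓝 L))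
    (hR : ∀ n, 0 ≤ R n) (h : ∀ β, (∃ᶠ n in atTop, A n - R n ≤ β) → L ≤ β) :
    Tendsto R atTop (𝓝 0) := by
  refine tendsto_order.2 ⟨fun a ha => Eventually.of_forall fun n => ha.trans_le (hR n),
    fun ε hε => ?_⟩
  by_contra hcon
  rw [not_eventually] at hcon
  have hA' := hA.eventually (gt_mem_nhds (show L < L + ε / 2 by linarith))
  have := h (L - ε / 2) ((hcon.and_eventually hA').mono fun n hn => by linarith [hn.1, hn.2])
  linarith

theorem ae_eq_of_tendsto_radialEnergy {η : ℕ → Plane → Plane} {u v : Plane → Plane}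
    (hη : ∀ n i, IsTestFunction (fun x => η n x i))
    (hlim : ∀ i, TendstoL2 discMeasure (fun n x => η n x i) (fun x => v x i - u x i))
    (h : Tendsto (fun n => radialEnergy (fun x => η n x 0) + radialEnergy (fun x => η n x 1)) atTop
      (𝓝 0)) : v =ᵐ[discMeasure] u := by
  have key : ∀ i, (fun x => v x i - u x i) =ᵐ[discMeasure] 0 := by
    intro i
    refine (hlim i).ae_eq_zero (tendsto_of_tendsto_of_tendsto_of_le_of_le tendsto_const_nhds h
      (fun n => integral_nonneg fun x => sq_nonneg _) fun n => ?_)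
    refine (integral_sq_le_radialEnergy (hη n i)).trans ?_
    have h₀ := radialEnergy_nonneg fun x => η n x 0
    have h₁ := radialEnergy_nonneg fun x => η n x 1
    fin_cases i
    · exact le_add_of_nonneg_right h₁
    · exact le_add_of_nonneg_left h₀
  filter_upwards [key 0, key 1] with x h₀ h₁
  ext i
  fin_cases i
  · exact sub_eq_zero.1 h₀
  · exact sub_eq_zero.1 h₁

/-! ### Choice of the Young weight for each kind of pressure -/

section bounds
variable {η : Plane → Plane} (hη : ∀ i, ContDiff ℝ ∞ (fun x => η x i)) {K : ℝ} (hK : 0 ≤ K)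
include hη hK

/-- A weight `c` gives the coefficients `1 + c/2` for the angular and `2/c` for the radial energy.
They balance at `c = √5 - 1`; the rational value `5/4` is close and gives `13/8` and `8/5`. -/
theorem quadBound_le_dirichlet : quadBound K K (5 / 4) η ≤
    13 / 8 * K * (dirichlet (fun x => η x 0) + dirichlet (fun x => η x 1)) := by
  have key : ∀ i, K * angularEnergy (fun x => η x i) + K / 2 * (5 / 4 * fluctuation (fun x => η x i)
      + (5 / 4)⁻¹ * radialSumEnergy (fun x => η x i)) ≤ 13 / 8 * K * dirichlet fun x => η x i := by
    intro i
    rw [← radialEnergy_add_angularEnergy (hη i)]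
    have h₁ := mul_le_mul_of_nonneg_left (fluctuation_le_angularEnergy (hη i)) hK
    have h₂ := mul_le_mul_of_nonneg_left (radialSumEnergy_add_le (hη i)) hK
    have h₃ := mul_nonneg hK (radialFluctuation_nonneg fun x => η x i)
    have h₄ := mul_nonneg hK (radialEnergy_nonneg fun x => η x i)
    norm_num
    linarith
  unfold quadBound
  linarith [key 0, key 1]

/-- The weight 2 makes the coefficients of the angular and radial energies both equal to `K`. -/
theorem quadBound_angular_le : quadBound 0 K 2 η ≤
    K * (dirichlet (fun x => η x 0) + dirichlet (fun x => η x 1)) -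
      3 / 4 * K * (radialFluctuation (fun x => η x 0) + radialFluctuation (fun x => η x 1)) := by
  have key : ∀ i, K / 2 * (2 * fluctuation (fun x => η x i) +
      2⁻¹ * radialSumEnergy (fun x => η x i)) ≤
      K * dirichlet (fun x => η x i) - 3 / 4 * K * radialFluctuation fun x => η x i := by
    intro i
    rw [← radialEnergy_add_angularEnergy (hη i)]
    have h₁ := mul_le_mul_of_nonneg_left (fluctuation_le_angularEnergy (hη i)) hK
    have h₂ := mul_le_mul_of_nonneg_left (radialSumEnergy_add_le (hη i)) hK
    linarith
  unfold quadBound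
  linarith [key 0, key 1]

/-- The weight 4 halves the contribution of the radial energy at the price of a larger multiple of
the fluctuation, harmless once the fluctuation is known to tend to zero. -/
theorem quadBound_angular_le_fluctuation : quadBound 0 K 4 η ≤
    2 * K * (fluctuation (fun x => η x 0) + fluctuation (fun x => η x 1)) +
      K / 2 * (dirichlet (fun x => η x 0) + dirichlet (fun x => η x 1)) := by
  have key : ∀ i, K * radialSumEnergy (fun x => η x i) ≤ K * (4 * dirichlet fun x => η x i) :=
    fun i => mul_le_mul_of_nonneg_left (radialSumEnergy_le_dirichlet (hη i)) hK
  unfold quadBound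
  linarith [key 0, key 1]

end bounds

theorem quadBound_radial_eq {η : Plane → Plane} (hη : ∀ i, ContDiff ℝ ∞ (fun x => η x i)) (K : ℝ) :
    quadBound K 0 1 η =
    K * (dirichlet (fun x => η x 0) + dirichlet (fun x => η x 1)) -
      K * (radialEnergy (fun x => η x 0) + radialEnergy (fun x => η x 1)) := by
  rw [← radialEnergy_add_angularEnergy (hη 0), ← radialEnergy_add_angularEnergy (hη 1), quadBound]
  ring

/-! ### Minimality and uniqueness for each kind of pressure -/

section comparison
variable {M : Plane → Tensor4} (hM : ∀ r s, MemLp (fun x => M x r s) ∞ discMeasure)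
  (hsymm : ∀ᵐ x ∂discMeasure, (M x).IsSymm) {ν : ℝ}
  (hconv : ∀ᵐ x ∂discMeasure, ∀ ξ : Mat2, ν * frob ξ ξ ≤ frob (tensorApply (M x) ξ) ξ)
  {b : Plane} {g : ℝ → Plane} (hg : ∀ i, MemW12Circle (fun θ => g θ i))
  {u v : Plane → Plane} (hu : u ∈ admissible g b) (hv : v ∈ admissible g b) {p : Plane → ℝ}
  (hup : IsStationaryWithPressure M u p)
include hM hsymm hconv hg hu hv hup

/-- The energy comparison when the pressure term is dominated by the Dirichlet integral up to a
nonnegative remainder: `u` minimises the energy, and the remainder tends to zero if the competitor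
does too. -/
theorem exists_test_maps_remainder {KR KT c : ℝ} (hKR : 0 ≤ KR) (hKT : 0 ≤ KT) (hc : 0 < c)
    (hp : ScaledGradBound p KR KT) {R : (Plane → Plane) → ℝ} (hR : ∀ η, 0 ≤ R η)
    (hq : ∀ η : Plane → Plane, (∀ i, ContDiff ℝ ∞ (fun x => η x i)) → quadBound KR KT c η ≤
      ν * (dirichlet (fun x => η x 0) + dirichlet (fun x => η x 1)) - R η) :
    energy M u ≤ energy M v ∧ (energy M v ≤ energy M u →
      ∃ (η : ℕ → Plane → Plane) (D : Plane → Mat2), (∀ n i, IsTestFunction (fun x => η n x i)) ∧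
      (∀ i, TendstoL2 discMeasure (fun n x => η n x i) (fun x => v x i - u x i)) ∧
      MatTendsto (fun n => classicalJacobian (η n)) D ∧
      Tendsto (fun n => dirichlet (fun x => η n x 0) + dirichlet (fun x => η n x 1)) atTop
        (𝓝 (∫ x in disc, frob (D x) (D x))) ∧
      Tendsto (fun n => R (η n)) atTop (𝓝 0) ∧
      ∀ c' : ℝ, 0 < c' → ∀ β : ℝ, (∃ᶠ n in atTop, quadBound KR KT c' (η n) ≤ β) →
        ν * ∫ x in disc, frob (D x) (D x) ≤ β) := by
  obtain ⟨η, D, hη, hlim, hD, h⟩ := exists_test_maps_energy_le hM hsymm hconv hg hu hv hup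
  have hA : Tendsto (fun n => dirichlet (fun x => η n x 0) + dirichlet (fun x => η n x 1)) atTop
      (𝓝 (∫ x in disc, frob (D x) (D x))) := by
    simpa only [dirichlet_add_dirichlet fun i => (hη _ i).1] using hD.tendsto_integral_frob hD
  have hq' : ∀ n, quadBound KR KT c (η n) ≤
      ν * (dirichlet (fun x => η n x 0) + dirichlet (fun x => η n x 1)) - R (η n) := fun n =>
    hq (η n) fun i => (hη n i).1
  -- Minimality: `β` is the limit of the Dirichlet term plus `ε`, and the remainder is dropped.
  -- Conversely, if `v` does no worse than `u`, the remainder cannot stay away from zero.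
  refine ⟨le_of_forall_pos_le_add fun ε hε => ?_, fun hle => ⟨η, D, hη, hlim, hD, hA, ?_, ?_⟩⟩
  · have hev := (hA.const_mul ν).eventually (gt_mem_nhds (lt_add_of_pos_right _ hε))
    have := h KR KT hKR hKT hp c hc _ (hev.mono fun n hn =>
      ((hq' n).trans (sub_le_self _ (hR _))).trans hn.le).frequently
    linarith
  · refine tendsto_zero_of_forall_frequently_le (hA.const_mul ν) (fun n => hR _) fun β hβ => ?_
    have := h KR KT hKR hKT hp c hc β (hβ.mono fun n hn => (hq' n).trans hn)
    linarith
  · intro c' hc' β hβ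
    have := h KR KT hKR hKT hp c' hc' β hβ
    linarith

/-- The inequality `13/8 * K < ν` leaves a positive multiple of the full Dirichlet integral as
remainder. -/
theorem energy_le_and_eq_of_small {K : ℝ} (hK : 0 ≤ K) (hKν : 13 / 8 * K < ν)
    (hp : ScaledGradBound p K K) :
    energy M u ≤ energy M v ∧ (energy M v ≤ energy M u → v =ᵐ[discMeasure] u) := by
  have hd : ∀ φ : Plane → ℝ, 0 ≤ dirichlet φ := fun φ =>
    integral_nonneg fun x => add_nonneg (sq_nonneg _) (sq_nonneg _)
  obtain ⟨h₁, h₂⟩ := exists_test_maps_remainder hM hsymm hconv hg hu hv hup hK hK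
    (show (0 : ℝ) < 5 / 4 by norm_num) hp
    (R := fun η => (ν - 13 / 8 * K) *
      (dirichlet (fun x => η x 0) + dirichlet (fun x => η x 1)))
    (fun η => mul_nonneg (sub_nonneg.2 hKν.le) (add_nonneg (hd _) (hd _)))
    (fun η hη => (quadBound_le_dirichlet hη hK).trans (le_of_eq (by ring)))
  refine ⟨h₁, fun hle => ?_⟩
  obtain ⟨η, D, hη, hlim, -, -, hR, -⟩ := h₂ hle
  refine ae_eq_of_tendsto_radialEnergy hη hlim ?_
  have hpos : 0 < ν - 13 / 8 * K := sub_pos.2 hKν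
  have ht := hR.const_mul (ν - 13 / 8 * K)⁻¹
  simp only [inv_mul_cancel_left₀ hpos.ne', mul_zero] at ht
  exact tendsto_of_tendsto_of_tendsto_of_le_of_le tendsto_const_nhds ht
    (fun n => add_nonneg (radialEnergy_nonneg _) (radialEnergy_nonneg _)) fun n =>
    add_le_add (radialEnergy_le_dirichlet (hη n 0).1) (radialEnergy_le_dirichlet (hη n 1).1)

variable (hν : 0 < ν)
include hν

/-- The pressure term sees the angular energy only, so the radial energy is the remainder, and it
already controls the `L²` norm of `v - u`. -/
theorem energy_le_and_eq_of_radial (hp : ScaledGradBound p ν 0) :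
    energy M u ≤ energy M v ∧ (energy M v ≤ energy M u → v =ᵐ[discMeasure] u) := by
  obtain ⟨h₁, h₂⟩ := exists_test_maps_remainder hM hsymm hconv hg hu hv hup hν.le le_rfl
    one_pos hp
    (R := fun η => ν * (radialEnergy (fun x => η x 0) + radialEnergy (fun x => η x 1)))
    (fun η => mul_nonneg hν.le (add_nonneg (radialEnergy_nonneg _) (radialEnergy_nonneg _)))
    (fun η hη => (quadBound_radial_eq hη ν).le)
  refine ⟨h₁, fun hle => ?_⟩
  obtain ⟨η, D, hη, hlim, -, -, hR, -⟩ := h₂ hle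
  refine ae_eq_of_tendsto_radialEnergy hη hlim ?_
  have ht := hR.const_mul ν⁻¹
  simpa only [inv_mul_cancel_left₀ hν.ne', mul_zero] using ht

/-- The remainder gives only `radialFluctuation → 0`, hence `fluctuation → 0`; this says nothing yet
about the circular means. A second use of the comparison, with weight 4, bounds `ν ∫ |D|²` by half
of itself, so `D` vanishes. -/
theorem energy_le_and_eq_of_angular (hp : ScaledGradBound p 0 ν) :
    energy M u ≤ energy M v ∧ (energy M v ≤ energy M u → v =ᵐ[discMeasure] u) := by
  obtain ⟨h₁, h₂⟩ := exists_test_maps_remainder hM hsymm hconv hg hu hv hup le_rfl hν.le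
    two_pos hp
    (R := fun η => 3 / 4 * ν *
      (radialFluctuation (fun x => η x 0) + radialFluctuation (fun x => η x 1)))
    (fun η => mul_nonneg (by positivity)
      (add_nonneg (radialFluctuation_nonneg _) (radialFluctuation_nonneg _)))
    (fun η hη => quadBound_angular_le hη hν.le)
  refine ⟨h₁, fun hle => ?_⟩
  obtain ⟨η, D, hη, hlim, hD, hA, hR, hβ⟩ := h₂ hle
  have ht := hR.const_mul (3 / 4 * ν)⁻¹
  simp only [inv_mul_cancel_left₀ (show 3 / 4 * ν ≠ 0 by positivity), mul_zero] at ht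
  have hfl : ∀ i, Tendsto (fun n => fluctuation (fun x => η n x i)) atTop (𝓝 0) := by
    intro i
    refine tendsto_fluctuation (fun n => hη n i) (d := fun j x => D x i j) (fun j => hD i j)
      (tendsto_of_tendsto_of_tendsto_of_le_of_le tendsto_const_nhds ht
        (fun n => radialFluctuation_nonneg _) fun n => ?_)
    have n₀ := radialFluctuation_nonneg fun x => η n x 0
    have n₁ := radialFluctuation_nonneg fun x => η n x 1
    fin_cases i
    · exact le_add_of_nonneg_right n₁
    · exact le_add_of_nonneg_left n₀
  have hL0 : 0 ≤ ∫ x in disc, frob (D x) (D x) := integral_nonneg fun x => frob_self_nonneg _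
  have hL : ∫ x in disc, frob (D x) (D x) = 0 := by
    have hlim' : Tendsto (fun n =>
        2 * ν * (fluctuation (fun x => η n x 0) + fluctuation (fun x => η n x 1)) +
        ν / 2 * (dirichlet (fun x => η n x 0) + dirichlet (fun x => η n x 1))) atTop
        (𝓝 (ν / 2 * ∫ x in disc, frob (D x) (D x))) := by
      simpa using (((hfl 0).add (hfl 1)).const_mul (2 * ν)).add (hA.const_mul (ν / 2))
    have : ν * (∫ x in disc, frob (D x) (D x)) ≤ ν / 2 * ∫ x in disc, frob (D x) (D x) := by
      refine le_of_forall_pos_le_add fun ε hε => hβ 4 (by norm_num) _ ?_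
      exact ((hlim'.eventually (gt_mem_nhds (lt_add_of_pos_right _ hε))).mono fun n hn =>
        (quadBound_angular_le_fluctuation (fun i => (hη n i).1) hν.le).trans hn.le).frequently
    nlinarith
  rw [hL] at hA
  refine ae_eq_of_tendsto_radialEnergy hη hlim ?_
  exact tendsto_of_tendsto_of_tendsto_of_le_of_le tendsto_const_nhds hA
    (fun n => add_nonneg (radialEnergy_nonneg _) (radialEnergy_nonneg _)) fun n =>
    add_le_add (radialEnergy_le_dirichlet (hη n 0).1) (radialEnergy_le_dirichlet (hη n 1).1)

end comparison

/-! ### Assembly of the theorem -/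

theorem isUniqueGlobalMinimizer_of_forall {M : Plane → Tensor4} {g : ℝ → Plane} {b : Plane}
    {u : Plane → Plane} (hu : u ∈ admissible g b)
    (h : ∀ v ∈ admissible g b, energy M u ≤ energy M v ∧
      (energy M v ≤ energy M u → v =ᵐ[discMeasure] u)) :
    IsUniqueGlobalMinimizer M g b u :=
  ⟨⟨hu, fun v hv => (h v hv).1⟩, fun v hv => (h v hv.1).2 (hv.2 u hu)⟩

theorem thirteen_eighths_mul_lt {ν : ℝ} (hν : 0 < ν) : 13 / 8 * (√3 * ν / (2 * √2)) < ν := by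
  have h2 : (√2) ^ 2 = 2 := Real.sq_sqrt (by norm_num)
  have h3 : (√3) ^ 2 = 3 := Real.sq_sqrt (by norm_num)
  have p2 : 0 < √2 := Real.sqrt_pos.2 (by norm_num)
  -- After squaring this is `507 < 512`.
  have hlt : 13 * √3 < 16 * √2 := by
    refine lt_of_pow_lt_pow_left₀ 2 (by positivity) ?_
    rw [mul_pow, mul_pow, h2, h3]
    norm_num
  rw [← mul_div_assoc, div_lt_iff₀ (by positivity)]
  nlinarith

end SmallPressure

end

theorem mainTheorem9
    (M : SmallPressure.Plane → SmallPressure.Tensor4)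
    (hM_bdd : ∀ r s, MemLp (fun x => M x r s) ∞ SmallPressure.discMeasure)
    (hM_symm : ∀ᵐ x ∂SmallPressure.discMeasure, (M x).IsSymm)
    (ν : ℝ) (hν : 0 < ν)
    (hM_conv : ∀ᵐ x ∂SmallPressure.discMeasure, ∀ ξ : SmallPressure.Mat2,
      ν * SmallPressure.frob ξ ξ ≤ SmallPressure.frob (SmallPressure.tensorApply (M x) ξ) ξ)
    (b : SmallPressure.Plane) (g : ℝ → SmallPressure.Plane)
    (hg : ∀ i, SmallPressure.MemW12Circle (fun θ => g θ i))
    (u : SmallPressure.Plane → SmallPressure.Plane) (hu : u ∈ SmallPressure.admissible g b)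
    (p : SmallPressure.Plane → ℝ) (hp : SmallPressure.WeaklyDifferentiable p)
    (hup : SmallPressure.IsStationaryWithPressure M u p) :
    (SmallPressure.polarSupNorm (SmallPressure.scaledGrad p) ≤
        ENNReal.ofReal (√3 * ν / (2 * √2)) →
      SmallPressure.IsGlobalMinimizer M g b u ∧
      (SmallPressure.StrictOnNontrivialSet p (√3 * ν / (2 * √2)) →
        SmallPressure.IsUniqueGlobalMinimizer M g b u)) ∧
    (SmallPressure.DependsOnlyOnRadius p ∨ SmallPressure.DependsOnlyOnAngle p →
      SmallPressure.polarSupNorm (SmallPressure.scaledGrad p) ≤ ENNReal.ofReal ν →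
      SmallPressure.IsGlobalMinimizer M g b u ∧
      (SmallPressure.StrictOnNontrivialSet p ν →
        SmallPressure.IsUniqueGlobalMinimizer M g b u)) := by
  refine ⟨fun hK => ?_, fun hdep hK => ?_⟩
  · have hK0 : 0 ≤ √3 * ν / (2 * √2) := by positivity
    have h := SmallPressure.isUniqueGlobalMinimizer_of_forall hu fun v hv =>
      SmallPressure.energy_le_and_eq_of_small hM_bdd hM_symm hM_conv hg hu hv hup hK0
        (SmallPressure.thirteen_eighths_mul_lt hν) (SmallPressure.scaledGradBound_of_polarSupNorm_le hp hK0 hK)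
    exact ⟨h.1, fun _ => h⟩
  · have h := SmallPressure.isUniqueGlobalMinimizer_of_forall hu fun v hv => hdep.elim
      (fun hrad => SmallPressure.energy_le_and_eq_of_radial hM_bdd hM_symm hM_conv hg hu hv hup hν
        (SmallPressure.scaledGradBound_of_dependsOnlyOnRadius hp hν.le hK hrad))
      (fun hang => SmallPressure.energy_le_and_eq_of_angular hM_bdd hM_symm hM_conv hg hu hv hup hν
        (SmallPressure.scaledGradBound_of_dependsOnlyOnAngle hp hν.le hK hang))
    exact ⟨h.1, fun _ => h⟩
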